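/- **Conventions.** On $\mathbb C^{2n}$ with coordinates $(z^1,\dots,z^n,w_1,\dots,w_n)$ let $\Omega=\sum dz^i\wedge dw_i$ and $\gamma=\sqrt{-1}\,\Omega(\cdot,\overline{\,\cdot\,})$; on $\mathbb C^{2n+2}$, with additional coordinates $z^0,w_0$, let $\hat\Omega,\hat\gamma$ be the analogous forms. An *affine special Kähler manifold* $(M,J,g,\nabla)$ is a complex manifold with a pseudo-Kähler metric $g$ (of any signature), $\omega=g(\cdot,J\cdot)$, and a flat torsion-free connection $\nabla$ with $\nabla\omega=0$ and $d^\nabla J=0$. It is *conical* with vector field $\xi$ if $g(\xi,\xi)\neq0$ everywhere and $\nabla\xi=D\xi=\mathrm{Id}$, where $D$ is the Levi-Civita connection. A holomorphic immersion $\phi$ of a complex $n$-manifold into $\mathbb C^{2n}$ is *Kählerian Lagrangian* if $\phi^*\Omega=0$ and $\phi^*\gamma$ is non-degenerate; it induces the metric $\frac12\mathrm{Re}\,\phi^*\gamma$ and the connection for which the components of $\mathrm{Re}\,\phi$ are affine functions. Let $M$ be a connected affine special Kähler manifold of complex dimension $n$. A *special Kähler pair* of an open set $U\subset M$ is a pair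 $(\phi,F)$ of a Kählerian Lagrangian immersion $\phi=(z,w):U\to\mathbb C^{2n}$ inducing the given structure on $U$ and a holomorphic function $F$ with $dF=\sum w_i\,dz^i$. Its *conification* is $$\Phi=\mathrm{con}(\phi,F):\mathbb C^*\times U\to\mathbb C^{2n+2},\qquad \Phi(z^0,p)=z^0\bigl(1,(2F-z^tw)(p),\phi(p)\bigr)$$ (in the coordinates $(z^0,w_0,z,w)$), and the pair is *non-degenerate* if $\Phi^*\hat\gamma$ is non-degenerate and $\hat\gamma(\Phi,\Phi)$ has no zeros. Let $G_{SK}=\mathrm{Sp}(\mathbb R^{2n})\ltimes\mathrm{Heis}_{2n+1}(\mathbb C)$ be the group of triples $x=(X,s,v)$, $X\in \mathrm{Sp}(\mathbb R^{2n})$, $s\in\mathbb C$, $v\in\mathbb C^{2n}$, with product $(X,s,v)(X',s',v')=(XX',\,s+s'+\tfrac12\Omega(v,Xv'),\,Xv'+v)$, acting on special Kähler pairs by $x\cdot(\phi,F)=(\phi',F')$, where $\phi'=(z',w')=X\phi+v$ and $$F'=F-\tfrac12z^tw+\tfrac12z'^tw'+\tfrac12\Omega(\phi',v)-s,$$ and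 let $G=\mathrm{Sp}(\mathbb R^{2n})\ltimes\mathrm{Heis}_{2n+1}(\mathbb R)\subset G_{SK}$ be the subgroup where $s$ and $v$ are real. Let $P\to M$ be the flat principal $G_{SK}$-bundle of germs of special Kähler pairs, whose local horizontal sections are $q\mapsto[(\phi,F)]_q$ for special Kähler pairs $(\phi,F)$. The holonomy group $\mathrm{Hol}_u$ at $u\in P_p$ is the set of $x\in G_{SK}$ such that $x\cdot u$ is the parallel transport of $u$ along some loop at $p$. A germ is non-degenerate if it is the germ of a non-degenerate pair of some neighbourhood of its base point. For a non-degenerate germ $u$ let $\mathrm{dom}(u)\subset M$ be the set of end points of the curves in $M$ that start at the base point of $u$ and along which the parallel transport of $u$ consists of non-degenerate germs. **Theorem.** Let $u\in P$ be a non-degenerate germ with $\mathrm{Hol}_u\subset G$. Then $\mathrm{dom}(u)$ is open in $M$, and the complex manifold $\hat M_u=\mathbb C^*\times\mathrm{dom}(u)$ carries a conical affine special Kähler structure $(\hat g,\hat\nabla,\xi)$ with the following properties. 1. If $(\phi,F)$ is a special Kähler pair of an open set $U\subset\mathrm{dom}(u)$ all of whose germs can be joined to $u$ by horizontal curves in $P$,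 then $\mathrm{con}(\phi,F)$ is a Kählerian Lagrangian immersion of $\mathbb C^*\times U$ inducing $(\hat g,\hat\nabla)$ there. 2. The holomorphic action $a\cdot(z^0,p)=(az^0,p)$ of $\mathbb C^*$ on $\hat M_u$ is generated by $\xi$ (the derivative at $1$ of the orbit map through $q$ is $c\mapsto \mathrm{Re}(c)\,\xi(q)+\mathrm{Im}(c)\,J\xi(q)$), and the projection $\pi:\hat M_u\to\mathrm{dom}(u)$ is its quotient map: the action is free, and $\pi$ is a surjective holomorphic submersion whose fibres are the orbits. There is a pseudo-Kähler metric $\bar g_u$ on $\mathrm{dom}(u)=\hat M_u/\mathbb C^*$ with $$\pi^*\bar g_u=-\frac{\hat g}{\hat K}+\frac{(\partial\hat K)(\bar\partial\hat K)}{\hat K^2},\qquad \hat K=\hat g(\xi,\xi),$$ so that $(\mathrm{dom}(u),\bar g_u)$ is the projective special Kähler manifold that the ASK/PSK-correspondence assigns to $(M,u)$. -/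

import Mathlib

open Filter Topology Set Bundle
open scoped Manifold ContDiff ComplexConjugate

noncomputable section

namespace SpecialKahler

/-! ### The symplectic vector space and the group of the bundle of special Kähler pairs -/

/-- `ℂ²ⁿ` with coordinates `z i = a (inl i)` and `w i = a (inr i)`. -/
abbrev Phase (n : ℕ) : Type := Fin n ⊕ Fin n → ℂ

variable {n : ℕ}

/-- The standard complex symplectic form `Ω = ∑ dzⁱ ∧ dwᵢ`. -/
def sympl (a b : Phase n) : ℂ :=
  ∑ i, (a (Sum.inl i) * b (Sum.inr i) - a (Sum.inr i) * b (Sum.inl i))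

/-- The Hermitian form `γ = √-1 Ω(·, τ ·)`, where `τ` is complex conjugation. -/
def herm (a b : Phase n) : ℂ :=
  Complex.I * sympl a (fun j => conj (b j))

/-- The pairing `zᵗ w` of the two halves of the coordinates. -/
def zw (a : Phase n) : ℂ := ∑ i, a (Sum.inl i) * a (Sum.inr i)

/-- The linear action of a real symplectic matrix on `ℂ²ⁿ`. -/
def spAct (X : Matrix.symplecticGroup (Fin n) ℝ) (a : Phase n) : Phase n :=
  ((X : Matrix (Fin n ⊕ Fin n) (Fin n ⊕ Fin n) ℝ).map (algebraMap ℝ ℂ)).mulVec a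

theorem sympl_eq (a b : Phase n) :
    sympl a b = - dotProduct a ((Matrix.J (Fin n) ℂ).mulVec b) := by
  simp [sympl, Matrix.J, dotProduct, Matrix.mulVec, Fintype.sum_sum_type, Matrix.one_apply,
    Finset.sum_sub_distrib]
  ring

theorem sympl_add_left (a b c : Phase n) : sympl (a + b) c = sympl a c + sympl b c := by
  simp [sympl_eq, add_dotProduct]; ring

theorem sympl_add_right (a b c : Phase n) : sympl a (b + c) = sympl a b + sympl a c := by
  simp [sympl_eq, Matrix.mulVec_add, dotProduct_add]; ring

theorem sympl_neg_right (a b : Phase n) : sympl a (-b) = - sympl a b := by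
  simp [sympl_eq, Matrix.mulVec_neg]

theorem sympl_self (a : Phase n) : sympl a a = 0 := by
  simp [sympl, mul_comm]

theorem sympl_spAct (X : Matrix.symplecticGroup (Fin n) ℝ) (a b : Phase n) :
    sympl (spAct X a) (spAct X b) = sympl a b := by
  have h := SymplecticGroup.mem_iff'.1
    (SymplecticGroup.map_mem (F := ℝ →+* ℂ) X.2 (algebraMap ℝ ℂ))
  rw [sympl_eq a b, ← h, sympl_eq]
  simp only [spAct, ← Matrix.mulVec_mulVec]
  rw [Matrix.dotProduct_mulVec a, Matrix.vecMul_transpose]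

theorem spAct_add (X : Matrix.symplecticGroup (Fin n) ℝ) (a b : Phase n) :
    spAct X (a + b) = spAct X a + spAct X b := Matrix.mulVec_add _ _ _

theorem spAct_neg (X : Matrix.symplecticGroup (Fin n) ℝ) (a : Phase n) :
    spAct X (-a) = - spAct X a := Matrix.mulVec_neg _ _

theorem spAct_one (a : Phase n) : spAct 1 a = a := by
  simp [spAct]

theorem spAct_mul (X Y : Matrix.symplecticGroup (Fin n) ℝ) (a : Phase n) :
    spAct (X * Y) a = spAct X (spAct Y a) := by
  rw [spAct, spAct, spAct, Matrix.mulVec_mulVec, ← Matrix.map_mul]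
  rfl

variable (n) in
/-- The group `G_SK = Sp(ℝ²ⁿ) ⋉ Heis_{2n+1}(ℂ)`, whose elements are triples `(X, s, v)`. -/
@[ext]
structure GSK where
  X : Matrix.symplecticGroup (Fin n) ℝ
  s : ℂ
  v : Phase n

namespace GSK

instance : Mul (GSK n) :=
  ⟨fun x y => ⟨x.X * y.X, x.s + y.s + 1 / 2 * sympl x.v (spAct x.X y.v), spAct x.X y.v + x.v⟩⟩

instance : One (GSK n) := ⟨⟨1, 0, 0⟩⟩

instance : Inv (GSK n) := ⟨fun x => ⟨x.X⁻¹, -x.s, -spAct x.X⁻¹ x.v⟩⟩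

theorem mul_def (x y : GSK n) : x * y =
    ⟨x.X * y.X, x.s + y.s + 1 / 2 * sympl x.v (spAct x.X y.v), spAct x.X y.v + x.v⟩ := rfl

theorem one_def : (1 : GSK n) = ⟨1, 0, 0⟩ := rfl

theorem inv_def (x : GSK n) : x⁻¹ = ⟨x.X⁻¹, -x.s, -spAct x.X⁻¹ x.v⟩ := rfl

instance : Group (GSK n) :=
  Group.ofLeftAxioms
    (by
      intro x y z
      ext1
      · simp [mul_def, mul_assoc]
      · simp only [mul_def, spAct_add, spAct_mul, sympl_add_left, sympl_add_right, sympl_spAct]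
        ring
      · simp only [mul_def, spAct_add, spAct_mul]
        abel)
    (by
      intro x
      ext1
      · simp [mul_def, one_def]
      · simp [mul_def, one_def, sympl]
      · simp [mul_def, one_def, spAct_one])
    (by
      intro x
      ext1
      · simp [mul_def, one_def, inv_def]
      · have h : sympl (-spAct x.X⁻¹ x.v) (spAct x.X⁻¹ x.v) = 0 := by
          rw [← neg_eq_zero, ← sympl_neg_right, sympl_self]
        change -x.s + x.s + 1 / 2 * sympl (-spAct x.X⁻¹ x.v) (spAct x.X⁻¹ x.v) = 0
        rw [h]
        ring
      · simp [mul_def, one_def, inv_def])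

/-- The values `(φ(p), F(p))` of special Kähler pairs are acted on by
`x · φ = X φ + v` and
`x · F = F - ½ zᵗw + ½ z'ᵗw' + ½ Ω(x φ, v) - s`, where `(z', w') = x φ`. -/
instance : MulAction (GSK n) (Phase n × ℂ) where
  smul x a :=
    (spAct x.X a.1 + x.v,
      a.2 - 1 / 2 * zw a.1 + 1 / 2 * zw (spAct x.X a.1 + x.v)
        + 1 / 2 * sympl (spAct x.X a.1 + x.v) x.v - x.s)
  one_smul a := by
    change (_, _) = a
    ext1
    · simp [one_def, spAct_one]
    · simp [one_def, spAct_one, sympl_eq]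
  mul_smul x y a := by
    change (_, _) = (_, _)
    ext1
    · change _ = spAct x.X (spAct y.X a.1 + y.v) + x.v
      simp only [mul_def, spAct_add, spAct_mul]
      abel
    · have h1 : spAct (x * y).X a.1 + (x * y).v
          = spAct x.X (spAct y.X a.1 + y.v) + x.v := by
        simp only [mul_def, spAct_add, spAct_mul]
        abel
      have h2 : sympl (spAct y.X a.1 + y.v) y.v
          = sympl (spAct x.X (spAct y.X a.1 + y.v)) (spAct x.X y.v) := (sympl_spAct _ _ _).symm
      dsimp only
      rw [h1]
      change _ = (a.2 - 1 / 2 * zw a.1 + 1 / 2 * zw (spAct y.X a.1 + y.v)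
        + 1 / 2 * sympl (spAct y.X a.1 + y.v) y.v - y.s)
        - 1 / 2 * zw (spAct y.X a.1 + y.v)
        + 1 / 2 * zw (spAct x.X (spAct y.X a.1 + y.v) + x.v)
        + 1 / 2 * sympl (spAct x.X (spAct y.X a.1 + y.v) + x.v) x.v - x.s
      rw [h2]
      simp only [mul_def, sympl_add_left, sympl_add_right]
      ring

end GSK

variable (n) in
/-- The real subgroup `G = Sp(ℝ²ⁿ) ⋉ Heis_{2n+1}(ℝ)` of `G_SK`. -/
def realSubgroup : Subgroup (GSK n) where
  carrier := {x | x.s.im = 0 ∧ ∀ j, (x.v j).im = 0}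
  one_mem' := by simp [GSK.one_def]
  mul_mem' := by
    rintro x y ⟨hx, hx'⟩ ⟨hy, hy'⟩
    have h : ∀ j, (spAct x.X y.v j).im = 0 := by
      intro j
      simp [spAct, Matrix.mulVec, dotProduct, hy']
    refine ⟨?_, ?_⟩
    · have h3 : (sympl x.v (spAct x.X y.v)).im = 0 := by
        simp [sympl, hx', h]
      have h4 : (1 / 2 * sympl x.v (spAct x.X y.v)).im = 0 := by
        rw [Complex.mul_im, h3]; norm_num
      simp only [GSK.mul_def, Complex.add_im, hx, hy, h4, add_zero]
    · intro j
      simp [GSK.mul_def, h, hx']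
  inv_mem' := by
    rintro x ⟨hx, hx'⟩
    refine ⟨by simp [GSK.inv_def, hx], fun j => ?_⟩
    simp [GSK.inv_def, spAct, Matrix.mulVec, dotProduct, hx']

/-! ### Complex manifolds as real manifolds, and products with `ℂˣ` -/

section Manifolds

variable {E : Type*} [NormedAddCommGroup E] [NormedSpace ℂ E]
  {M : Type*} [TopologicalSpace M] [ChartedSpace E M]

/-- A complex manifold is a real analytic manifold with the same charts. -/
instance realManifold [IsManifold 𝓘(ℂ, E) ω M] : IsManifold 𝓘(ℝ, E) ω M := by
  refine isManifold_of_contDiffOn 𝓘(ℝ, E) ω M ?_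
  intro e e' he he'
  have h := (contDiffGroupoid ω 𝓘(ℂ, E)).compatible he he'
  rw [contDiffGroupoid, mem_groupoid_of_pregroupoid] at h
  exact ContDiffOn.restrict_scalars ℝ h.1

/-- The product charts on `ℂˣ × M`, with `ℂˣ` an open subset of `ℂ`. -/
instance conicalChartedSpace : ChartedSpace (ℂ × E) (ℂˣ × M) :=
  inferInstanceAs (ChartedSpace (ModelProd ℂ E) (ℂˣ × M))

instance conicalManifold [IsManifold 𝓘(ℂ, E) ω M] : IsManifold 𝓘(ℂ, ℂ × E) ω (ℂˣ × M) := by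
  rw [modelWithCornersSelf_prod]
  exact IsManifold.prod (I := 𝓘(ℂ, ℂ)) (I' := 𝓘(ℂ, E)) (n := ω) ℂˣ M

end Manifolds

/-! ### Special Kähler geometry on a complex manifold -/

section Geometry

variable (E : Type*) [NormedAddCommGroup E] [NormedSpace ℂ E]
  (M : Type*) [TopologicalSpace M] [ChartedSpace E M]

/-- Vector fields on the real manifold underlying a complex manifold. -/
abbrev VField : Type _ := (x : M) → TangentSpace 𝓘(ℝ, E) x

/-- Real bilinear forms on all (real) tangent spaces. -/
abbrev BilinField : Type _ :=
  (x : M) → TangentSpace 𝓘(ℝ, E) x →L[ℝ] TangentSpace 𝓘(ℝ, E) x →L[ℝ] ℝ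

variable {E M}

/-- The complex structure: multiplication by `√-1` in holomorphic charts. -/
def cplxJ (x : M) : TangentSpace 𝓘(ℝ, E) x →L[ℝ] TangentSpace 𝓘(ℝ, E) x :=
  (Complex.I • ContinuousLinearMap.id ℝ E : E →L[ℝ] E)

/-- The derivative of a vector valued function on the underlying real manifold. -/
def dR {W : Type*} [NormedAddCommGroup W] [NormedSpace ℝ W] (f : M → W) (x : M) :
    TangentSpace 𝓘(ℝ, E) x →L[ℝ] W :=
  mvfderiv 𝓘(ℝ, E) f x

section

variable [IsManifold 𝓘(ℂ, E) ω M]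

/-- The vector field `X` is differentiable at `x`. -/
def VDiffAt (X : VField E M) (x : M) : Prop :=
  MDifferentiableAt 𝓘(ℝ, E) 𝓘(ℝ, E).tangent
    (fun y => (⟨y, X y⟩ : TangentBundle 𝓘(ℝ, E) M)) x

/-- The vector field `X` is smooth. -/
def VSmooth (X : VField E M) : Prop :=
  ContMDiff 𝓘(ℝ, E) 𝓘(ℝ, E).tangent ∞ (fun y => (⟨y, X y⟩ : TangentBundle 𝓘(ℝ, E) M))

variable (E M) in
/-- A pseudo-Kähler metric on a complex manifold: a smooth, symmetric, non-degenerate,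
`J`-invariant bilinear form `g` such that `ω = g(·, J ·)` is closed. -/
structure PseudoKahler where
  g : BilinField E M
  smooth : ContMDiff 𝓘(ℝ, E) (𝓘(ℝ, E).prod 𝓘(ℝ, E →L[ℝ] E →L[ℝ] ℝ)) ∞
    (fun x => TotalSpace.mk' (E →L[ℝ] E →L[ℝ] ℝ)
      (E := fun x : M => TangentSpace 𝓘(ℝ, E) x →L[ℝ] TangentSpace 𝓘(ℝ, E) x →L[ℝ] ℝ) x (g x))
  symm : ∀ x v w, g x v w = g x w v
  nondeg : ∀ x v, (∀ w, g x v w = 0) → v = 0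
  invariant : ∀ x v w, g x (cplxJ x v) (cplxJ x w) = g x v w
  closed : ∀ (X Y Z : VField E M) (x : M), VDiffAt X x → VDiffAt Y x → VDiffAt Z x →
    dR (fun y => g y (Y y) (cplxJ y (Z y))) x (X x)
      + dR (fun y => g y (Z y) (cplxJ y (X y))) x (Y x)
      + dR (fun y => g y (X y) (cplxJ y (Y y))) x (Z x)
      - g x (VectorField.mlieBracket 𝓘(ℝ, E) X Y x) (cplxJ x (Z x))
      - g x (VectorField.mlieBracket 𝓘(ℝ, E) Y Z x) (cplxJ x (X x))
      - g x (VectorField.mlieBracket 𝓘(ℝ, E) Z X x) (cplxJ x (Y x)) = 0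

/-- The Kähler form `ω = g(·, J ·)`. -/
def PseudoKahler.form (S : PseudoKahler E M) (x : M) (v w : TangentSpace 𝓘(ℝ, E) x) : ℝ :=
  S.g x v (cplxJ x w)

variable (E M) in
/-- Connections on the tangent bundle; `D Y x (X x)` is `(D_X Y)(x)`. -/
abbrev Connection : Type _ :=
  CovariantDerivative 𝓘(ℝ, E) E (fun x : M => TangentSpace 𝓘(ℝ, E) x)

/-- `D_X Y - D_Y X = [X, Y]`. -/
def IsTorsionFree (D : Connection E M) : Prop :=
  ∀ (X Y : VField E M) (x : M), VDiffAt X x → VDiffAt Y x →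
    D Y x (X x) - D X x (Y x) = VectorField.mlieBracket 𝓘(ℝ, E) X Y x

/-- `D_X D_Y Z - D_Y D_X Z = D_[X, Y] Z`. -/
def IsFlat (D : Connection E M) : Prop :=
  ∀ X Y Z : VField E M, VSmooth X → VSmooth Y → VSmooth Z → ∀ x,
    D (fun y => D Z y (Y y)) x (X x) - D (fun y => D Z y (X y)) x (Y x)
      = D Z x (VectorField.mlieBracket 𝓘(ℝ, E) X Y x)

/-- `D` is the Levi-Civita connection of the metric. -/
def IsLeviCivita (S : PseudoKahler E M) (D : Connection E M) : Prop :=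
  IsTorsionFree D ∧
    ∀ (Y Z : VField E M) (x : M) (v : TangentSpace 𝓘(ℝ, E) x), VDiffAt Y x → VDiffAt Z x →
      dR (fun y => S.g y (Y y) (Z y)) x v = S.g x (D Y x v) (Z x) + S.g x (Y x) (D Z x v)

variable (E M) in
/-- Affine special Kähler structures on a complex manifold: a pseudo-Kähler metric and a smooth
flat torsion-free connection `∇` with `∇ω = 0` and `d^∇ J = 0`. -/
structure AffineSpecialKahler extends PseudoKahler E M where
  conn : Connection E M
  conn_smooth : CovariantDerivative.ContMDiffCovariantDerivative conn ∞
  torsionFree : IsTorsionFree conn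
  flat : IsFlat conn
  form_parallel : ∀ (Y Z : VField E M) (x : M) (v : TangentSpace 𝓘(ℝ, E) x),
    VDiffAt Y x → VDiffAt Z x →
      dR (fun y => toPseudoKahler.form y (Y y) (Z y)) x v
        = toPseudoKahler.form x (conn Y x v) (Z x) + toPseudoKahler.form x (Y x) (conn Z x v)
  dJ_eq_zero : ∀ (X Y : VField E M) (x : M), VDiffAt X x → VDiffAt Y x →
    conn (fun y => cplxJ y (Y y)) x (X x) - conn (fun y => cplxJ y (X y)) x (Y x)
      - cplxJ x (VectorField.mlieBracket 𝓘(ℝ, E) X Y x) = 0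

variable (E M) in
/-- Conical affine special Kähler structures: in addition a vector field `ξ` with
`g(ξ, ξ) ≠ 0` everywhere and `∇ξ = Dξ = Id`, where `D` is the Levi-Civita connection. -/
structure ConicalAffineSpecialKahler extends AffineSpecialKahler E M where
  ξ : VField E M
  ξ_smooth : VSmooth ξ
  norm_ξ_ne_zero : ∀ x, g x (ξ x) (ξ x) ≠ 0
  conn_ξ : ∀ x v, conn ξ x v = v
  leviCivita_ξ : ∃ D : Connection E M, IsLeviCivita toPseudoKahler D ∧ ∀ x v, D ξ x v = v

/-! ### The projective special Kähler quotient -/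

namespace ConicalAffineSpecialKahler

variable (S : ConicalAffineSpecialKahler E M)

/-- The function `K̂ = ĝ(ξ, ξ)`. -/
def potential (x : M) : ℝ := S.g x (S.ξ x) (S.ξ x)

/-- The symmetric tensor `g' = -ĝ / K̂ + (∂K̂)(∂̄K̂) / K̂²`; as a real bilinear form the symmetric
product `(∂K̂)(∂̄K̂)` is
`(v, w) ↦ Re (∂K̂(v) ∂̄K̂(w)) = ¼ (dK̂(v) dK̂(w) + dK̂(J v) dK̂(J w))`. -/
def quotientTensor (x : M) (v w : TangentSpace 𝓘(ℝ, E) x) : ℝ :=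
  - S.g x v w / S.potential x
    + (dR S.potential x v * dR S.potential x w
        + dR S.potential x (cplxJ x v) * dR S.potential x (cplxJ x w))
      / (4 * S.potential x ^ 2)

/-- `(B, h)` is the projective special Kähler manifold obtained from the conical affine special
Kähler manifold `(M, S)`: the holomorphic vector field determined by `ξ` generates a principal
`ℂˣ`-action `act` with quotient map `pr : M → B`, and `h` is a pseudo-Kähler metric with
`pr^* h = g'`. -/
structure IsProjectiveQuotient {E' : Type*} [NormedAddCommGroup E'] [NormedSpace ℂ E']
    {B : Type*} [TopologicalSpace B] [ChartedSpace E' B] [IsManifold 𝓘(ℂ, E') ω B]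
    (S : ConicalAffineSpecialKahler E M) (act : ℂˣ → M → M) (pr : M → B)
    (h : PseudoKahler E' B) : Prop where
  act_one : ∀ x, act 1 x = x
  act_mul : ∀ a b x, act (a * b) x = act a (act b x)
  act_holomorphic : MDifferentiable 𝓘(ℂ, ℂ × E) 𝓘(ℂ, E) (fun q : ℂˣ × M => act q.1 q.2)
  act_free : ∀ a x, act a x = x → a = 1
  /-- The derivative at `1` of the orbit map through `x` is `c ↦ c ξ(x) = Re(c) ξ(x) + Im(c) J ξ(x)`. -/
  generator : ∀ x, ∀ c : ℂ,
    mfderiv 𝓘(ℝ, ℂ) 𝓘(ℝ, E) (fun a : ℂˣ => act a x) 1 c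
      = c.re • S.ξ (act 1 x) + c.im • cplxJ (act 1 x) (S.ξ (act 1 x))
  pr_surjective : Function.Surjective pr
  pr_holomorphic : MDifferentiable 𝓘(ℂ, E) 𝓘(ℂ, E') pr
  pr_submersion : ∀ x, Function.Surjective (mfderiv 𝓘(ℝ, E) 𝓘(ℝ, E') pr x)
  pr_fibres : ∀ x y, pr x = pr y ↔ ∃ a, y = act a x
  pullback : ∀ x (v w : TangentSpace 𝓘(ℝ, E) x),
    h.g (pr x) (mfderiv 𝓘(ℝ, E) 𝓘(ℝ, E') pr x v) (mfderiv 𝓘(ℝ, E) 𝓘(ℝ, E') pr x w)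
      = S.quotientTensor x v w

end ConicalAffineSpecialKahler

/-! ### Special Kähler pairs and their conification -/

/-- `φ^*γ` is non-degenerate at `x`. -/
def IsKahlerianAt (φ : M → Phase n) (x : M) : Prop :=
  ∀ v : TangentSpace 𝓘(ℝ, E) x, (∀ w : TangentSpace 𝓘(ℝ, E) x,
    herm (dR φ x v) (dR φ x w) = 0) → v = 0

variable (E) in
/-- `φ` is, on the open set `U` of the complex `n`-manifold `M`, a Kählerian Lagrangian (holomorphic)
immersion into `ℂ²ⁿ`. -/
structure IsKahlerianLagrangian (U : Set M) (φ : M → Phase n) : Prop where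
  holomorphic : ∀ x ∈ U, MDifferentiableAt 𝓘(ℂ, E) 𝓘(ℂ, Phase n) φ x
  immersion : ∀ x ∈ U, Function.Injective (dR (E := E) φ x)
  lagrangian : ∀ x ∈ U, ∀ v w : TangentSpace 𝓘(ℝ, E) x, sympl (dR φ x v) (dR φ x w) = 0
  kahlerian : ∀ x ∈ U, IsKahlerianAt (E := E) φ x

/-- The affine special Kähler structure induced by `φ` on `U` is the restriction of `S`: the metric
is `½ Re φ^*γ` (so that `½ γ(φ, φ)` is a Kähler potential) and the connection is the one for which
the functions `Re φ` are affine, i.e. `(d Re φ)(∇_v Y) = v((d Re φ)(Y))`. -/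
structure AffineSpecialKahler.IsInducedBy (S : AffineSpecialKahler E M) (U : Set M)
    (φ : M → Phase n) : Prop where
  metric : ∀ x ∈ U, ∀ v w, S.g x v w = 1 / 2 * (herm (dR φ x v) (dR φ x w)).re
  connection : ∀ x ∈ U, ∀ (Y : VField E M) (v : TangentSpace 𝓘(ℝ, E) x), VDiffAt Y x → ∀ j,
    (dR φ x (S.conn Y x v) j).re = dR (fun y => (dR φ y (Y y) j).re) x v

/-- `(φ, F)` is a special Kähler pair of `U`: a Kählerian Lagrangian immersion inducing the given
structure, and a holomorphic prepotential, `dF = ∑ wᵢ dzⁱ`. -/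
structure IsSpecialKahlerPair (S : AffineSpecialKahler E M) (U : Set M)
    (φ : M → Phase n) (F : M → ℂ) : Prop where
  isKahlerianLagrangian : IsKahlerianLagrangian E U φ
  induced : S.IsInducedBy U φ
  prepotential_holomorphic : ∀ x ∈ U, MDifferentiableAt 𝓘(ℂ, E) 𝓘(ℂ, ℂ) F x
  prepotential : ∀ x ∈ U, ∀ v : TangentSpace 𝓘(ℝ, E) x,
    dR F x v = ∑ i, φ x (Sum.inr i) * dR φ x v (Sum.inl i)

end

/-- The conification `Φ(z⁰, p) = z⁰ (1, (2F - zᵗw)(p), φ(p))`, where `ℂ²ⁿ⁺²` has coordinates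
`(z⁰, …, zⁿ, w₀, …, wₙ)`, the additional coordinates being those with index `0`. -/
def conification {N : Type*} (φ : N → Phase n) (F : N → ℂ) (q : ℂˣ × N) : Phase (n + 1) :=
  (q.1 : ℂ) • Sum.elim
    (Fin.cons 1 (fun i => φ q.2 (Sum.inl i)))
    (Fin.cons (2 * F q.2 - zw (φ q.2)) (fun i => φ q.2 (Sum.inr i)))

variable [IsManifold 𝓘(ℂ, E) ω M] (S : AffineSpecialKahler E M)

/-- A special Kähler pair of `U` is non-degenerate if its conification `Φ` is Kählerian and
`γ̂(Φ, Φ)` has no zeros on `ℂˣ × U`. -/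
structure IsNondegeneratePair (U : Set M) (φ : M → Phase n) (F : M → ℂ) : Prop
    extends IsSpecialKahlerPair S U φ F where
  kahlerian : ∀ q : ℂˣ × M, q.2 ∈ U → IsKahlerianAt (E := ℂ × E) (conification φ F) q
  norm_ne_zero : ∀ q : ℂˣ × M, q.2 ∈ U → herm (conification φ F q) (conification φ F q) ≠ 0

/-! ### The bundle of germs of special Kähler pairs, parallel transport and holonomy -/

/-- The germ at `p` of `(φ, F)`. -/
def germAt (φ : M → Phase n) (F : M → ℂ) (p : M) : Germ (𝓝 p) (Phase n × ℂ) :=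
  ((fun y => (φ y, F y) : M → Phase n × ℂ) : Germ (𝓝 p) (Phase n × ℂ))

variable (n) in
/-- The total space `P` of the bundle of germs of special Kähler pairs; the projection to `M` is
`u ↦ u.1`. -/
def SKBundle : Type _ :=
  Σ p : M, {u : Germ (𝓝 p) (Phase n × ℂ) //
    ∃ (U : Set M) (φ : M → Phase n) (F : M → ℂ), IsOpen U ∧ p ∈ U ∧
      IsSpecialKahlerPair S U φ F ∧ u = germAt φ F p}

variable {S}

/-- `u` is the germ of the pair `(φ, F)` at the base point of `u`. -/
def SKBundle.IsGermOf (u : SKBundle n S) (φ : M → Phase n) (F : M → ℂ) : Prop :=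
  u.2.1 = germAt φ F u.1

/-- `u` is the germ of a non-degenerate special Kähler pair of a neighbourhood of its base point. -/
def SKBundle.IsNondegenerate (u : SKBundle n S) : Prop :=
  ∃ (U : Set M) (φ : M → Phase n) (F : M → ℂ), IsOpen U ∧ u.1 ∈ U ∧
    IsNondegeneratePair S U φ F ∧ u.IsGermOf φ F

/-- `u' = x · u` for the action of `G_SK` on the fibres of `P`. -/
def SKBundle.IsTranslate (x : GSK n) (u u' : SKBundle n S) : Prop :=
  ∃ φ F φ' F', u.IsGermOf φ F ∧ u'.IsGermOf φ' F' ∧ u'.1 = u.1 ∧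
    ∀ y, (φ' y, F' y) = x • (φ y, F y)

/-- The horizontal curves of the flat connection of `P`. The horizontal sections are the sections
`q ↦ [(φ, F)]_q` given by special Kähler pairs, so a curve in `P` over a continuous curve in `M` is
horizontal if locally it runs in such sections. -/
def IsHorizontal (c : unitInterval → SKBundle n S) : Prop :=
  Continuous (fun t => (c t).1) ∧
    ∀ t, ∃ (U : Set M) (φ : M → Phase n) (F : M → ℂ), IsOpen U ∧ (c t).1 ∈ U ∧
      IsSpecialKahlerPair S U φ F ∧ ∀ᶠ s in 𝓝 t, (c s).IsGermOf φ F

/-- The holonomy group of the flat connection of `P` at the point `u`: the set of `x ∈ G_SK` such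
that `x · u` is the parallel transport of `u` along some loop. -/
def holonomy (u : SKBundle n S) : Set (GSK n) :=
  {x | ∃ c : unitInterval → SKBundle n S, IsHorizontal c ∧ c 0 = u ∧ SKBundle.IsTranslate x u (c 1)}

/-- The set `P(u)` of points of `P` that can be joined to `u` by a horizontal curve. -/
def horizontalLeaf (u : SKBundle n S) : Set (SKBundle n S) :=
  {u' | ∃ c : unitInterval → SKBundle n S, IsHorizontal c ∧ c 0 = u ∧ c 1 = u'}

/-- The domain of non-degeneracy of `u`: the points of `M` that are reached from the base point of
`u` by a curve along which the analytic continuation of `u` stays non-degenerate. -/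
def dom (u : SKBundle n S) : Set M :=
  {p | ∃ c : unitInterval → SKBundle n S, IsHorizontal c ∧ c 0 = u ∧ (c 1).1 = p ∧
    ∀ t, (c t).IsNondegenerate}

end Geometry

end SpecialKahler

end

/-! Locally the theorem is linear algebra in `ℂ²ⁿ⁺²`. For a special Kähler pair put Ψ = (1, 2F -
zᵗw, φ), so that its conification is Φ = z⁰Ψ. Because dF = ∑ wᵢ dzⁱ, the form Ω̂(Ψ, dΨ) vanishes,
and Ω̂ restricted to dΨ is φ^*Ω = 0; hence Φ is Lagrangian
(`IsNondegeneratePair.isKahlerianLagrangian_conification`).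

The global point is that different continuations of u give compatible conifications. Two
continuations over the same point differ by some x in G_SK (`IsSpecialKahlerPair.exists_eq_smul`).
Parallel transport commutes with the action, so x⁻¹ lies in the holonomy group of u and x is real
(`SKBundle.exists_realSubgroup`). Conification intertwines the action of G_SK with a linear
representation on `ℂ²ⁿ⁺²` that preserves Ω̂ (`lift_smul`), and for real s and v it commutes with
conjugation (`isRealSympl_linear`). Such maps preserve γ̂ and act linearly on real parts, so the
conifications induce the same metric and the same connection (`InducesAt.comp_real`), which
therefore glue over the whole of ℂˣ × dom u.

For a Kählerian Lagrangian immersion the real part is a local diffeomorphism, and in these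
coordinates ∇ is the ordinary derivative while ω is a constant form. Torsion-freeness, flatness,
d^∇J = 0 and dω = 0 are then instances of the symmetry of second derivatives (`dR_bracket`). The
field ξ generating the scaling of z⁰ satisfies dΦ(ξ) = Φ, whence ∇ξ = Id and ∇(Jξ) = J; since the
Levi-Civita connection is ½(∇ - J∇J), also Dξ = Id.

On {γ̂(A, A) ≠ 0} the Hermitian form `projHerm` kills the radial direction and is scale invariant
(`projHerm_invariant`). Its real part pulls back to the quotient metric along Ψ, and to π^* of that
metric along Φ. The metric is non-degenerate since Φ^*γ̂ is; it is closed because Ψ can be rescaled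
near a point to constant norm, which turns the Kähler form into the pull-back of a constant
alternating form (`ProjectiveAtlas.exists_form_eq`). -/

noncomputable section

namespace SpecialKahler

variable {n : ℕ}

/-! ### Differentials, vector fields and Lie brackets read in charts. -/

section Calculus
variable {E : Type*} [NormedAddCommGroup E] [NormedSpace ℂ E]
  {M : Type*} [TopologicalSpace M] [ChartedSpace E M] [IsManifold 𝓘(ℂ, E) ω M]
  {W : Type*} [NormedAddCommGroup W] [NormedSpace ℝ W]

/-- The tangent vectors at `y` with given coordinates in the chart at `x₀`. -/
def frame (x₀ y : M) : E →L[ℝ] TangentSpace 𝓘(ℝ, E) y :=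
  (trivializationAt E (TangentSpace 𝓘(ℝ, E)) x₀).symmL ℝ y

/-- The coordinates of a tangent vector at `y` in the chart at `x₀`. -/
def coframe (x₀ y : M) : TangentSpace 𝓘(ℝ, E) y →L[ℝ] E :=
  (trivializationAt E (TangentSpace 𝓘(ℝ, E)) x₀).continuousLinearMapAt ℝ y

theorem frame_coframe {x₀ y : M} (hy : y ∈ (chartAt E x₀).source) (v : TangentSpace 𝓘(ℝ, E) y) :
    frame x₀ y (coframe x₀ y v) = v :=
  (trivializationAt E (TangentSpace 𝓘(ℝ, E)) x₀).symmL_continuousLinearMapAt (by simpa using hy) v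

theorem coframe_frame {x₀ y : M} (hy : y ∈ (chartAt E x₀).source) (v : E) :
    coframe x₀ y (frame x₀ y v) = v :=
  (trivializationAt E (TangentSpace 𝓘(ℝ, E)) x₀).continuousLinearMapAt_symmL (by simpa using hy) v

/-- The differential lives on a varying tangent space; composing with `frame` gives a map into a
fixed space of operators, for which regularity is the usual statement on derivatives in tangent
coordinates. -/
theorem contMDiffAt_dR_frame {k m : ℕ∞ω} {f : M → W} {x₀ : M}
    (hf : ContMDiffAt 𝓘(ℝ, E) 𝓘(ℝ, W) k f x₀) (hmk : m + 1 ≤ k) :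
    ContMDiffAt 𝓘(ℝ, E) 𝓘(ℝ, E →L[ℝ] W) m (fun y : M => (dR (E := E) f y).comp (frame (E := E) x₀ y)) x₀ := by
  refine (ContMDiffAt.mfderiv_const hf hmk).congr_of_eventuallyEq (.of_forall fun y => ?_)
  ext v
  simp only [inTangentCoordinates, ContinuousLinearMap.inCoordinates,
    TangentBundle.continuousLinearMapAt_model_space]
  rfl

theorem vDiffAt_iff {X : VField E M} {x : M} :
    VDiffAt X x ↔ MDifferentiableAt 𝓘(ℝ, E) 𝓘(ℝ, E) (fun y => coframe x y (X y)) x := by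
  rw [VDiffAt, mdifferentiableAt_section]
  refine (Filter.EventuallyEq.mdifferentiableAt_iff ?_)
  filter_upwards [(chartAt E x).open_source.mem_nhds (mem_chart_source E x)] with y hy
  rw [coframe, Bundle.Trivialization.continuousLinearMapAt_apply,
    Bundle.Trivialization.linearMapAt_apply, if_pos (by simpa using hy)]

theorem contMDiffAt_vField_iff {k : ℕ∞ω} {X : VField E M} {x : M} :
    ContMDiffAt 𝓘(ℝ, E) 𝓘(ℝ, E).tangent k (fun y => (⟨y, X y⟩ : TangentBundle 𝓘(ℝ, E) M)) x ↔
      ContMDiffAt 𝓘(ℝ, E) 𝓘(ℝ, E) k (fun y => coframe x y (X y)) x := by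
  rw [Bundle.contMDiffAt_section]
  refine (Filter.EventuallyEq.contMDiffAt_iff ?_)
  filter_upwards [(chartAt E x).open_source.mem_nhds (mem_chart_source E x)] with y hy
  rw [coframe, Bundle.Trivialization.continuousLinearMapAt_apply,
    Bundle.Trivialization.linearMapAt_apply, if_pos (by simpa using hy)]

theorem eventually_dR_eq_frame (f : M → W) (X : VField E M) (x : M) :
    (fun y => dR f y (X y)) =ᶠ[𝓝 x] fun y => (dR f y).comp (frame x y) (coframe x y (X y)) := by
  filter_upwards [(chartAt E x).open_source.mem_nhds (mem_chart_source E x)] with y hy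
  rw [ContinuousLinearMap.comp_apply, frame_coframe hy]

theorem mdifferentiableAt_dR_apply {f : M → W} {X : VField E M} {x : M}
    (hf : ContMDiffAt 𝓘(ℝ, E) 𝓘(ℝ, W) 2 f x) (hX : VDiffAt X x) :
    MDifferentiableAt 𝓘(ℝ, E) 𝓘(ℝ, W) (fun y => dR f y (X y)) x := by
  refine MDifferentiableAt.congr_of_eventuallyEq ?_ (eventually_dR_eq_frame f X x)
  exact ((contMDiffAt_dR_frame (m := 1) hf le_rfl).mdifferentiableAt one_ne_zero).clm_apply
    (vDiffAt_iff.1 hX)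

theorem contMDiffAt_dR_apply {k m : ℕ∞ω} {f : M → W} {X : VField E M} {x : M}
    (hf : ContMDiffAt 𝓘(ℝ, E) 𝓘(ℝ, W) k f x) (hmk : m + 1 ≤ k)
    (hX : ContMDiffAt 𝓘(ℝ, E) 𝓘(ℝ, E).tangent m
      (fun y => (⟨y, X y⟩ : TangentBundle 𝓘(ℝ, E) M)) x) :
    ContMDiffAt 𝓘(ℝ, E) 𝓘(ℝ, W) m (fun y => dR f y (X y)) x := by
  refine ContMDiffAt.congr_of_eventuallyEq ?_ (eventually_dR_eq_frame f X x)
  exact (contMDiffAt_dR_frame hf hmk).clm_apply (contMDiffAt_vField_iff.1 hX)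

omit [IsManifold 𝓘(ℂ, E) ω M] in
set_option synthInstance.maxHeartbeats 200000 in
theorem _root_.ContMDiffAt.bilinearComp_self {V : Type*} [NormedAddCommGroup V] [NormedSpace ℝ V]
    {k : ℕ∞ω} {C : M → W →L[ℝ] W →L[ℝ] ℝ} {A : M → V →L[ℝ] W} {x : M}
    (hC : ContMDiffAt 𝓘(ℝ, E) 𝓘(ℝ, W →L[ℝ] W →L[ℝ] ℝ) k C x)
    (hA : ContMDiffAt 𝓘(ℝ, E) 𝓘(ℝ, V →L[ℝ] W) k A x) :
    ContMDiffAt 𝓘(ℝ, E) 𝓘(ℝ, V →L[ℝ] V →L[ℝ] ℝ) k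
      (fun y => (C y).bilinearComp (A y) (A y)) x := by
  -- The form is rewritten as two compositions of continuous linear maps, to which the rule for
  -- composition applies.
  have h2 : ContMDiffAt 𝓘(ℝ, E) 𝓘(ℝ, V →L[ℝ] V →L[ℝ] ℝ) k
      (fun y : M => ((ContinuousLinearMap.compL ℝ V W ℝ).flip (A y)).comp ((C y).comp (A y))) x :=
    ContMDiffAt.clm_comp (contMDiffAt_const.clm_apply hA) (hC.clm_comp hA)
  exact h2

/-- A section of the bundle of bilinear forms is smooth if it is the pull-back of a smooth
form on a vector space. -/
theorem contMDiffAt_bilin_dR {f : M → W} {C : M → W →L[ℝ] W →L[ℝ] ℝ} {x : M}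
    (hf : ContMDiffAt 𝓘(ℝ, E) 𝓘(ℝ, W) ∞ f x)
    (hC : ContMDiffAt 𝓘(ℝ, E) 𝓘(ℝ, W →L[ℝ] W →L[ℝ] ℝ) ∞ C x) {g : BilinField E M}
    (hg : ∀ᶠ y in 𝓝 x, ∀ v w, g y v w = C y (dR f y v) (dR f y w)) :
    ContMDiffAt 𝓘(ℝ, E) (𝓘(ℝ, E).prod 𝓘(ℝ, E →L[ℝ] E →L[ℝ] ℝ)) ∞
      (fun x => TotalSpace.mk' (E →L[ℝ] E →L[ℝ] ℝ)
        (E := fun x : M => TangentSpace 𝓘(ℝ, E) x →L[ℝ] TangentSpace 𝓘(ℝ, E) x →L[ℝ] ℝ)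
        x (g x)) x := by
  rw [contMDiffAt_hom_bundle]
  refine ⟨contMDiffAt_id, ?_⟩
  refine (hC.bilinearComp_self (contMDiffAt_dR_frame (m := ∞) hf le_rfl)).congr_of_eventuallyEq ?_
  filter_upwards [hg, (chartAt E x).open_source.mem_nhds (mem_chart_source E x)] with y hy hy'
  ext v w
  rw [inCoordinates_apply_eq₂ (by simpa using hy') (by simpa using hy') (by simp)]
  have hb : y ∈ (trivializationAt E (TangentSpace 𝓘(ℝ, E)) x).baseSet := by simpa using hy'
  simp only [hy, frame]
  simp [Bundle.Trivialization.symmL_apply _ hb]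

theorem frame_eq {x y : M} (hy : y ∈ (chartAt E x).source) :
    frame (E := E) x y = mfderivWithin 𝓘(ℝ, E) 𝓘(ℝ, E) (extChartAt 𝓘(ℝ, E) x).symm
      (range 𝓘(ℝ, E)) (extChartAt 𝓘(ℝ, E) x y) :=
  TangentBundle.symmL_trivializationAt hy

theorem coframe_eq {x y : M} (hy : y ∈ (chartAt E x).source) :
    coframe (E := E) x y = mfderiv 𝓘(ℝ, E) 𝓘(ℝ, E) (extChartAt 𝓘(ℝ, E) x) y :=
  TangentBundle.continuousLinearMapAt_trivializationAt hy

theorem frame_comp_coframe {x y : M} (hy : y ∈ (chartAt E x).source) :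
    (frame (E := E) x y).comp (coframe x y) = ContinuousLinearMap.id ℝ _ :=
  ContinuousLinearMap.ext fun v => frame_coframe hy v

theorem coframe_comp_frame {x y : M} (hy : y ∈ (chartAt E x).source) :
    (coframe (E := E) x y).comp (frame x y) = ContinuousLinearMap.id ℝ _ :=
  ContinuousLinearMap.ext fun v => coframe_frame hy v

/-- `frame` is the derivative of the inverse chart, so this is the chain rule. -/
theorem dR_comp_frame_symm {f : M → W} {x : M} {z : E} (hz : z ∈ (extChartAt 𝓘(ℝ, E) x).target)
    (hf : MDifferentiableAt 𝓘(ℝ, E) 𝓘(ℝ, W) f ((extChartAt 𝓘(ℝ, E) x).symm z)) :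
    (dR f ((extChartAt 𝓘(ℝ, E) x).symm z)).comp (frame (E := E) x _) =
      fderiv ℝ (f ∘ (extChartAt 𝓘(ℝ, E) x).symm) z := by
  have h1 : MDifferentiableAt 𝓘(ℝ, E) 𝓘(ℝ, E) (extChartAt 𝓘(ℝ, E) x).symm z := by
    have := mdifferentiableWithinAt_extChartAt_symm (I := 𝓘(ℝ, E)) hz
    rwa [ModelWithCorners.range_eq_univ, mdifferentiableWithinAt_univ] at this
  have h0 : (extChartAt 𝓘(ℝ, E) x).symm z ∈ (chartAt E x).source := by
    simpa using (extChartAt 𝓘(ℝ, E) x).map_target hz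
  rw [← mfderiv_eq_fderiv, mfderiv_comp z hf h1, frame_eq h0, (extChartAt 𝓘(ℝ, E) x).right_inv hz,
    ModelWithCorners.range_eq_univ, mfderivWithin_univ]
  rfl

theorem dR_comp_frame_eq {f : M → W} {x y : M} (hy : y ∈ (chartAt E x).source)
    (hf : MDifferentiableAt 𝓘(ℝ, E) 𝓘(ℝ, W) f y) :
    (dR f y).comp (frame (E := E) x y) =
      fderiv ℝ (f ∘ (extChartAt 𝓘(ℝ, E) x).symm) (extChartAt 𝓘(ℝ, E) x y) := by
  have hy' : y ∈ (extChartAt 𝓘(ℝ, E) x).source := by simpa using hy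
  have h2 : (extChartAt 𝓘(ℝ, E) x).symm (extChartAt 𝓘(ℝ, E) x y) = y :=
    (extChartAt 𝓘(ℝ, E) x).left_inv hy'
  have := dR_comp_frame_symm (f := f) ((extChartAt 𝓘(ℝ, E) x).map_source hy') (by rwa [h2])
  rwa [h2] at this

/-- The local representation of a vector field in the chart at `x`. -/
def chartField (x : M) (X : VField E M) (z : E) : E :=
  coframe x ((extChartAt 𝓘(ℝ, E) x).symm z) (X ((extChartAt 𝓘(ℝ, E) x).symm z))

/-- Pulling back along the inverse chart applies the inverse of its derivative, which is the
derivative of the chart, that is `coframe`. -/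
theorem mpullbackWithin_eq_chartField (X : VField E M) {x : M} {z : E}
    (hz : z ∈ (extChartAt 𝓘(ℝ, E) x).target) :
    VectorField.mpullbackWithin 𝓘(ℝ, E) 𝓘(ℝ, E) (extChartAt 𝓘(ℝ, E) x).symm X
      (range 𝓘(ℝ, E)) z = chartField x X z := by
  have h0 : (extChartAt 𝓘(ℝ, E) x).symm z ∈ (chartAt E x).source := by
    simpa using (extChartAt 𝓘(ℝ, E) x).map_target hz
  have key : (mfderivWithin 𝓘(ℝ, E) 𝓘(ℝ, E) (extChartAt 𝓘(ℝ, E) x).symm (range 𝓘(ℝ, E)) z :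
      E →L[ℝ] E).inverse =
      (mfderiv 𝓘(ℝ, E) 𝓘(ℝ, E) (extChartAt 𝓘(ℝ, E) x) ((extChartAt 𝓘(ℝ, E) x).symm z) :
        E →L[ℝ] E) :=
    ContinuousLinearMap.inverse_eq (mfderivWithin_extChartAt_symm_comp_mfderiv_extChartAt hz)
      (mfderiv_extChartAt_comp_mfderivWithin_extChartAt_symm hz)
  rw [VectorField.mpullbackWithin_apply, chartField, coframe_eq h0]
  exact DFunLike.congr_fun key _

theorem chartField_apply (X : VField E M) {x y : M} (hy : y ∈ (chartAt E x).source) :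
    chartField x X (extChartAt 𝓘(ℝ, E) x y) = coframe x y (X y) := by
  rw [chartField, (extChartAt 𝓘(ℝ, E) x).left_inv (by simpa using hy)]

theorem dR_apply_eq_fderiv {f : M → W} {x y : M} (hy : y ∈ (chartAt E x).source)
    (hf : MDifferentiableAt 𝓘(ℝ, E) 𝓘(ℝ, W) f y) (X : VField E M) :
    dR f y (X y) = fderiv ℝ (f ∘ (extChartAt 𝓘(ℝ, E) x).symm) (extChartAt 𝓘(ℝ, E) x y)
      (chartField x X (extChartAt 𝓘(ℝ, E) x y)) := by
  rw [chartField_apply X hy, ← dR_comp_frame_eq hy hf, ContinuousLinearMap.comp_apply,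
    frame_coframe hy]

theorem differentiableAt_chartField {X : VField E M} {x : M} (hX : VDiffAt X x) :
    DifferentiableAt ℝ (chartField x X) (extChartAt 𝓘(ℝ, E) x x) := by
  have h := (mdifferentiableAt_iff _ _).1 (vDiffAt_iff.1 hX)
  have h2 := h.2
  rw [ModelWithCorners.range_eq_univ, differentiableWithinAt_univ] at h2
  exact h2

theorem _root_.VectorField.lieBracketWithin_eq_of_eventuallyEq {V : Type*} [NormedAddCommGroup V]
    [NormedSpace ℝ V] {X X' Y Y' : V → V} {s : Set V} {z : V} (hs : s = univ)
    (hX : X =ᶠ[𝓝 z] X') (hY : Y =ᶠ[𝓝 z] Y') :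
    VectorField.lieBracketWithin ℝ X Y s z = VectorField.lieBracket ℝ X' Y' z := by
  rw [hs, VectorField.lieBracketWithin_univ]
  exact Filter.EventuallyEq.lieBracket_vectorField_eq hX hY

/-- The bracket at x is by definition computed in the chart at x and carried back; only the germs of
the chart representations matter. -/
theorem mlieBracket_eq_frame (X Y : VField E M) (x : M) :
    VectorField.mlieBracket 𝓘(ℝ, E) X Y x = frame x x
      (VectorField.lieBracket ℝ (chartField x X) (chartField x Y) (extChartAt 𝓘(ℝ, E) x x)) := by
  have h := mem_chart_source E x
  have h1 : (mfderiv 𝓘(ℝ, E) 𝓘(ℝ, E) (extChartAt 𝓘(ℝ, E) x) x : E →L[ℝ] E).inverse =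
      (frame x x : E →L[ℝ] E) := by
    refine ContinuousLinearMap.inverse_eq ?_ ?_
    · exact (congrArg (fun L => L.comp (frame (E := E) x x)) (coframe_eq h)).symm.trans
        (coframe_comp_frame h)
    · exact (congrArg (fun L => (frame (E := E) x x).comp L) (coframe_eq h)).symm.trans
        (frame_comp_coframe h)
  have h2 (X : VField E M) : ∀ᶠ z in 𝓝 (extChartAt 𝓘(ℝ, E) x x),
      VectorField.mpullbackWithin 𝓘(ℝ, E) 𝓘(ℝ, E) (extChartAt 𝓘(ℝ, E) x).symm X
        (range 𝓘(ℝ, E)) z = chartField x X z := by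
    filter_upwards [extChartAt_target_mem_nhds (I := 𝓘(ℝ, E)) x] with z hz
    exact mpullbackWithin_eq_chartField _ hz
  rw [← VectorField.mlieBracketWithin_univ, VectorField.mlieBracketWithin_apply]
  refine (DFunLike.congr_fun h1 _).trans (congrArg (frame (E := E) x x) ?_)
  exact VectorField.lieBracketWithin_eq_of_eventuallyEq (V := E)
    (by rw [preimage_univ, univ_inter, ModelWithCorners.range_eq_univ]) (h2 X) (h2 Y)

omit [IsManifold 𝓘(ℂ, E) ω M] in
theorem contDiffAt_comp_extChartAt_symm {k : ℕ∞ω} {f : M → W} {x : M}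
    (hf : ContMDiffAt 𝓘(ℝ, E) 𝓘(ℝ, W) k f x) :
    ContDiffAt ℝ k (f ∘ (extChartAt 𝓘(ℝ, E) x).symm) (extChartAt 𝓘(ℝ, E) x x) := by
  have := (contMDiffAt_iff.1 hf).2
  rw [ModelWithCorners.range_eq_univ, contDiffWithinAt_univ] at this
  exact this

/-- Product rule for z ↦ f'(z)(Y z) in the chart. The Hessian term is separated because it
disappears on antisymmetrising in X and Y. -/
theorem dR_dR_apply {f : M → W} {X Y : VField E M} {x : M}
    (hf : ContMDiffAt 𝓘(ℝ, E) 𝓘(ℝ, W) 2 f x) (hY : VDiffAt Y x) :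
    let z := extChartAt 𝓘(ℝ, E) x x
    let f' := f ∘ (extChartAt 𝓘(ℝ, E) x).symm
    dR (fun y => dR f y (Y y)) x (X x) =
      fderiv ℝ (fderiv ℝ f') z (chartField x X z) (chartField x Y z)
      + fderiv ℝ f' z (fderiv ℝ (chartField x Y) z (chartField x X z)) := by
  intro z f'
  have hx := mem_chart_source E x
  rw [dR_apply_eq_fderiv hx (mdifferentiableAt_dR_apply hf hY)]
  have h1 : (fun y => dR f y (Y y)) ∘ (extChartAt 𝓘(ℝ, E) x).symm =ᶠ[𝓝 z]
      fun z => fderiv ℝ f' z (chartField x Y z) := by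
    have h2 : ∀ᶠ y in 𝓝 x, ContMDiffAt 𝓘(ℝ, E) 𝓘(ℝ, W) 2 f y :=
      (contMDiffAt_iff_contMDiffAt_nhds (by simp)).1 hf
    have h3 := (continuousAt_extChartAt_symm (I := 𝓘(ℝ, E)) x).tendsto
    rw [extChartAt_to_inv] at h3
    filter_upwards [extChartAt_target_mem_nhds (I := 𝓘(ℝ, E)) x, h3.eventually h2] with z hz hz'
    have h0 : (extChartAt 𝓘(ℝ, E) x).symm z ∈ (chartAt E x).source := by
      simpa using (extChartAt 𝓘(ℝ, E) x).map_target hz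
    rw [Function.comp_apply, dR_apply_eq_fderiv h0 (hz'.mdifferentiableAt (by simp)),
      (extChartAt 𝓘(ℝ, E) x).right_inv hz]
  rw [h1.fderiv_eq]
  have h4 : ContDiffAt ℝ 2 f' z := contDiffAt_comp_extChartAt_symm hf
  have h5 : DifferentiableAt ℝ (fderiv ℝ f') z :=
    (h4.fderiv_right (m := 1) le_rfl).differentiableAt one_ne_zero
  rw [fderiv_clm_apply h5 (differentiableAt_chartField hY)]
  simp [add_comm]
  rfl

/-- The Hessian terms cancel by symmetry and the remaining ones form the bracket in the chart. This
is d(df) = 0 for vector valued f, and torsion-freeness, flatness, d^∇J = 0 and closedness are all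
derived from it. -/
theorem dR_bracket {f : M → W} {X Y : VField E M} {x : M}
    (hf : ContMDiffAt 𝓘(ℝ, E) 𝓘(ℝ, W) 2 f x) (hX : VDiffAt X x) (hY : VDiffAt Y x) :
    dR (fun y => dR f y (Y y)) x (X x) - dR (fun y => dR f y (X y)) x (Y x)
      = dR f x (VectorField.mlieBracket 𝓘(ℝ, E) X Y x) := by
  have hx := mem_chart_source E x
  have h4 := contDiffAt_comp_extChartAt_symm hf
  have h5 := h4.isSymmSndFDerivAt (by simp)
  have h6 (v : E) := DFunLike.congr_fun (dR_comp_frame_eq hx (hf.mdifferentiableAt (by simp))) v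
  simp only [ContinuousLinearMap.comp_apply] at h6
  rw [dR_dR_apply hf hY, dR_dR_apply hf hX, mlieBracket_eq_frame, h6, VectorField.lieBracket_eq, map_sub,
    h5.eq]
  abel_nf

end Calculus

/-! ### Smoothness of holomorphic functions of several variables. -/

section Holomorphic

variable {E F : Type*} [NormedAddCommGroup E] [NormedSpace ℂ E] [FiniteDimensional ℂ E]
  [NormedAddCommGroup F] [NormedSpace ℂ F] [FiniteDimensional ℂ F]

open Metric MeasureTheory in
/-- Directional derivatives of a holomorphic function of several variables are holomorphic. -/
theorem differentiableAt_fderiv_apply {f : E → F} {x₀ : E}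
    (hf : ∀ᶠ x in 𝓝 x₀, DifferentiableAt ℂ f x) (v : E) :
    DifferentiableAt ℂ (fun x => fderiv ℂ f x v) x₀ := by
  have hF : CompleteSpace F := FiniteDimensional.complete ℂ F
  let _ : MeasurableSpace E := borel E
  have _ : BorelSpace E := ⟨rfl⟩
  have hc : ∀ᶠ x in 𝓝 x₀, f x ∈ ball (f x₀) 1 :=
    hf.self_of_nhds.continuousAt.eventually (ball_mem_nhds _ one_pos)
  obtain ⟨ε, hε, hball⟩ := Metric.eventually_nhds_iff_ball.1 (hf.and hc)
  -- A ball of radius 2R about a point of the ball of radius 2R about x₀ stays in the ball of radius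
  -- ε = 4R.
  set R := ε / 4 with hR
  have hR0 : 0 < R := by positivity
  -- Cauchy estimate: f maps the ball of radius 2R about y into a ball of radius 2 about f y. This
  -- uniform bound dominates the differentiated integrand below.
  have hd : ∀ y ∈ ball x₀ (2 * R), ‖fderiv ℂ f y‖ ≤ 2 / (2 * R) := by
    intro y hy
    have hsub : ball y (2 * R) ⊆ ball x₀ ε := ball_subset_ball' (by
      rw [mem_ball] at hy; linarith)
    refine Complex.norm_fderiv_le_div_of_mapsTo_ball
      (fun z hz => (hball z (hsub hz)).1.differentiableWithinAt) ?_ (by positivity)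
    intro z hz
    have h1 := (hball z (hsub hz)).2
    have h2 := (hball y (hsub (mem_ball_self (by positivity)))).2
    rw [mem_ball] at h1 h2
    rw [mem_closedBall]
    calc dist (f z) (f y) ≤ dist (f z) (f x₀) + dist (f y) (f x₀) := dist_triangle_right _ _ _
      _ ≤ 2 := by linarith
  -- Makes x + ζv stay within 2R of x₀ for x within R and |ζ| ≤ r; the summand 1 covers v = 0.
  set r := R / (‖v‖ + 1) with hr
  have hr0 : 0 < r := by positivity
  have hrv : r * ‖v‖ < R := by
    rw [hr, div_mul_eq_mul_div, div_lt_iff₀ (by positivity)]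
    nlinarith [norm_nonneg v]
  have hmem : ∀ x ∈ ball x₀ R, ∀ ζ ∈ closedBall (0 : ℂ) r, x + ζ • v ∈ ball x₀ (2 * R) := by
    intro x hx ζ hζ
    rw [mem_ball, dist_eq_norm] at hx ⊢
    rw [mem_closedBall_zero_iff] at hζ
    calc ‖x + ζ • v - x₀‖ = ‖(x - x₀) + ζ • v‖ := by congr 1; abel
      _ ≤ ‖x - x₀‖ + ‖ζ‖ * ‖v‖ := (norm_add_le _ _).trans (by rw [norm_smul])
      _ ≤ ‖x - x₀‖ + r * ‖v‖ := by gcongr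
      _ < 2 * R := by linarith
  have hdiff : ∀ x ∈ ball x₀ R, ∀ ζ ∈ closedBall (0 : ℂ) r, DifferentiableAt ℂ f (x + ζ • v) :=
    fun x hx ζ hζ => (hball _ (ball_subset_ball (by linarith) (hmem x hx ζ hζ))).1
  have hcircle (θ : ℝ) : circleMap 0 r θ ∈ closedBall (0 : ℂ) r :=
    circleMap_mem_closedBall 0 hr0.le θ
  let c : ℝ → ℂ := fun θ => deriv (circleMap 0 r) θ * ((circleMap 0 r θ - 0) ^ 2)⁻¹
  have hcc : Continuous c := by
    have h0 (θ : ℝ) : circleMap 0 r θ ≠ 0 := circleMap_ne_center hr0.ne'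
    simp only [c, deriv_circleMap, sub_zero]
    refine (by fun_prop : Continuous fun θ => circleMap 0 r θ * Complex.I).mul ?_
    exact ((continuous_circleMap 0 r).pow 2).inv₀ fun θ => pow_ne_zero 2 (h0 θ)
  -- The directional derivative is a Cauchy integral over a circle in direction v, and the integral
  -- may be differentiated in x under the integral sign.
  have key : HasFDerivAt (𝕜 := ℂ) (fun x => ∫ θ in (0 : ℝ)..2 * Real.pi,
        c θ • f (x + circleMap 0 r θ • v))
      (∫ θ in (0 : ℝ)..2 * Real.pi, c θ • fderiv ℂ f (x₀ + circleMap 0 r θ • v)) x₀ := by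
    have hcont : ∀ x ∈ ball x₀ R, Continuous fun θ => c θ • f (x + circleMap 0 r θ • v) := by
      intro x hx
      refine hcc.smul (continuous_iff_continuousAt.2 fun θ => ?_)
      exact ContinuousAt.comp (f := fun θ => x + circleMap 0 r θ • v)
        (hdiff x hx _ (hcircle θ)).continuousAt (by fun_prop)
    refine intervalIntegral.hasFDerivAt_integral_of_dominated_of_fderiv_le
      (F' := fun x θ => c θ • fderiv ℂ f (x + circleMap 0 r θ • v))
      (bound := fun θ => ‖c θ‖ * (2 / (2 * R))) (ball_mem_nhds x₀ hR0) ?_ ?_ ?_ ?_ ?_ ?_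
    · filter_upwards [ball_mem_nhds x₀ hR0] with x hx
      exact (hcont x hx).aestronglyMeasurable
    · exact (hcont x₀ (mem_ball_self hR0)).intervalIntegrable _ _
    -- Continuity of the derivative is not yet known; its measurability is enough.
    · have : SecondCountableTopology (E →L[ℂ] F) := by
        have := FiniteDimensional.proper ℂ (E →L[ℂ] F)
        infer_instance
      refine (hcc.aestronglyMeasurable).smul ?_
      refine Measurable.aestronglyMeasurable ?_
      exact (measurable_fderiv ℂ f).comp (by fun_prop : Continuous _).measurable
    · refine .of_forall fun θ _ x hx => ?_
      rw [norm_smul]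
      gcongr
      exact hd _ (hmem x hx _ (hcircle θ))
    · exact (hcc.norm.mul continuous_const).intervalIntegrable _ _
    · refine .of_forall fun θ _ x hx => ?_
      have h1 := (hdiff x hx _ (hcircle θ)).hasFDerivAt.comp x
        ((hasFDerivAt_id x).add_const (circleMap 0 r θ • v))
      rw [ContinuousLinearMap.comp_id] at h1
      exact h1.const_smul (c θ)
  refine (key.differentiableAt.const_smul (2 * Real.pi * Complex.I : ℂ)⁻¹).congr_of_eventuallyEq ?_
  filter_upwards [ball_mem_nhds x₀ hR0] with x hx
  have hopen : IsOpen ((fun ζ : ℂ => x + ζ • v) ⁻¹' ball x₀ (2 * R)) :=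
    isOpen_ball.preimage (by fun_prop)
  have hcauchy := Complex.two_pi_I_inv_smul_circleIntegral_sub_sq_inv_smul_of_differentiable
    (f := fun ζ : ℂ => f (x + ζ • v)) hopen (c := 0) (w₀ := 0) (R := r)
    (fun ζ hζ => hmem x hx ζ hζ)
    (fun ζ hζ => by
      refine DifferentiableAt.differentiableWithinAt ?_
      refine DifferentiableAt.comp (f := fun ζ : ℂ => x + ζ • v) ζ
        (hball _ (ball_subset_ball (by linarith) hζ)).1 (by fun_prop)) (mem_ball_self hr0)
  have hderiv : deriv (fun ζ : ℂ => f (x + ζ • v)) 0 = fderiv ℂ f x v := by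
    have h1 : HasFDerivAt f (fderiv ℂ f x) (x + (0 : ℂ) • v) := by
      have := hdiff x hx 0 (by simp [hr0.le])
      simpa using this.hasFDerivAt
    have h2 : HasDerivAt (fun ζ : ℂ => x + ζ • v) v 0 := by
      simpa using ((hasDerivAt_id (0 : ℂ)).smul_const v).const_add x
    exact (h1.comp_hasDerivAt 0 h2).deriv
  rw [← hderiv, ← hcauchy, circleIntegral]
  simp only [c, smul_smul, Pi.smul_apply]

/-- Holomorphic functions of several variables are smooth. -/
theorem contDiffAt_of_eventually_differentiableAt {f : E → F} {x₀ : E}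
    (hf : ∀ᶠ x in 𝓝 x₀, DifferentiableAt ℂ f x) : ContDiffAt ℂ ∞ f x₀ := by
  -- All functions f are quantified over, since the induction step applies the claim to the
  -- directional derivatives of f.
  have key (k : ℕ) : ∀ (f : E → F) (s : Set E), IsOpen s → DifferentiableOn ℂ f s →
      ContDiffOn ℂ k f s := by
    induction k with
    | zero => exact fun f s _ hf => contDiffOn_zero.2 hf.continuousOn
    | succ k ih =>
      intro f s hs hf
      rw [Nat.cast_succ, contDiffOn_succ_iff_fderiv_of_isOpen hs]
      refine ⟨hf, by simp, ?_⟩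
      rw [contDiffOn_clm_apply]
      intro v
      refine ih _ s hs fun x hx => DifferentiableAt.differentiableWithinAt ?_
      refine differentiableAt_fderiv_apply ?_ v
      filter_upwards [hs.mem_nhds hx] with y hy
      exact hf.differentiableAt (hs.mem_nhds hy)
  obtain ⟨s, hs, ho, hx⟩ := eventually_nhds_iff.1 hf
  refine contDiffAt_infty.2 fun k => ?_
  exact (key k f s ho fun y hy => (hs y hy).differentiableWithinAt).contDiffAt (ho.mem_nhds hx)

end Holomorphic

/-! ### Holomorphic maps on the underlying real manifold. -/

section HolomorphicManifold
variable {E : Type*} [NormedAddCommGroup E] [NormedSpace ℂ E]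
  {M : Type*} [TopologicalSpace M] [ChartedSpace E M]
  {W : Type*} [NormedAddCommGroup W] [NormedSpace ℂ W]

theorem hasMFDerivAt_real {E' : Type*} [NormedAddCommGroup E'] [NormedSpace ℂ E']
    {M' : Type*} [TopologicalSpace M'] [ChartedSpace E' M'] {f : M → M'} {x : M}
    {f' : E →L[ℂ] E'} (hf : HasMFDerivAt 𝓘(ℂ, E) 𝓘(ℂ, E') f x f') :
    HasMFDerivAt 𝓘(ℝ, E) 𝓘(ℝ, E') f x (f'.restrictScalars ℝ : E →L[ℝ] E') :=
  ⟨hf.1, HasFDerivWithinAt.restrictScalars ℝ hf.2⟩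

theorem mdifferentiableAt_real {E' : Type*} [NormedAddCommGroup E'] [NormedSpace ℂ E']
    {M' : Type*} [TopologicalSpace M'] [ChartedSpace E' M'] {f : M → M'} {x : M}
    (hf : MDifferentiableAt 𝓘(ℂ, E) 𝓘(ℂ, E') f x) :
    MDifferentiableAt 𝓘(ℝ, E) 𝓘(ℝ, E') f x :=
  (hasMFDerivAt_real hf.hasMFDerivAt).mdifferentiableAt

theorem mfderiv_cplxJ {E' : Type*} [NormedAddCommGroup E'] [NormedSpace ℂ E']
    {M' : Type*} [TopologicalSpace M'] [ChartedSpace E' M'] {f : M → M'} {x : M}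
    (hf : MDifferentiableAt 𝓘(ℂ, E) 𝓘(ℂ, E') f x) (v : TangentSpace 𝓘(ℝ, E) x) :
    mfderiv 𝓘(ℝ, E) 𝓘(ℝ, E') f x (cplxJ x v) = cplxJ (f x) (mfderiv 𝓘(ℝ, E) 𝓘(ℝ, E') f x v) := by
  rw [(hasMFDerivAt_real hf.hasMFDerivAt).mfderiv]
  exact (mfderiv 𝓘(ℂ, E) 𝓘(ℂ, E') f x : E →L[ℂ] E').map_smul Complex.I (v : E)

theorem dR_cplxJ {f : M → W} {x : M} (hf : MDifferentiableAt 𝓘(ℂ, E) 𝓘(ℂ, W) f x)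
    (v : TangentSpace 𝓘(ℝ, E) x) : dR f x (cplxJ x v) = Complex.I • dR f x v :=
  mfderiv_cplxJ hf v

variable [IsManifold 𝓘(ℂ, E) ω M] [FiniteDimensional ℂ E] [FiniteDimensional ℂ W]

theorem contMDiffAt_real_of_holomorphic {f : M → W} {x : M}
    (hf : ∀ᶠ y in 𝓝 x, MDifferentiableAt 𝓘(ℂ, E) 𝓘(ℂ, W) f y) :
    ContMDiffAt 𝓘(ℝ, E) 𝓘(ℝ, W) ∞ f x := by
  have h1 : ∀ᶠ z in 𝓝 (extChartAt 𝓘(ℂ, E) x x),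
      DifferentiableAt ℂ (f ∘ (extChartAt 𝓘(ℂ, E) x).symm) z := by
    have h3 := (continuousAt_extChartAt_symm (I := 𝓘(ℂ, E)) x).tendsto
    rw [extChartAt_to_inv] at h3
    filter_upwards [extChartAt_target_mem_nhds (I := 𝓘(ℂ, E)) x, h3.eventually hf] with z hz hz'
    have h4 := mdifferentiableWithinAt_extChartAt_symm (I := 𝓘(ℂ, E)) hz
    rw [ModelWithCorners.range_eq_univ, mdifferentiableWithinAt_univ] at h4
    exact mdifferentiableAt_iff_differentiableAt.1 (hz'.comp z h4)
  have h2 := (contDiffAt_of_eventually_differentiableAt h1).restrict_scalars ℝ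
  refine contMDiffAt_iff.2 ⟨hf.self_of_nhds.continuousAt, ?_⟩
  rw [ModelWithCorners.range_eq_univ, contDiffWithinAt_univ]
  exact h2

end HolomorphicManifold

/-! ### Regularity of fields from their images under a local diffeomorphism. -/

section Inverse
variable {E : Type*} [NormedAddCommGroup E] [NormedSpace ℂ E] [FiniteDimensional ℂ E]
  {M : Type*} [TopologicalSpace M] [ChartedSpace E M] [IsManifold 𝓘(ℂ, E) ω M]
  {W : Type*} [NormedAddCommGroup W] [NormedSpace ℝ W]

theorem isInvertible_dR_frame {r : M → W} {x y : M} (hy : y ∈ (chartAt E x).source)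
    (hr : Function.Bijective (dR (E := E) r y)) :
    ((dR (E := E) r y).comp (frame (E := E) x y)).IsInvertible := by
  have hb : Function.Bijective ((dR (E := E) r y).comp (frame (E := E) x y)) := by
    refine hr.comp (Function.bijective_iff_has_inverse.2 ⟨coframe x y, ?_, ?_⟩)
    · exact coframe_frame hy
    · exact frame_coframe hy
  exact ⟨(LinearEquiv.ofBijective _ hb).toContinuousLinearEquiv, by ext; rfl⟩

/-- The inverse of the derivative of a local diffeomorphism, in a chart, is smooth. -/
theorem contMDiffAt_inverse_dR_frame {r : M → W} {x : M}
    (hr : ContMDiffAt 𝓘(ℝ, E) 𝓘(ℝ, W) ∞ r x)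
    (hb : Function.Bijective (dR (E := E) r x)) :
    ContMDiffAt 𝓘(ℝ, E) 𝓘(ℝ, W →L[ℝ] E) ∞
      (fun y : M => ((dR (E := E) r y).comp (frame (E := E) x y)).inverse) x := by
  have : CompleteSpace E := FiniteDimensional.complete ℂ E
  obtain ⟨e, he⟩ := isInvertible_dR_frame (mem_chart_source E x) hb
  have h1 := contDiffAt_map_inverse (n := ∞) e
  rw [he] at h1
  exact ContDiffAt.comp_contMDiffAt (g := ContinuousLinearMap.inverse)
    (f := fun y : M => (dR (E := E) r y).comp (frame (E := E) x y)) h1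
    (contMDiffAt_dR_frame (m := ∞) hr le_rfl)

theorem coframe_eq_inverse {r : M → W} {x y : M} (hy : y ∈ (chartAt E x).source)
    (hb : Function.Bijective (dR (E := E) r y)) (v : TangentSpace 𝓘(ℝ, E) y) :
    coframe x y v = ((dR (E := E) r y).comp (frame (E := E) x y)).inverse (dR r y v) := by
  obtain ⟨e, he⟩ := isInvertible_dR_frame hy hb
  have h1 : dR r y v = e (coframe x y v) := by
    have := DFunLike.congr_fun he (coframe x y v)
    rw [ContinuousLinearMap.comp_apply, frame_coframe hy] at this
    exact this.symm
  rw [← he, h1, ContinuousLinearMap.inverse_equiv]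
  simp

/-- In the chart X is the inverse of dr applied to dr(X), and this inverse depends smoothly on the
point. Fields specified only through dr(X) obtain their regularity in this way. -/
theorem vDiffAt_of_dR {r : M → W} {x : M} {X : VField E M}
    (hr : ContMDiffAt 𝓘(ℝ, E) 𝓘(ℝ, W) ∞ r x)
    (hb : ∀ᶠ y in 𝓝 x, Function.Bijective (dR (E := E) r y))
    (hX : MDifferentiableAt 𝓘(ℝ, E) 𝓘(ℝ, W) (fun y => dR r y (X y)) x) : VDiffAt X x := by
  rw [vDiffAt_iff]
  refine MDifferentiableAt.congr_of_eventuallyEq (((contMDiffAt_inverse_dR_frame hr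
    hb.self_of_nhds).mdifferentiableAt (by simp)).clm_apply hX) ?_
  filter_upwards [hb, (chartAt E x).open_source.mem_nhds (mem_chart_source E x)] with y hy hy'
  exact coframe_eq_inverse hy' hy _

theorem contMDiffAt_vField_of_dR {r : M → W} {x : M} {X : VField E M}
    (hr : ContMDiffAt 𝓘(ℝ, E) 𝓘(ℝ, W) ∞ r x)
    (hb : ∀ᶠ y in 𝓝 x, Function.Bijective (dR (E := E) r y))
    (hX : ContMDiffAt 𝓘(ℝ, E) 𝓘(ℝ, W) ∞ (fun y => dR r y (X y)) x) :
    ContMDiffAt 𝓘(ℝ, E) 𝓘(ℝ, E).tangent ∞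
      (fun y => (⟨y, X y⟩ : TangentBundle 𝓘(ℝ, E) M)) x := by
  rw [contMDiffAt_vField_iff]
  refine ContMDiffAt.congr_of_eventuallyEq ((contMDiffAt_inverse_dR_frame hr
    hb.self_of_nhds).clm_apply hX) ?_
  filter_upwards [hb, (chartAt E x).open_source.mem_nhds (mem_chart_source E x)] with y hy hy'
  exact coframe_eq_inverse hy' hy _

/-- Meant for L = ∇Y and s = dr(Y), where r is an affine coordinate system: the defining relation is
then dr ∘ ∇Y = ds. -/
theorem contMDiffAt_endomorphism_of_dR {r s : M → W} {x : M}
    {L : (y : M) → TangentSpace 𝓘(ℝ, E) y →L[ℝ] TangentSpace 𝓘(ℝ, E) y}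
    (hr : ContMDiffAt 𝓘(ℝ, E) 𝓘(ℝ, W) ∞ r x)
    (hb : ∀ᶠ y in 𝓝 x, Function.Bijective (dR (E := E) r y))
    (hs : ContMDiffAt 𝓘(ℝ, E) 𝓘(ℝ, W) ∞ s x)
    (hL : ∀ᶠ y in 𝓝 x, ∀ v, dR r y (L y v) = dR s y v) :
    ContMDiffAt 𝓘(ℝ, E) (𝓘(ℝ, E).prod 𝓘(ℝ, E →L[ℝ] E)) ∞
      (fun x => TotalSpace.mk' (E →L[ℝ] E)
        (E := fun x : M => TangentSpace 𝓘(ℝ, E) x →L[ℝ] TangentSpace 𝓘(ℝ, E) x) x (L x)) x := by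
  rw [contMDiffAt_hom_bundle]
  refine ⟨contMDiffAt_id, ?_⟩
  refine ContMDiffAt.congr_of_eventuallyEq ((contMDiffAt_inverse_dR_frame hr
    hb.self_of_nhds).clm_comp (contMDiffAt_dR_frame (m := ∞) hs le_rfl)) ?_
  filter_upwards [hb, hL, (chartAt E x).open_source.mem_nhds (mem_chart_source E x)]
    with y hy hLy hy'
  ext v
  have := coframe_eq_inverse hy' hy (L y (frame x y v))
  rw [hLy] at this
  exact this

end Inverse

/-! ### Ω and γ in real and imaginary parts; real symplectic maps. -/

section LinearAlgebra

/-- The real points of `Phase n`. -/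
abbrev RealPhase (n : ℕ) : Type := Fin n ⊕ Fin n → ℝ

variable (n) in
/-- The real part of a vector of `ℂ²ⁿ`. -/
def reP : Phase n →L[ℝ] RealPhase n :=
  ContinuousLinearMap.pi fun j => Complex.reCLM.comp (ContinuousLinearMap.proj j)

variable (n) in
/-- The imaginary part of a vector of `ℂ²ⁿ`. -/
def imP : Phase n →L[ℝ] RealPhase n :=
  ContinuousLinearMap.pi fun j => Complex.imCLM.comp (ContinuousLinearMap.proj j)

@[simp] theorem reP_apply (a : Phase n) (j : Fin n ⊕ Fin n) : reP n a j = (a j).re := rfl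
@[simp] theorem imP_apply (a : Phase n) (j : Fin n ⊕ Fin n) : imP n a j = (a j).im := rfl

theorem reP_I_smul (a : Phase n) : reP n (Complex.I • a) = - imP n a := by
  ext j; simp

theorem imP_I_smul (a : Phase n) : imP n (Complex.I • a) = reP n a := by
  ext j; simp

theorem ext_reP_imP {a b : Phase n} (h1 : reP n a = reP n b) (h2 : imP n a = imP n b) : a = b := by
  ext j
  exact Complex.ext (congrFun h1 j) (congrFun h2 j)

variable (n) in
/-- The real symplectic form on `ℝ²ⁿ`. -/
def symplR : RealPhase n →L[ℝ] RealPhase n →L[ℝ] ℝ :=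
  ∑ i, ((ContinuousLinearMap.proj (R := ℝ) (φ := fun _ : Fin n ⊕ Fin n => ℝ) (Sum.inl i)).smulRight
      (ContinuousLinearMap.proj (R := ℝ) (φ := fun _ : Fin n ⊕ Fin n => ℝ) (Sum.inr i))
    - (ContinuousLinearMap.proj (R := ℝ) (φ := fun _ : Fin n ⊕ Fin n => ℝ) (Sum.inr i)).smulRight
      (ContinuousLinearMap.proj (R := ℝ) (φ := fun _ : Fin n ⊕ Fin n => ℝ) (Sum.inl i)))

set_option synthInstance.maxHeartbeats 200000 in
theorem symplR_apply (a b : RealPhase n) :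
    symplR n a b = ∑ i, (a (Sum.inl i) * b (Sum.inr i) - a (Sum.inr i) * b (Sum.inl i)) := by
  simp [symplR, sum_apply]

theorem symplR_swap (a b : RealPhase n) : symplR n a b = - symplR n b a := by
  simp only [symplR_apply, ← Finset.sum_neg_distrib]
  exact Finset.sum_congr rfl fun i _ => by ring

theorem eq_zero_of_symplR {a : RealPhase n} (h : ∀ b, symplR n a b = 0) : a = 0 := by
  funext j
  cases j with
  | inl i => simpa [symplR_apply, Pi.single_apply] using h (Pi.single (Sum.inr i) 1)
  | inr i => simpa [symplR_apply, Pi.single_apply] using h (Pi.single (Sum.inl i) 1)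

theorem sympl_re (a b : Phase n) : (sympl a b).re =
    symplR n (reP n a) (reP n b) - symplR n (imP n a) (imP n b) := by
  simp only [sympl, symplR_apply, Complex.re_sum, ← Finset.sum_sub_distrib]
  exact Finset.sum_congr rfl fun i _ => by simp; ring

theorem sympl_im (a b : Phase n) : (sympl a b).im =
    symplR n (reP n a) (imP n b) + symplR n (imP n a) (reP n b) := by
  simp only [sympl, symplR_apply, Complex.im_sum, ← Finset.sum_add_distrib]
  exact Finset.sum_congr rfl fun i _ => by simp; ring

theorem herm_re (a b : Phase n) : (herm a b).re =
    symplR n (reP n a) (imP n b) - symplR n (imP n a) (reP n b) := by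
  have h1 : reP n (fun j => conj (b j)) = reP n b := by ext; simp
  have h2 : imP n (fun j => conj (b j)) = - imP n b := by ext; simp
  simp only [herm, Complex.mul_re, Complex.I_re, Complex.I_im, zero_mul, one_mul, sympl_im, h1, h2,
    map_neg]
  ring

theorem herm_im (a b : Phase n) : (herm a b).im =
    symplR n (reP n a) (reP n b) + symplR n (imP n a) (imP n b) := by
  have h1 : reP n (fun j => conj (b j)) = reP n b := by ext; simp
  have h2 : imP n (fun j => conj (b j)) = - imP n b := by ext; simp
  simp only [herm, Complex.mul_im, Complex.I_re, Complex.I_im, zero_mul, one_mul, sympl_re, h1, h2,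
    map_neg]
  ring

theorem herm_add_left (a b c : Phase n) : herm (a + b) c = herm a c + herm b c := by
  simp [herm, sympl_add_left, mul_add]

theorem herm_smul_left (c : ℂ) (a b : Phase n) : herm (c • a) b = c * herm a b := by
  simp only [herm, sympl, Finset.mul_sum]
  exact Finset.sum_congr rfl fun i _ => by simp; ring

theorem herm_swap (a b : Phase n) : herm a b = conj (herm b a) := by
  apply Complex.ext
  · rw [Complex.conj_re, herm_re, herm_re, symplR_swap (reP n a), symplR_swap (imP n a)]
    ring
  · rw [Complex.conj_im, herm_im, herm_im, symplR_swap (reP n a), symplR_swap (imP n a)]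
    ring

theorem herm_add_right (a b c : Phase n) : herm a (b + c) = herm a b + herm a c := by
  rw [herm_swap, herm_add_left, map_add, ← herm_swap, ← herm_swap]

theorem herm_smul_right (c : ℂ) (a b : Phase n) : herm a (c • b) = conj c * herm a b := by
  rw [herm_swap, herm_smul_left, map_mul, ← herm_swap]

theorem herm_self_im (a : Phase n) : (herm a a).im = 0 := by
  have := congrArg Complex.im (herm_swap a a)
  rw [Complex.conj_im] at this
  linarith

variable (n) in
/-- The bilinear form `½ Re γ` on `ℂ²ⁿ`. -/
def metricForm : Phase n →L[ℝ] Phase n →L[ℝ] ℝ :=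
  (1 / 2 : ℝ) • ((symplR n).bilinearComp (reP n) (imP n) - (symplR n).bilinearComp (imP n) (reP n))

theorem metricForm_apply (a b : Phase n) : metricForm n a b = 1 / 2 * (herm a b).re := by
  simp [metricForm, herm_re]

/-- Re Ω(a, b) = 0 says that the real and the imaginary parts have the same symplectic product, and
the left side is the mean of these two numbers. Thus on a Lagrangian subspace the Kähler form
depends on real parts only. -/
theorem metricForm_I_smul {a b : Phase n} (h : sympl a b = 0) :
    metricForm n a (Complex.I • b) = symplR n (reP n a) (reP n b) := by
  have h1 := sympl_re a b
  rw [h, Complex.zero_re] at h1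
  rw [metricForm_apply, herm_re, imP_I_smul, reP_I_smul, map_neg]
  linarith

/-- A purely imaginary a satisfies ā = -a, so γ(b, a) is a multiple of Ω(b, a). Hence on a
Lagrangian tangent space the kernel of the real part is γ-null. -/
theorem eq_zero_of_reP_eq_zero {a : Phase n} (ha : reP n a = 0) (b : Phase n)
    (h : sympl a b = 0) : herm a b = 0 := by
  have h1 := sympl_re a b
  have h2 := sympl_im a b
  simp only [ha, h, map_zero, zero_apply] at h1 h2
  apply Complex.ext
  · rw [herm_re, ha]; simp at h2 ⊢; exact h2.symm
  · rw [herm_im, ha]; simp at h1 ⊢; exact h1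

/-- Complexifications of real symplectic maps. -/
structure IsRealSympl (R : Phase n →L[ℂ] Phase n) : Prop where
  sympl_eq : ∀ a b, sympl (R a) (R b) = sympl a b
  map_conj : ∀ a : Phase n, R (fun j => conj (a j)) = fun j => conj (R a j)

namespace IsRealSympl

variable {R : Phase n →L[ℂ] Phase n} (hR : IsRealSympl R)
include hR

theorem herm_eq (a b : Phase n) : herm (R a) (R b) = herm a b := by
  rw [herm, ← hR.map_conj, hR.sympl_eq, herm]

theorem map_eq_zero {a : Phase n} (h : R a = 0) : a = 0 := by
  have h1 : ∀ b, sympl a b = 0 := fun b => by rw [← hR.sympl_eq, h]; simp [sympl]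
  funext j
  cases j with
  | inl i => simpa [sympl, Pi.single_apply] using h1 (Pi.single (Sum.inr i) 1)
  | inr i => simpa [sympl, Pi.single_apply] using h1 (Pi.single (Sum.inl i) 1)

end IsRealSympl

variable (n) in
/-- The inclusion of `ℝ²ⁿ` in `ℂ²ⁿ`. -/
def ofRealP : RealPhase n →L[ℝ] Phase n :=
  ContinuousLinearMap.pi fun j => Complex.ofRealCLM.comp (ContinuousLinearMap.proj j)

/-- The restriction to `ℝ²ⁿ` of an endomorphism of `ℂ²ⁿ`. -/
def realPart (R : Phase n →L[ℂ] Phase n) : RealPhase n →L[ℝ] RealPhase n :=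
  (reP n).comp ((R.restrictScalars ℝ).comp (ofRealP n))

/-- Commuting with conjugation, R preserves `ℝ²ⁿ` and i`ℝ²ⁿ`, so the real part of R a involves only
the real part of a. -/
theorem IsRealSympl.reP_map {R : Phase n →L[ℂ] Phase n} (hR : IsRealSympl R) (a : Phase n) :
    reP n (R a) = realPart R (reP n a) := by
  have h1 (b : RealPhase n) : imP n (R (ofRealP n b)) = 0 := by
    have h2 : (fun j => conj (ofRealP n b j)) = ofRealP n b := by ext j; simp [ofRealP]
    have h3 := hR.map_conj (ofRealP n b)
    rw [h2] at h3
    ext j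
    have := congrArg Complex.im (congrFun h3 j)
    rw [Complex.conj_im] at this
    simp; linarith
  have h2 : a = ofRealP n (reP n a) + Complex.I • ofRealP n (imP n a) := by
    ext j
    simp [ofRealP, mul_comm Complex.I, Complex.re_add_im]
  conv_lhs => rw [h2]
  rw [map_add, map_smul, map_add, reP_I_smul, h1, neg_zero, add_zero]
  rfl

end LinearAlgebra

/-! ### Rules for differentials; closedness of pulled back constant forms. -/

section DerivativeRules

theorem two_le_infty : (2 : ℕ∞ω) ≤ ∞ := by
  have h : ((2 : ℕ∞) : ℕ∞ω) ≤ ((⊤ : ℕ∞) : ℕ∞ω) := WithTop.coe_le_coe.2 le_top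
  exact h

variable {E : Type*} [NormedAddCommGroup E] [NormedSpace ℂ E]
  {M : Type*} [TopologicalSpace M] [ChartedSpace E M]
  {W W' W'' : Type*} [NormedAddCommGroup W] [NormedSpace ℝ W] [NormedAddCommGroup W']
  [NormedSpace ℝ W'] [NormedAddCommGroup W''] [NormedSpace ℝ W'']

theorem dR_congr {f g : M → W} {x : M} (h : f =ᶠ[𝓝 x] g) :
    dR (E := E) f x = dR g x := by
  ext v
  have := h.mfderiv_eq (I := 𝓘(ℝ, E)) (I' := 𝓘(ℝ, W))
  exact DFunLike.congr_fun this v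

theorem dR_const (c : W) (x : M) : dR (E := E) (fun _ : M => c) x = 0 := mvfderiv_const c

theorem dR_add {f g : M → W} {x : M} (hf : MDifferentiableAt 𝓘(ℝ, E) 𝓘(ℝ, W) f x)
    (hg : MDifferentiableAt 𝓘(ℝ, E) 𝓘(ℝ, W) g x) :
    dR (E := E) (fun y => f y + g y) x = dR f x + dR g x := mvfderiv_add hf hg

theorem dR_sub {f g : M → W} {x : M} (hf : MDifferentiableAt 𝓘(ℝ, E) 𝓘(ℝ, W) f x)
    (hg : MDifferentiableAt 𝓘(ℝ, E) 𝓘(ℝ, W) g x) :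
    dR (E := E) (fun y => f y - g y) x = dR f x - dR g x := mvfderiv_sub hf hg

theorem dR_smul {a : M → ℝ} {f : M → W} {x : M} (ha : MDifferentiableAt 𝓘(ℝ, E) 𝓘(ℝ, ℝ) a x)
    (hf : MDifferentiableAt 𝓘(ℝ, E) 𝓘(ℝ, W) f x) (v : TangentSpace 𝓘(ℝ, E) x) :
    dR (fun y => a y • f y) x v = a x • dR f x v + dR a x v • f x := by
  have := DFunLike.congr_fun (mvfderiv_smul ha hf) v
  exact this

theorem mdifferentiableAt_clm_comp (L : W →L[ℝ] W') {f : M → W} {x : M}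
    (hf : MDifferentiableAt 𝓘(ℝ, E) 𝓘(ℝ, W) f x) :
    MDifferentiableAt 𝓘(ℝ, E) 𝓘(ℝ, W') (fun y => L (f y)) x :=
  L.differentiableAt.comp_mdifferentiableAt hf

theorem dR_clm_comp (L : W →L[ℝ] W') {f : M → W} {x : M}
    (hf : MDifferentiableAt 𝓘(ℝ, E) 𝓘(ℝ, W) f x) (v : TangentSpace 𝓘(ℝ, E) x) :
    dR (fun y => L (f y)) x v = L (dR f x v) := by
  have h := (L.hasFDerivAt.hasMFDerivAt (x := f x)).comp x hf.hasMFDerivAt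
  exact DFunLike.congr_fun h.mfderiv v

theorem contMDiffAt_clm_comp {k : ℕ∞ω} (L : W →L[ℝ] W') {f : M → W} {x : M}
    (hf : ContMDiffAt 𝓘(ℝ, E) 𝓘(ℝ, W) k f x) :
    ContMDiffAt 𝓘(ℝ, E) 𝓘(ℝ, W') k (fun y => L (f y)) x :=
  L.contDiff.contDiffAt.comp_contMDiffAt hf

variable [IsManifold 𝓘(ℂ, E) ω M]

theorem dR_eq_fderiv_chart {f : M → W} {x : M} (hf : MDifferentiableAt 𝓘(ℝ, E) 𝓘(ℝ, W) f x)
    (v : TangentSpace 𝓘(ℝ, E) x) :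
    dR f x v = fderiv ℝ (f ∘ (extChartAt 𝓘(ℝ, E) x).symm) (extChartAt 𝓘(ℝ, E) x x)
      (coframe x x v) := by
  have hx := mem_chart_source E x
  rw [← dR_comp_frame_eq hx hf, ContinuousLinearMap.comp_apply, frame_coframe hx]

omit [IsManifold 𝓘(ℂ, E) ω M] in
theorem differentiableAt_comp_extChartAt_symm {f : M → W} {x : M}
    (hf : MDifferentiableAt 𝓘(ℝ, E) 𝓘(ℝ, W) f x) :
    DifferentiableAt ℝ (f ∘ (extChartAt 𝓘(ℝ, E) x).symm) (extChartAt 𝓘(ℝ, E) x x) := by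
  have h2 := ((mdifferentiableAt_iff _ _).1 hf).2
  rw [ModelWithCorners.range_eq_univ, differentiableWithinAt_univ] at h2
  exact h2

omit [IsManifold 𝓘(ℂ, E) ω M] in
theorem mdifferentiableAt_bilin (B : W →L[ℝ] W' →L[ℝ] W'') {f : M → W} {h : M → W'} {x : M}
    (hf : MDifferentiableAt 𝓘(ℝ, E) 𝓘(ℝ, W) f x) (hh : MDifferentiableAt 𝓘(ℝ, E) 𝓘(ℝ, W') h x) :
    MDifferentiableAt 𝓘(ℝ, E) 𝓘(ℝ, W'') (fun y => B (f y) (h y)) x :=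
  (mdifferentiableAt_clm_comp B hf).clm_apply hh

theorem dR_bilin (B : W →L[ℝ] W' →L[ℝ] W'') {f : M → W} {h : M → W'} {x : M}
    (hf : MDifferentiableAt 𝓘(ℝ, E) 𝓘(ℝ, W) f x) (hh : MDifferentiableAt 𝓘(ℝ, E) 𝓘(ℝ, W') h x)
    (v : TangentSpace 𝓘(ℝ, E) x) :
    dR (fun y => B (f y) (h y)) x v = B (dR f x v) (h x) + B (f x) (dR h x v) := by
  rw [dR_eq_fderiv_chart (mdifferentiableAt_bilin B hf hh), dR_eq_fderiv_chart hf,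
    dR_eq_fderiv_chart hh]
  have := B.fderiv_of_bilinear (differentiableAt_comp_extChartAt_symm hf)
    (differentiableAt_comp_extChartAt_symm hh)
  refine (DFunLike.congr_fun this (coframe x x v)).trans ?_
  simp [add_comm]

/-- The pull-back of a constant alternating form is closed. -/
theorem closed_pullback_const (B : W →L[ℝ] W →L[ℝ] ℝ) (hB : ∀ a b, B a b = - B b a) {f : M → W}
    {x : M} (hf : ContMDiffAt 𝓘(ℝ, E) 𝓘(ℝ, W) 2 f x) {X Y Z : VField E M}
    (hX : VDiffAt X x) (hY : VDiffAt Y x) (hZ : VDiffAt Z x) :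
    dR (fun y => B (dR f y (Y y)) (dR f y (Z y))) x (X x)
      + dR (fun y => B (dR f y (Z y)) (dR f y (X y))) x (Y x)
      + dR (fun y => B (dR f y (X y)) (dR f y (Y y))) x (Z x)
      - B (dR f x (VectorField.mlieBracket 𝓘(ℝ, E) X Y x)) (dR f x (Z x))
      - B (dR f x (VectorField.mlieBracket 𝓘(ℝ, E) Y Z x)) (dR f x (X x))
      - B (dR f x (VectorField.mlieBracket 𝓘(ℝ, E) Z X x)) (dR f x (Y x)) = 0 := by
  have h1 := mdifferentiableAt_dR_apply hf hX
  have h2 := mdifferentiableAt_dR_apply hf hY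
  have h3 := mdifferentiableAt_dR_apply hf hZ
  -- With the brackets replaced by iterated derivatives and the product rule applied, the terms
  -- cancel in pairs by antisymmetry of B.
  rw [← dR_bracket hf hX hY, ← dR_bracket hf hY hZ, ← dR_bracket hf hZ hX,
    dR_bilin B h2 h3, dR_bilin B h3 h1, dR_bilin B h1 h2]
  simp only [map_sub, sub_apply]
  rw [hB (dR f x (X x)) (dR (fun y => dR f y (Y y)) x (Z x)),
    hB (dR f x (Y x)) (dR (fun y => dR f y (Z y)) x (X x)),
    hB (dR f x (Z x)) (dR (fun y => dR f y (X y)) x (Y x))]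
  ring

theorem mdifferentiableAt_extChartAt_complex {x y : M} (hy : y ∈ (chartAt E x).source) :
    MDifferentiableAt 𝓘(ℂ, E) 𝓘(ℂ, E) (extChartAt 𝓘(ℂ, E) x) y :=
  mdifferentiableAt_extChartAt hy

theorem coframe_cplxJ {x y : M} (hy : y ∈ (chartAt E x).source) (v : TangentSpace 𝓘(ℝ, E) y) :
    coframe x y (cplxJ y v) = Complex.I • coframe x y v := by
  rw [coframe_eq hy]
  exact mfderiv_cplxJ (mdifferentiableAt_extChartAt_complex hy) v

theorem VDiffAt.cplxJ {X : VField E M} {x : M} (hX : VDiffAt X x) :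
    VDiffAt (fun y => cplxJ y (X y)) x := by
  rw [vDiffAt_iff] at hX ⊢
  have h1 := mdifferentiableAt_clm_comp (Complex.I • ContinuousLinearMap.id ℝ E : E →L[ℝ] E) hX
  refine h1.congr_of_eventuallyEq ?_
  filter_upwards [(chartAt E x).open_source.mem_nhds (mem_chart_source E x)] with y hy
  rw [coframe_cplxJ hy]
  rfl

omit [IsManifold 𝓘(ℂ, E) ω M] in
theorem cplxJ_cplxJ (x : M) (v : TangentSpace 𝓘(ℝ, E) x) : cplxJ x (cplxJ x v) = - v := by
  have h (w : E) : Complex.I • (Complex.I • w) = -w := by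
    rw [smul_smul, Complex.I_mul_I, neg_one_smul]
  exact h v

end DerivativeRules

/-! ### Kählerian Lagrangian immersions and the structures they induce. -/

section KahlerianLagrangian
variable {E : Type*} [NormedAddCommGroup E] [NormedSpace ℂ E] [FiniteDimensional ℂ E]
  {M : Type*} [TopologicalSpace M] [ChartedSpace E M] [IsManifold 𝓘(ℂ, E) ω M]
  {U : Set M} {φ : M → Phase n}

omit [FiniteDimensional ℂ E] [IsManifold 𝓘(ℂ, E) ω M] in
theorem IsKahlerianLagrangian.mono (h : IsKahlerianLagrangian E U φ) {V : Set M} (hV : V ⊆ U) :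
    IsKahlerianLagrangian E V φ :=
  ⟨fun x hx => h.holomorphic x (hV hx), fun x hx => h.immersion x (hV hx),
    fun x hx => h.lagrangian x (hV hx), fun x hx => h.kahlerian x (hV hx)⟩

theorem IsKahlerianLagrangian.contMDiffAt (h : IsKahlerianLagrangian E U φ) (hU : IsOpen U)
    {x : M} (hx : x ∈ U) : ContMDiffAt 𝓘(ℝ, E) 𝓘(ℝ, Phase n) ∞ φ x :=
  contMDiffAt_real_of_holomorphic (Filter.mem_of_superset (hU.mem_nhds hx) h.holomorphic)

omit [FiniteDimensional ℂ E] [IsManifold 𝓘(ℂ, E) ω M] in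
theorem IsKahlerianLagrangian.mdifferentiableAt (h : IsKahlerianLagrangian E U φ)
    {x : M} (hx : x ∈ U) : MDifferentiableAt 𝓘(ℝ, E) 𝓘(ℝ, Phase n) φ x :=
  mdifferentiableAt_real (h.holomorphic x hx)

omit [FiniteDimensional ℂ E] [IsManifold 𝓘(ℂ, E) ω M] in
theorem IsKahlerianLagrangian.dR_reP (h : IsKahlerianLagrangian E U φ) {x : M} (hx : x ∈ U)
    (v : TangentSpace 𝓘(ℝ, E) x) : dR (fun y => reP n (φ y)) x v = reP n (dR φ x v) :=
  dR_clm_comp (reP n) (h.mdifferentiableAt hx) v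

omit [IsManifold 𝓘(ℂ, E) ω M] in
/-- The real part of a Kählerian Lagrangian immersion is a local diffeomorphism. -/
theorem IsKahlerianLagrangian.bijective_dR_reP (hE : Module.finrank ℂ E = n)
    (h : IsKahlerianLagrangian E U φ) {x : M} (hx : x ∈ U) :
    Function.Bijective (dR (E := E) (fun y => reP n (φ y)) x) := by
  have hinj : Function.Injective (dR (E := E) (fun y => reP n (φ y)) x) := by
    rw [injective_iff_map_eq_zero]
    intro v hv
    rw [h.dR_reP hx] at hv
    -- A vector whose image has no real part is γ-orthogonal to the whole tangent space.
    exact h.kahlerian x hx v fun w => eq_zero_of_reP_eq_zero hv _ (h.lagrangian x hx v w)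
  -- Both sides have real dimension 2n, so injectivity gives bijectivity.
  have hdim : Module.finrank ℝ E = Module.finrank ℝ (RealPhase n) := by
    rw [finrank_real_of_complex, hE]
    simp [two_mul]
  let L : E →ₗ[ℝ] RealPhase n := (dR (E := E) (fun y => reP n (φ y)) x).toLinearMap
  exact ⟨hinj, (LinearMap.injective_iff_surjective_of_finrank_eq_finrank (f := L) hdim).1 hinj⟩

/-- The metric and connection `(g, D)` are induced by `φ` at the point `x`. -/
structure InducesAt (g : BilinField E M)
    (D : VField E M → (x : M) → TangentSpace 𝓘(ℝ, E) x →L[ℝ] TangentSpace 𝓘(ℝ, E) x)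
    (φ : M → Phase n) (x : M) : Prop where
  metric : ∀ v w, g x v w = metricForm n (dR φ x v) (dR φ x w)
  connection : ∀ (Y : VField E M) (v : TangentSpace 𝓘(ℝ, E) x), VDiffAt Y x →
    reP n (dR φ x (D Y x v)) = dR (fun y => reP n (dR φ y (Y y))) x v

theorem AffineSpecialKahler.isInducedBy_iff (S : AffineSpecialKahler E M) (hU : IsOpen U)
    (hφ : IsKahlerianLagrangian E U φ) :
    S.IsInducedBy U φ ↔ ∀ x ∈ U, InducesAt S.g S.conn φ x := by
  have key : ∀ x ∈ U, ∀ (Y : VField E M) (v : TangentSpace 𝓘(ℝ, E) x), VDiffAt Y x → ∀ j,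
      dR (fun y => reP n (dR φ y (Y y))) x v j = dR (fun y => (dR φ y (Y y) j).re) x v := by
    intro x hx Y v hY j
    have h1 := mdifferentiableAt_dR_apply ((hφ.contMDiffAt hU hx).of_le two_le_infty) hY
    have h2 := dR_clm_comp (ContinuousLinearMap.proj (R := ℝ) (φ := fun _ : Fin n ⊕ Fin n => ℝ) j)
      (mdifferentiableAt_clm_comp (reP n) h1) v
    exact h2.symm
  constructor
  · intro h x hx
    refine ⟨fun v w => ?_, fun Y v hY => ?_⟩
    · rw [h.metric x hx, metricForm_apply]
    · funext j
      rw [key x hx Y v hY, reP_apply, h.connection x hx Y v hY]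
  · intro h
    refine ⟨fun x hx v w => ?_, fun x hx Y v hY j => ?_⟩
    · rw [(h x hx).metric, metricForm_apply]
    · rw [← key x hx Y v hY, ← (h x hx).connection Y v hY, reP_apply]

omit [FiniteDimensional ℂ E] [IsManifold 𝓘(ℂ, E) ω M] in
theorem dR_comp_real {R : Phase n →L[ℂ] Phase n} {c : Phase n} {φ' : M → Phase n} {x : M}
    (hφ : MDifferentiableAt 𝓘(ℝ, E) 𝓘(ℝ, Phase n) φ x) (h : φ' =ᶠ[𝓝 x] fun y => R (φ y) + c)
    (v : TangentSpace 𝓘(ℝ, E) x) : dR φ' x v = R (dR φ x v) := by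
  have h1 := mdifferentiableAt_clm_comp (R.restrictScalars ℝ) hφ
  rw [dR_congr h]
  refine (DFunLike.congr_fun (dR_add h1 mdifferentiableAt_const) v).trans ?_
  rw [dR_const, add_zero]
  exact dR_clm_comp (R.restrictScalars ℝ) hφ v

omit [FiniteDimensional ℂ E] [IsManifold 𝓘(ℂ, E) ω M] in
theorem IsKahlerianLagrangian.comp_real {R : Phase n →L[ℂ] Phase n} (hR : IsRealSympl R)
    {c : Phase n} {φ' : M → Phase n} (hφ : IsKahlerianLagrangian E U φ)
    (h : ∀ x ∈ U, φ' =ᶠ[𝓝 x] fun y => R (φ y) + c) : IsKahlerianLagrangian E U φ' := by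
  have h1 : ∀ x ∈ U, ∀ v : TangentSpace 𝓘(ℝ, E) x, dR φ' x v = R (dR φ x v) :=
    fun x hx v => dR_comp_real (hφ.mdifferentiableAt hx) (h x hx) v
  refine ⟨fun x hx => ?_, fun x hx => ?_, fun x hx v w => ?_, fun x hx v hv => ?_⟩
  · refine MDifferentiableAt.congr_of_eventuallyEq ?_ (h x hx)
    exact (R.differentiableAt.comp_mdifferentiableAt (hφ.holomorphic x hx)).add
      mdifferentiableAt_const
  · rw [injective_iff_map_eq_zero]
    intro v hv
    rw [h1 x hx] at hv
    exact hφ.immersion x hx (by rw [hR.map_eq_zero hv, map_zero])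
  · rw [h1 x hx, h1 x hx, hR.sympl_eq, hφ.lagrangian x hx]
  · refine hφ.kahlerian x hx v fun w => ?_
    rw [← hR.herm_eq, ← h1 x hx, ← h1 x hx, hv]

-- R preserves γ, hence the metric; it changes Re φ by a fixed real affine map, hence leaves the
-- class of affine functions, and so the connection, unchanged.
omit [FiniteDimensional ℂ E] in
theorem InducesAt.comp_real {g : BilinField E M}
    {D : VField E M → (x : M) → TangentSpace 𝓘(ℝ, E) x →L[ℝ] TangentSpace 𝓘(ℝ, E) x}
    {R : Phase n →L[ℂ] Phase n} (hR : IsRealSympl R) {c : Phase n} {φ' : M → Phase n} {x : M}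
    (hφ : ContMDiffAt 𝓘(ℝ, E) 𝓘(ℝ, Phase n) ∞ φ x) (h : φ' =ᶠ[𝓝 x] fun y => R (φ y) + c)
    (hi : InducesAt g D φ x) : InducesAt g D φ' x := by
  have h1 : ∀ᶠ y in 𝓝 x, ∀ v : TangentSpace 𝓘(ℝ, E) y, dR φ' y v = R (dR φ y v) := by
    have h2 := (contMDiffAt_iff_contMDiffAt_nhds (by simp)).1 (hφ.of_le (m := 1) (by simp))
    filter_upwards [h2, h.eventuallyEq_nhds] with y hy hy' v
    exact dR_comp_real (hy.mdifferentiableAt one_ne_zero) hy' v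
  refine ⟨fun v w => ?_, fun Y v hY => ?_⟩
  · rw [h1.self_of_nhds, h1.self_of_nhds, hi.metric, metricForm_apply, metricForm_apply,
      hR.herm_eq]
  · have h3 : (fun y => reP n (dR φ' y (Y y))) =ᶠ[𝓝 x]
        fun y => realPart R (reP n (dR φ y (Y y))) := by
      filter_upwards [h1] with y hy
      rw [hy, hR.reP_map]
    rw [h1.self_of_nhds, hR.reP_map, hi.connection Y v hY, dR_congr h3]
    exact (dR_clm_comp (realPart R) (mdifferentiableAt_clm_comp (reP n)
      (mdifferentiableAt_dR_apply (hφ.of_le two_le_infty) hY)) v).symm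

end KahlerianLagrangian

/-! ### Affine special Kähler structures from local immersions. -/

section Gluing
variable {E : Type*} [NormedAddCommGroup E] [NormedSpace ℂ E] [FiniteDimensional ℂ E]
  {M : Type*} [TopologicalSpace M] [ChartedSpace E M] [IsManifold 𝓘(ℂ, E) ω M]

variable (n) in
/-- The metric and connection `(g, D)` are locally induced by Kählerian Lagrangian immersions. -/
def LocallyInduced (g : BilinField E M)
    (D : VField E M → (x : M) → TangentSpace 𝓘(ℝ, E) x →L[ℝ] TangentSpace 𝓘(ℝ, E) x) : Prop :=
  ∀ x, ∃ (U : Set M) (φ : M → Phase n), IsOpen U ∧ x ∈ U ∧ IsKahlerianLagrangian E U φ ∧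
    ∀ y ∈ U, InducesAt g D φ y

/-- A metric and connection near `x`, together with affine coordinates `r`. -/
structure AffineCoordinatesAt (g : BilinField E M)
    (D : VField E M → (x : M) → TangentSpace 𝓘(ℝ, E) x →L[ℝ] TangentSpace 𝓘(ℝ, E) x)
    (φ : M → Phase n) (x : M) : Prop where
  smooth : ContMDiffAt 𝓘(ℝ, E) 𝓘(ℝ, Phase n) ∞ φ x
  smooth_re : ContMDiffAt 𝓘(ℝ, E) 𝓘(ℝ, RealPhase n) ∞ (fun y => reP n (φ y)) x
  bijective : ∀ᶠ y in 𝓝 x, Function.Bijective (dR (E := E) (fun y => reP n (φ y)) y)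
  dR_re : ∀ᶠ y in 𝓝 x, ∀ v : TangentSpace 𝓘(ℝ, E) y,
    dR (fun y => reP n (φ y)) y v = reP n (dR φ y v)
  dR_J : ∀ᶠ y in 𝓝 x, ∀ v : TangentSpace 𝓘(ℝ, E) y, dR φ y (cplxJ y v) = Complex.I • dR φ y v
  metric : ∀ᶠ y in 𝓝 x, ∀ v w, g y v w = metricForm n (dR φ y v) (dR φ y w)
  form : ∀ᶠ y in 𝓝 x, ∀ v w, g y v (cplxJ y w) =
    symplR n (dR (fun y => reP n (φ y)) y v) (dR (fun y => reP n (φ y)) y w)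
  connection : ∀ᶠ y in 𝓝 x, ∀ (Y : VField E M) (v : TangentSpace 𝓘(ℝ, E) y), VDiffAt Y y →
    dR (fun y => reP n (φ y)) y (D Y y v) =
      dR (fun y => dR (fun y => reP n (φ y)) y (Y y)) y v

variable {g : BilinField E M}
  {D : VField E M → (x : M) → TangentSpace 𝓘(ℝ, E) x →L[ℝ] TangentSpace 𝓘(ℝ, E) x}

theorem affineCoordinatesAt (hE : Module.finrank ℂ E = n) {U : Set M} {φ : M → Phase n}
    (hU : IsOpen U) (hφ : IsKahlerianLagrangian E U φ) (hi : ∀ y ∈ U, InducesAt g D φ y) {x : M}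
    (hx : x ∈ U) : AffineCoordinatesAt g D φ x where
  smooth := hφ.contMDiffAt hU hx
  smooth_re := contMDiffAt_clm_comp (reP n) (hφ.contMDiffAt hU hx)
  bijective := by
    filter_upwards [hU.mem_nhds hx] with y hy using hφ.bijective_dR_reP hE hy
  dR_re := by
    filter_upwards [hU.mem_nhds hx] with y hy using hφ.dR_reP hy
  dR_J := by
    filter_upwards [hU.mem_nhds hx] with y hy using dR_cplxJ (hφ.holomorphic y hy)
  metric := by
    filter_upwards [hU.mem_nhds hx] with y hy using (hi y hy).metric
  form := by
    filter_upwards [hU.mem_nhds hx] with y hy v w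
    rw [(hi y hy).metric, dR_cplxJ (hφ.holomorphic y hy),
      metricForm_I_smul (hφ.lagrangian y hy v w), hφ.dR_reP hy, hφ.dR_reP hy]
  connection := by
    filter_upwards [hU.mem_nhds hx] with y hy Y v hY
    rw [hφ.dR_reP hy, (hi y hy).connection Y v hY]
    refine DFunLike.congr_fun (dR_congr ?_) v
    filter_upwards [hU.mem_nhds hy] with z hz
    rw [hφ.dR_reP hz]

theorem LocallyInduced.exists_coordinates (hE : Module.finrank ℂ E = n)
    (h : LocallyInduced n g D) (x : M) : ∃ φ : M → Phase n, AffineCoordinatesAt g D φ x := by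
  obtain ⟨U, φ, hU, hx, hφ, hi⟩ := h x
  exact ⟨φ, affineCoordinatesAt hE hU hφ hi hx⟩

namespace AffineCoordinatesAt

variable {φ : M → Phase n} {x : M} (h : AffineCoordinatesAt g D φ x)
include h

omit [FiniteDimensional ℂ E] in
theorem mdiff {Y : VField E M} (hY : VDiffAt Y x) :
    MDifferentiableAt 𝓘(ℝ, E) 𝓘(ℝ, RealPhase n) (fun y => dR (fun y => reP n (φ y)) y (Y y)) x :=
  mdifferentiableAt_dR_apply (h.smooth_re.of_le two_le_infty) hY

-- In affine coordinates ω has constant coefficients and ∇ is the ordinary derivative, so ∇ω = 0 is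
-- the product rule.
omit [FiniteDimensional ℂ E] in
theorem dR_form {Y Z : VField E M} (hY : VDiffAt Y x) (hZ : VDiffAt Z x)
    (v : TangentSpace 𝓘(ℝ, E) x) :
    dR (fun y => g y (Y y) (cplxJ y (Z y))) x v =
      g x (D Y x v) (cplxJ x (Z x)) + g x (Y x) (cplxJ x (D Z x v)) := by
  have h1 : (fun y => g y (Y y) (cplxJ y (Z y))) =ᶠ[𝓝 x] fun y =>
      symplR n (dR (fun y => reP n (φ y)) y (Y y)) (dR (fun y => reP n (φ y)) y (Z y)) := by
    filter_upwards [h.form] with y hy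
    rw [hy]
  rw [dR_congr h1, dR_bilin (symplR n) (h.mdiff hY) (h.mdiff hZ), h.form.self_of_nhds,
    h.form.self_of_nhds, h.connection.self_of_nhds Y v hY, h.connection.self_of_nhds Z v hZ]

omit [FiniteDimensional ℂ E] in
theorem closed {X Y Z : VField E M} (hX : VDiffAt X x) (hY : VDiffAt Y x) (hZ : VDiffAt Z x) :
    dR (fun y => g y (Y y) (cplxJ y (Z y))) x (X x)
      + dR (fun y => g y (Z y) (cplxJ y (X y))) x (Y x)
      + dR (fun y => g y (X y) (cplxJ y (Y y))) x (Z x)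
      - g x (VectorField.mlieBracket 𝓘(ℝ, E) X Y x) (cplxJ x (Z x))
      - g x (VectorField.mlieBracket 𝓘(ℝ, E) Y Z x) (cplxJ x (X x))
      - g x (VectorField.mlieBracket 𝓘(ℝ, E) Z X x) (cplxJ x (Y x)) = 0 := by
  have h1 (Y Z : VField E M) : (fun y => g y (Y y) (cplxJ y (Z y))) =ᶠ[𝓝 x] fun y =>
      symplR n (dR (fun y => reP n (φ y)) y (Y y)) (dR (fun y => reP n (φ y)) y (Z y)) := by
    filter_upwards [h.form] with y hy
    rw [hy]
  rw [dR_congr (h1 Y Z), dR_congr (h1 Z X), dR_congr (h1 X Y), h.form.self_of_nhds,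
    h.form.self_of_nhds, h.form.self_of_nhds]
  exact closed_pullback_const (symplR n) symplR_swap (h.smooth_re.of_le two_le_infty) hX hY hZ

omit [FiniteDimensional ℂ E] in
theorem eq_of_dR_eq {v w : TangentSpace 𝓘(ℝ, E) x}
    (hvw : dR (fun y => reP n (φ y)) x v = dR (fun y => reP n (φ y)) x w) : v = w :=
  h.bijective.self_of_nhds.1 hvw

omit [FiniteDimensional ℂ E] in
theorem torsionFree {X Y : VField E M} (hX : VDiffAt X x) (hY : VDiffAt Y x) :
    D Y x (X x) - D X x (Y x) = VectorField.mlieBracket 𝓘(ℝ, E) X Y x := by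
  apply h.eq_of_dR_eq
  rw [map_sub, h.connection.self_of_nhds Y _ hY, h.connection.self_of_nhds X _ hX]
  exact dR_bracket (h.smooth_re.of_le two_le_infty) hX hY

omit [FiniteDimensional ℂ E] in
theorem smooth_im :
    ContMDiffAt 𝓘(ℝ, E) 𝓘(ℝ, RealPhase n) ∞ (fun y => -imP n (φ y)) x :=
  contMDiffAt_clm_comp (-imP n) h.smooth

-- As dφ is complex linear, J followed by d Re φ is the differential of -Im φ. Read in affine
-- coordinates, J is thus an exact vector valued 1-form, which is the source of d^∇J = 0.
omit [FiniteDimensional ℂ E] in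
theorem dR_re_J : ∀ᶠ y in 𝓝 x, ∀ v : TangentSpace 𝓘(ℝ, E) y,
    dR (fun y => reP n (φ y)) y (cplxJ y v) = dR (fun y => -imP n (φ y)) y v := by
  have h2 := (contMDiffAt_iff_contMDiffAt_nhds (by simp)).1 (h.smooth.of_le (m := 1) (by simp))
  filter_upwards [h.dR_re, h.dR_J, h2] with y h1 h2 h3 v
  rw [h1, h2, reP_I_smul]
  exact (dR_clm_comp (-imP n) (h3.mdifferentiableAt one_ne_zero) v).symm

omit [FiniteDimensional ℂ E] in
theorem dJ_eq_zero {X Y : VField E M} (hX : VDiffAt X x) (hY : VDiffAt Y x) :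
    D (fun y => cplxJ y (Y y)) x (X x) - D (fun y => cplxJ y (X y)) x (Y x)
      - cplxJ x (VectorField.mlieBracket 𝓘(ℝ, E) X Y x) = 0 := by
  rw [sub_eq_zero]
  apply h.eq_of_dR_eq
  have h1 (Y : VField E M) : (fun y => dR (fun y => reP n (φ y)) y (cplxJ y (Y y))) =ᶠ[𝓝 x]
      fun y => dR (fun y => -imP n (φ y)) y (Y y) := by
    filter_upwards [h.dR_re_J] with y hy
    rw [hy]
  rw [map_sub, h.connection.self_of_nhds _ _ hY.cplxJ, h.connection.self_of_nhds _ _ hX.cplxJ,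
    dR_congr (h1 X), dR_congr (h1 Y), h.dR_re_J.self_of_nhds]
  exact dR_bracket (h.smooth_im.of_le two_le_infty) hX hY

omit [FiniteDimensional ℂ E] in
theorem contMDiffAt_dR {X : VField E M} (hX : ContMDiffAt 𝓘(ℝ, E) 𝓘(ℝ, E).tangent ∞
    (fun y => (⟨y, X y⟩ : TangentBundle 𝓘(ℝ, E) M)) x) :
    ContMDiffAt 𝓘(ℝ, E) 𝓘(ℝ, RealPhase n) ∞ (fun y => dR (fun y => reP n (φ y)) y (X y)) x :=
  contMDiffAt_dR_apply h.smooth_re le_rfl hX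

/-- In affine coordinates Z becomes the vector valued function s = dr(Z) and ∇Z becomes ds, so
flatness is `dR_bracket` for s. -/
theorem flat {X Y Z : VField E M} (hX : VSmooth X) (hY : VSmooth Y) (hZ : VSmooth Z) :
    D (fun y => D Z y (Y y)) x (X x) - D (fun y => D Z y (X y)) x (Y x)
      = D Z x (VectorField.mlieBracket 𝓘(ℝ, E) X Y x) := by
  have hdiff {X : VField E M} (hX : VSmooth X) (y : M) : VDiffAt X y :=
    (hX y).mdifferentiableAt (by simp)
  have hs := h.contMDiffAt_dR (hZ x)
  have h1 (Y : VField E M) : (fun y => dR (fun y => reP n (φ y)) y (D Z y (Y y))) =ᶠ[𝓝 x]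
      fun y => dR (fun y => dR (fun y => reP n (φ y)) y (Z y)) y (Y y) := by
    filter_upwards [h.connection] with y hy
    rw [hy Z _ (hdiff hZ y)]
  -- Differentiability of ∇_Y Z is needed before ∇ of it can be computed in coordinates.
  have h2 {Y : VField E M} (hY : VSmooth Y) : VDiffAt (fun y => D Z y (Y y)) x := by
    refine vDiffAt_of_dR h.smooth_re h.bijective ?_
    exact (mdifferentiableAt_dR_apply (hs.of_le two_le_infty) (hdiff hY x)).congr_of_eventuallyEq
      (h1 Y)
  apply h.eq_of_dR_eq
  rw [map_sub, h.connection.self_of_nhds _ _ (h2 hY), h.connection.self_of_nhds _ _ (h2 hX),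
    dR_congr (h1 X), dR_congr (h1 Y), h.connection.self_of_nhds Z _ (hdiff hZ x)]
  exact dR_bracket (hs.of_le two_le_infty) (hdiff hX x) (hdiff hY x)

theorem contMDiffAt_connection {Y : VField E M} (hY : VSmooth Y) :
    ContMDiffAt 𝓘(ℝ, E) (𝓘(ℝ, E).prod 𝓘(ℝ, E →L[ℝ] E)) ∞
      (fun x => TotalSpace.mk' (E →L[ℝ] E)
        (E := fun x : M => TangentSpace 𝓘(ℝ, E) x →L[ℝ] TangentSpace 𝓘(ℝ, E) x) x (D Y x)) x := by
  refine contMDiffAt_endomorphism_of_dR h.smooth_re h.bijective (h.contMDiffAt_dR (hY x)) ?_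
  filter_upwards [h.connection] with y hy v
  exact hy Y v ((hY y).mdifferentiableAt (by simp))

omit [FiniteDimensional ℂ E] in
theorem nondeg {v : TangentSpace 𝓘(ℝ, E) x} (hv : ∀ w, g x v w = 0) : v = 0 := by
  have h1 : dR (fun y => reP n (φ y)) x v = 0 := by
    refine eq_zero_of_symplR fun b => ?_
    obtain ⟨w, rfl⟩ := h.bijective.self_of_nhds.2 b
    rw [← h.form.self_of_nhds, hv]
  exact h.eq_of_dR_eq (by rw [h1, map_zero])

omit [FiniteDimensional ℂ E] in
theorem symm (v w : TangentSpace 𝓘(ℝ, E) x) : g x v w = g x w v := by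
  rw [h.metric.self_of_nhds, h.metric.self_of_nhds, metricForm_apply, metricForm_apply, herm_swap,
    Complex.conj_re]

omit [FiniteDimensional ℂ E] in
theorem invariant (v w : TangentSpace 𝓘(ℝ, E) x) : g x (cplxJ x v) (cplxJ x w) = g x v w := by
  rw [h.metric.self_of_nhds, h.metric.self_of_nhds, metricForm_apply, metricForm_apply,
    h.dR_J.self_of_nhds, h.dR_J.self_of_nhds, herm_smul_left, herm_smul_right, ← mul_assoc]
  simp

omit [FiniteDimensional ℂ E] in
theorem contMDiffAt_metric :
    ContMDiffAt 𝓘(ℝ, E) (𝓘(ℝ, E).prod 𝓘(ℝ, E →L[ℝ] E →L[ℝ] ℝ)) ∞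
      (fun x => TotalSpace.mk' (E →L[ℝ] E →L[ℝ] ℝ)
        (E := fun x : M => TangentSpace 𝓘(ℝ, E) x →L[ℝ] TangentSpace 𝓘(ℝ, E) x →L[ℝ] ℝ)
        x (g x)) x :=
  contMDiffAt_bilin_dR h.smooth contMDiffAt_const h.metric

omit [FiniteDimensional ℂ E] in
theorem map_add {Y Z : VField E M} (hY : VDiffAt Y x) (hZ : VDiffAt Z x) (hYZ : VDiffAt (Y + Z) x) :
    D (Y + Z) x = D Y x + D Z x := by
  ext v
  apply h.eq_of_dR_eq
  rw [add_apply, _root_.map_add, h.connection.self_of_nhds _ _ hY,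
    h.connection.self_of_nhds _ _ hZ, h.connection.self_of_nhds _ _ hYZ, ← add_apply,
    ← dR_add (h.mdiff hY) (h.mdiff hZ)]
  simp

omit [FiniteDimensional ℂ E] in
theorem leibniz {Y : VField E M} {a : M → ℝ} (hY : VDiffAt Y x)
    (ha : MDifferentiableAt 𝓘(ℝ, E) 𝓘(ℝ, ℝ) a x) (haY : VDiffAt (a • Y) x) :
    D (a • Y) x = a x • D Y x + (dR a x).smulRight (Y x) := by
  ext v
  apply h.eq_of_dR_eq
  rw [add_apply, _root_.map_add, smul_apply, map_smul, h.connection.self_of_nhds _ _ hY,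
    h.connection.self_of_nhds _ _ haY, ContinuousLinearMap.smulRight_apply, map_smul,
    ← dR_smul ha (h.mdiff hY)]
  simp

end AffineCoordinatesAt

theorem LocallyInduced.isCovariantDerivativeOn (hE : Module.finrank ℂ E = n)
    (h : LocallyInduced n g D) : IsCovariantDerivativeOn (I := 𝓘(ℝ, E)) E D univ where
  add {Y Z x} hY hZ _ := by
    obtain ⟨φ, hφ⟩ := h.exists_coordinates hE x
    exact hφ.map_add hY hZ (mdifferentiableAt_add_section hY hZ)
  leibniz {Y a x} hY ha _ := by
    obtain ⟨φ, hφ⟩ := h.exists_coordinates hE x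
    exact hφ.leibniz hY ha (MDifferentiableAt.smul_section ha hY)

/-- The affine special Kähler structure that is locally induced by Kählerian Lagrangian
immersions. -/
def LocallyInduced.affineSpecialKahler (hE : Module.finrank ℂ E = n)
    (h : LocallyInduced n g D) : AffineSpecialKahler E M where
  g := g
  smooth x := (h.exists_coordinates hE x).choose_spec.contMDiffAt_metric
  symm x := (h.exists_coordinates hE x).choose_spec.symm
  nondeg x _ := (h.exists_coordinates hE x).choose_spec.nondeg
  invariant x := (h.exists_coordinates hE x).choose_spec.invariant
  closed _ _ _ x hX hY hZ := (h.exists_coordinates hE x).choose_spec.closed hX hY hZ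
  conn := ⟨D, h.isCovariantDerivativeOn hE⟩
  conn_smooth := ⟨⟨fun {_} hY x _ =>
    ((h.exists_coordinates hE x).choose_spec.contMDiffAt_connection
      (contMDiffOn_univ.1 hY)).contMDiffWithinAt⟩⟩
  torsionFree _ _ x hX hY := (h.exists_coordinates hE x).choose_spec.torsionFree hX hY
  flat _ _ _ hX hY hZ x := (h.exists_coordinates hE x).choose_spec.flat hX hY hZ
  form_parallel _ _ x v hY hZ := (h.exists_coordinates hE x).choose_spec.dR_form hY hZ v
  dJ_eq_zero _ _ x hX hY := (h.exists_coordinates hE x).choose_spec.dJ_eq_zero hX hY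

end Gluing

/-! ### The Levi-Civita connection of an affine special Kähler structure. -/

section LeviCivita
variable {E : Type*} [NormedAddCommGroup E] [NormedSpace ℂ E]
  {M : Type*} [TopologicalSpace M] [ChartedSpace E M] [IsManifold 𝓘(ℂ, E) ω M]

namespace AffineSpecialKahler

variable (S : AffineSpecialKahler E M)

/-- The Levi-Civita connection `D Y = ½ (∇Y - J ∇(J Y))`. -/
def leviCivita : Connection E M where
  toFun Y x := (1 / 2 : ℝ) •
    (S.conn Y x - (cplxJ x).comp (S.conn (fun y => cplxJ y (Y y)) x))
  isCovariantDerivativeOnUniv :=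
    { add := by
        intro Y Z x hY hZ _
        have h1 : (fun y => cplxJ y ((Y + Z) y)) =
            (fun y => cplxJ y (Y y)) + fun y => cplxJ y (Z y) := by
          funext y; exact map_add (cplxJ y) _ _
        have h2 : S.conn (Y + Z) x = S.conn Y x + S.conn Z x :=
          S.conn.isCovariantDerivativeOnUniv.add hY hZ
        have h3 : S.conn ((fun y => cplxJ y (Y y)) + fun y => cplxJ y (Z y)) x =
            S.conn (fun y => cplxJ y (Y y)) x + S.conn (fun y => cplxJ y (Z y)) x :=
          S.conn.isCovariantDerivativeOnUniv.add (VDiffAt.cplxJ hY) (VDiffAt.cplxJ hZ)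
        rw [h1, h2, h3, ContinuousLinearMap.comp_add, add_sub_add_comm, smul_add]
      leibniz := by
        intro Y a x hY ha _
        have h1 : (fun y => cplxJ y ((a • Y) y)) = a • fun y => cplxJ y (Y y) := by
          funext y; exact map_smul (cplxJ y) (a y) _
        have h2 : S.conn (a • Y) x = a x • S.conn Y x + (dR a x).smulRight (Y x) :=
          S.conn.isCovariantDerivativeOnUniv.leibniz hY ha
        have h3 : S.conn (a • fun y => cplxJ y (Y y)) x =
            a x • S.conn (fun y => cplxJ y (Y y)) x + (dR a x).smulRight (cplxJ x (Y x)) :=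
          S.conn.isCovariantDerivativeOnUniv.leibniz (VDiffAt.cplxJ hY) ha
        -- Since J² = -1, both halves contribute da ⊗ Y, which the factor ½ averages.
        have h4 : (cplxJ (E := E) x).comp ((dR (E := E) a x).smulRight (cplxJ x (Y x))) =
            - (dR (E := E) a x).smulRight (Y x) := by
          ext v
          simp only [ContinuousLinearMap.comp_apply, ContinuousLinearMap.smulRight_apply, map_smul,
            cplxJ_cplxJ, neg_apply, smul_neg]
        rw [h1, h2, h3, ContinuousLinearMap.comp_add, h4, ContinuousLinearMap.comp_smul]
        change _ = a x • _ + (dR a x).smulRight (Y x)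
        module }

theorem leviCivita_apply (Y : VField E M) (x : M) (v : TangentSpace 𝓘(ℝ, E) x) :
    S.leviCivita Y x v =
      (1 / 2 : ℝ) • (S.conn Y x v - cplxJ x (S.conn (fun y => cplxJ y (Y y)) x v)) := rfl

/-- Write g(Y, Z) = -ω(Y, JZ) and use ∇ω = 0: the connections ∇ and -J∇J are dual with respect to g.
-/
theorem dR_metric {Y Z : VField E M} {x : M} (v : TangentSpace 𝓘(ℝ, E) x)
    (hY : VDiffAt Y x) (hZ : VDiffAt Z x) :
    dR (fun y => S.g y (Y y) (Z y)) x v =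
      S.g x (S.conn Y x v) (Z x) - S.g x (Y x) (cplxJ x (S.conn (fun y => cplxJ y (Z y)) x v)) := by
  have h1 : (fun y => S.g y (Y y) (Z y)) =
      - fun y => S.form y (Y y) (cplxJ y (Z y)) := by
    funext y
    simp only [PseudoKahler.form, Pi.neg_apply, cplxJ_cplxJ, map_neg, neg_neg]
  rw [h1, dR, mvfderiv_neg, neg_apply]
  refine (congrArg Neg.neg (S.form_parallel Y _ x v hY hZ.cplxJ)).trans ?_
  simp only [PseudoKahler.form, cplxJ_cplxJ, map_neg]
  ring

/-- By d^∇J = 0 the connection -J∇J is torsion-free like ∇, hence so is the mean of the two.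
Averaging the duality formula `dR_metric` with its version for exchanged arguments shows that the
mean is metric. -/
theorem isLeviCivita : IsLeviCivita S.toPseudoKahler S.leviCivita := by
  refine ⟨fun X Y x hX hY => ?_, fun Y Z x v hY hZ => ?_⟩
  · have h1 := S.torsionFree X Y x hX hY
    have h2 := sub_eq_zero.1 (S.dJ_eq_zero X Y x hX hY)
    rw [leviCivita_apply, leviCivita_apply, ← smul_sub, sub_sub_sub_comm, h1, ← map_sub, h2,
      cplxJ_cplxJ]
    module
  · have h1 := S.dR_metric v hY hZ
    have h2 := S.dR_metric v hZ hY
    have h3 : (fun y => S.g y (Z y) (Y y)) = fun y => S.g y (Y y) (Z y) := by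
      funext y; exact S.symm y _ _
    rw [h3] at h2
    rw [leviCivita_apply, leviCivita_apply]
    simp only [map_smul, map_sub, smul_apply, sub_apply, smul_eq_mul]
    rw [S.symm x (cplxJ x _) (Z x), S.symm x (S.conn Y x v)]
    rw [S.symm x (S.conn Y x v)] at h1
    rw [S.symm x (S.conn Z x v)] at h2
    linarith

/-- If `∇ξ = Id` and `∇(J ξ) = J`, then also `D ξ = Id`. -/
theorem leviCivita_eq_id {ξ : VField E M} {x : M} {v : TangentSpace 𝓘(ℝ, E) x}
    (h : S.conn ξ x v = v) (hJ : S.conn (fun y => cplxJ y (ξ y)) x v = cplxJ x v) :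
    S.leviCivita ξ x v = v := by
  rw [leviCivita_apply, h, hJ, cplxJ_cplxJ]
  module

end AffineSpecialKahler
end LeviCivita

/-! ### The pairing zᵗw and symplectic matrices. -/

section Pairing

variable (n) in
/-- The complex bilinear form `(a, b) ↦ z(a)ᵗ w(b)`. -/
def pairing : Phase n →L[ℂ] Phase n →L[ℂ] ℂ :=
  ∑ i, (ContinuousLinearMap.mul ℂ ℂ).bilinearComp
    (ContinuousLinearMap.proj (R := ℂ) (φ := fun _ : Fin n ⊕ Fin n => ℂ) (Sum.inl i))
    (ContinuousLinearMap.proj (R := ℂ) (φ := fun _ : Fin n ⊕ Fin n => ℂ) (Sum.inr i))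

theorem pairing_apply (a b : Phase n) :
    pairing n a b = ∑ i, a (Sum.inl i) * b (Sum.inr i) := by
  simp [pairing, sum_apply]

theorem zw_eq_pairing (a : Phase n) : zw a = pairing n a a := (pairing_apply a a).symm

theorem sympl_eq_pairing (a b : Phase n) : sympl a b = pairing n a b - pairing n b a := by
  rw [pairing_apply, pairing_apply, ← Finset.sum_sub_distrib]
  exact Finset.sum_congr rfl fun i _ => by ring

variable (n) in
/-- `pairing` as a real bilinear form. -/
def pairingR : Phase n →L[ℝ] Phase n →L[ℝ] ℂ := (pairing n).bilinearRestrictScalars ℝ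

/-- The action of a real symplectic matrix as a continuous linear map. -/
def spActL (X : Matrix.symplecticGroup (Fin n) ℝ) : Phase n →L[ℂ] Phase n :=
  LinearMap.toContinuousLinearMap (Matrix.mulVecLin
    ((X : Matrix (Fin n ⊕ Fin n) (Fin n ⊕ Fin n) ℝ).map (algebraMap ℝ ℂ)))

theorem spActL_apply (X : Matrix.symplecticGroup (Fin n) ℝ) (a : Phase n) :
    spActL X a = spAct X a := rfl

theorem isRealSympl_spActL (X : Matrix.symplecticGroup (Fin n) ℝ) : IsRealSympl (spActL X) where
  sympl_eq := sympl_spAct X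
  map_conj a := by
    ext j
    simp [spActL_apply, spAct, Matrix.mulVec, dotProduct]

theorem reP_spAct (X : Matrix.symplecticGroup (Fin n) ℝ) (a : Phase n) :
    reP n (spAct X a) = X.1.mulVec (reP n a) := by
  ext j
  simp [spAct, Matrix.mulVec, dotProduct]

theorem symplR_eq_dotProduct (a b : RealPhase n) :
    symplR n a b = - dotProduct a ((Matrix.J (Fin n) ℝ).mulVec b) := by
  simp [symplR_apply, Matrix.J, dotProduct, Matrix.mulVec, Fintype.sum_sum_type, Matrix.one_apply,
    Finset.sum_sub_distrib]
  ring

theorem exists_symplecticGroup (A : RealPhase n →L[ℝ] RealPhase n)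
    (hA : ∀ a b, symplR n (A a) (A b) = symplR n a b) :
    ∃ X : Matrix.symplecticGroup (Fin n) ℝ, ∀ a, X.1.mulVec a = A a := by
  let L : RealPhase n →ₗ[ℝ] RealPhase n := A
  have hL (a) : (LinearMap.toMatrix' L).mulVec a = A a := LinearMap.toMatrix'_mulVec L a
  refine ⟨⟨LinearMap.toMatrix' L, SymplecticGroup.mem_iff'.2 ?_⟩, hL⟩
  refine Matrix.ext_of_mulVec_single fun j => ?_
  refine dotProduct_eq _ _ fun a => ?_
  have h1 := hA a (Pi.single j 1)
  rw [symplR_eq_dotProduct, symplR_eq_dotProduct, neg_inj] at h1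
  rw [dotProduct_comm _ a, dotProduct_comm _ a, ← h1, ← hL, ← hL, ← Matrix.mulVec_mulVec,
    ← Matrix.mulVec_mulVec, Matrix.dotProduct_mulVec a, Matrix.vecMul_transpose]

end Pairing

/-! ### Functions with vanishing differential. -/

section LocallyConstant
variable {E : Type*} [NormedAddCommGroup E] [NormedSpace ℂ E]
  {M : Type*} [TopologicalSpace M] [ChartedSpace E M] [IsManifold 𝓘(ℂ, E) ω M]
  {W : Type*} [NormedAddCommGroup W] [NormedSpace ℝ W]

theorem eventually_eq_of_dR_eq_zero {f : M → W} {x : M}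
    (hf : ∀ᶠ y in 𝓝 x, MDifferentiableAt 𝓘(ℝ, E) 𝓘(ℝ, W) f y)
    (h : ∀ᶠ y in 𝓝 x, dR (E := E) f y = 0) : ∀ᶠ y in 𝓝 x, f y = f x := by
  have h3 := (continuousAt_extChartAt_symm (I := 𝓘(ℝ, E)) x).tendsto
  rw [extChartAt_to_inv] at h3
  obtain ⟨r, hr, hball⟩ := Metric.eventually_nhds_iff_ball.1
    ((Filter.eventually_mem_set.2 (extChartAt_target_mem_nhds (I := 𝓘(ℝ, E)) x)).and
      (h3.eventually (hf.and h)))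
  set z₀ := extChartAt 𝓘(ℝ, E) x x with hz₀
  set g := f ∘ (extChartAt 𝓘(ℝ, E) x).symm with hg
  have hd : ∀ z ∈ Metric.ball z₀ r, DifferentiableAt ℝ g z ∧ fderiv ℝ g z = 0 := by
    intro z hz
    obtain ⟨h4, h5, h6⟩ := hball z hz
    have h7 := mdifferentiableWithinAt_extChartAt_symm (I := 𝓘(ℝ, E)) h4
    rw [ModelWithCorners.range_eq_univ, mdifferentiableWithinAt_univ] at h7
    refine ⟨mdifferentiableAt_iff_differentiableAt.1 (h5.comp z h7), ?_⟩
    rw [hg, ← dR_comp_frame_symm h4 h5, h6, ContinuousLinearMap.zero_comp]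
  have hc : ∀ z ∈ Metric.ball z₀ r, g z = g z₀ := by
    intro z hz
    exact Metric.isOpen_ball.is_const_of_fderiv_eq_zero (convex_ball z₀ r).isPreconnected
      (fun z hz => (hd z hz).1.differentiableWithinAt) (fun z hz => (hd z hz).2) hz
      (Metric.mem_ball_self hr)
  filter_upwards [(continuousAt_extChartAt (I := 𝓘(ℝ, E)) x).preimage_mem_nhds
    (Metric.ball_mem_nhds _ hr), extChartAt_source_mem_nhds (I := 𝓘(ℝ, E)) x] with y hy hy'
  have := hc _ hy
  rwa [hg, Function.comp_apply, (extChartAt 𝓘(ℝ, E) x).left_inv hy', Function.comp_apply,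
    extChartAt_to_inv] at this

end LocallyConstant

/-! ### The action of G_SK on special Kähler pairs and its transitivity. -/

section Pairs
variable {E : Type*} [NormedAddCommGroup E] [NormedSpace ℂ E]
  {M : Type*} [TopologicalSpace M] [ChartedSpace E M] [IsManifold 𝓘(ℂ, E) ω M]
  {S : AffineSpecialKahler E M} {U : Set M} {φ φ' : M → Phase n} {F F' : M → ℂ}

theorem IsSpecialKahlerPair.mono (h : IsSpecialKahlerPair S U φ F) {V : Set M} (hV : V ⊆ U) :
    IsSpecialKahlerPair S V φ F where
  isKahlerianLagrangian :=
    ⟨fun x hx => h.1.holomorphic x (hV hx), fun x hx => h.1.immersion x (hV hx),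
      fun x hx => h.1.lagrangian x (hV hx), fun x hx => h.1.kahlerian x (hV hx)⟩
  induced := ⟨fun x hx => h.induced.metric x (hV hx), fun x hx => h.induced.connection x (hV hx)⟩
  prepotential_holomorphic x hx := h.prepotential_holomorphic x (hV hx)
  prepotential x hx := h.prepotential x (hV hx)

theorem IsSpecialKahlerPair.dR_prepotential (h : IsSpecialKahlerPair S U φ F) {y : M} (hy : y ∈ U)
    (v : TangentSpace 𝓘(ℝ, E) y) : dR F y v = pairing n (dR φ y v) (φ y) := by
  rw [h.prepotential y hy, pairing_apply]
  exact Finset.sum_congr rfl fun i _ => mul_comm _ _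

theorem GSK.smul_fst (x : GSK n) (a : Phase n × ℂ) : (x • a).1 = spAct x.X a.1 + x.v := rfl

theorem GSK.smul_snd (x : GSK n) (a : Phase n × ℂ) : (x • a).2 =
    a.2 - ((1 / 2 : ℂ) • pairing n) a.1 a.1
      + ((1 / 2 : ℂ) • pairing n) (spAct x.X a.1 + x.v) (spAct x.X a.1 + x.v)
      + ((1 / 2 : ℂ) • ((pairing n).flip x.v - pairing n x.v)) (spAct x.X a.1 + x.v) - x.s := by
  change a.2 - 1 / 2 * zw a.1 + 1 / 2 * zw (spAct x.X a.1 + x.v)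
    + 1 / 2 * sympl (spAct x.X a.1 + x.v) x.v - x.s = _
  simp only [zw_eq_pairing, sympl_eq_pairing, smul_apply, sub_apply, smul_eq_mul,
    ContinuousLinearMap.flip_apply]

omit [IsManifold 𝓘(ℂ, E) ω M] in
theorem mdifferentiableAt_bilin_complex (B : Phase n →L[ℂ] Phase n →L[ℂ] ℂ) {x : M}
    (hφ : MDifferentiableAt 𝓘(ℂ, E) 𝓘(ℂ, Phase n) φ x) :
    MDifferentiableAt 𝓘(ℂ, E) 𝓘(ℂ, ℂ) (fun y => B (φ y) (φ y)) x :=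
  (B.differentiableAt.comp_mdifferentiableAt hφ).clm_apply hφ

omit [IsManifold 𝓘(ℂ, E) ω M] in
theorem GSK.mdifferentiableAt_smul_fst (x : GSK n) {y : M}
    (hφ : MDifferentiableAt 𝓘(ℂ, E) 𝓘(ℂ, Phase n) φ y) :
    MDifferentiableAt 𝓘(ℂ, E) 𝓘(ℂ, Phase n) (fun y => spAct x.X (φ y) + x.v) y :=
  ((spActL x.X).differentiableAt.comp_mdifferentiableAt hφ).add mdifferentiableAt_const

omit [IsManifold 𝓘(ℂ, E) ω M] in
theorem GSK.mdifferentiableAt_smul_snd (x : GSK n) {y : M}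
    (hφ : MDifferentiableAt 𝓘(ℂ, E) 𝓘(ℂ, Phase n) φ y)
    (hF : MDifferentiableAt 𝓘(ℂ, E) 𝓘(ℂ, ℂ) F y) :
    MDifferentiableAt 𝓘(ℂ, E) 𝓘(ℂ, ℂ) (fun y => (x • (φ y, F y)).2) y := by
  have h1 := x.mdifferentiableAt_smul_fst hφ
  simp only [GSK.smul_snd]
  exact (((hF.sub (mdifferentiableAt_bilin_complex _ hφ)).add
    (mdifferentiableAt_bilin_complex _ h1)).add
    ((ContinuousLinearMap.differentiableAt _).comp_mdifferentiableAt h1)).sub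
    mdifferentiableAt_const

theorem dR_bilin_self (B : Phase n →L[ℂ] Phase n →L[ℂ] ℂ) {x : M}
    (hφ : MDifferentiableAt 𝓘(ℝ, E) 𝓘(ℝ, Phase n) φ x) (v : TangentSpace 𝓘(ℝ, E) x) :
    dR (fun y => B (φ y) (φ y)) x v = B (dR φ x v) (φ x) + B (φ x) (dR φ x v) :=
  dR_bilin (B.bilinearRestrictScalars ℝ) hφ hφ v

omit [IsManifold 𝓘(ℂ, E) ω M] in
theorem dR_sum_of_terms {a b c d : M → ℂ} {x : M} (ha : MDifferentiableAt 𝓘(ℝ, E) 𝓘(ℝ, ℂ) a x)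
    (hb : MDifferentiableAt 𝓘(ℝ, E) 𝓘(ℝ, ℂ) b x) (hc : MDifferentiableAt 𝓘(ℝ, E) 𝓘(ℝ, ℂ) c x)
    (hd : MDifferentiableAt 𝓘(ℝ, E) 𝓘(ℝ, ℂ) d x) (s : ℂ) (v : TangentSpace 𝓘(ℝ, E) x) :
    dR (fun y => a y - b y + c y + d y - s) x v = dR a x v - dR b x v + dR c x v + dR d x v := by
  have h1 := ha.sub hb
  have h2 := h1.add hc
  have h3 := h2.add hd
  have e1 := DFunLike.congr_fun (dR_sub ha hb) v
  have e2 := DFunLike.congr_fun (dR_add h1 hc) v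
  have e3 := DFunLike.congr_fun (dR_add h2 hd) v
  have e4 := DFunLike.congr_fun (dR_sub h3 (mdifferentiableAt_const (c := s))) v
  refine e4.trans ?_
  rw [dR_const, sub_zero]
  refine e3.trans (congrArg (· + dR d x v) (e2.trans (congrArg (· + dR c x v) e1)))

/-- The differential of F - ½zᵗw is ½Ω(dφ, φ), which is invariant under the symplectic group. The
terms ½z'ᵗw' + ½Ω(φ', v) turn it back into ∑ w'ᵢ dz'ⁱ, so the transformed function is again a
prepotential. -/
theorem GSK.dR_smul_snd (x : GSK n) {y : M} (hφ : MDifferentiableAt 𝓘(ℂ, E) 𝓘(ℂ, Phase n) φ y)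
    (hF : MDifferentiableAt 𝓘(ℂ, E) 𝓘(ℂ, ℂ) F y) {v : TangentSpace 𝓘(ℝ, E) y}
    (h : dR F y v = pairing n (dR φ y v) (φ y)) :
    dR (fun y => (x • (φ y, F y)).2) y v =
      pairing n (spAct x.X (dR φ y v)) (spAct x.X (φ y) + x.v) := by
  have h1 := x.mdifferentiableAt_smul_fst hφ
  have h2 : dR (fun y => spAct x.X (φ y) + x.v) y v = spAct x.X (dR φ y v) :=
    dR_comp_real (R := spActL x.X) (mdifferentiableAt_real hφ) (.of_forall fun _ => rfl) v
  have m1 := mdifferentiableAt_bilin_complex ((1 / 2 : ℂ) • pairing n) hφ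
  have m2 := mdifferentiableAt_bilin_complex ((1 / 2 : ℂ) • pairing n) h1
  set L : Phase n →L[ℂ] ℂ := (1 / 2 : ℂ) • ((pairing n).flip x.v - pairing n x.v) with hL
  have m3 : MDifferentiableAt 𝓘(ℂ, E) 𝓘(ℂ, ℂ) (fun y => L (spAct x.X (φ y) + x.v)) y :=
    L.differentiableAt.comp_mdifferentiableAt h1
  have h3 : dR (fun y => L (spAct x.X (φ y) + x.v)) y v = L (spAct x.X (dR φ y v)) := by
    rw [← h2]
    exact dR_clm_comp (L.restrictScalars ℝ) (mdifferentiableAt_real h1) v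
  simp only [GSK.smul_snd]
  refine (dR_sum_of_terms (mdifferentiableAt_real hF) (mdifferentiableAt_real m1)
    (mdifferentiableAt_real m2) (mdifferentiableAt_real m3) x.s v).trans ?_
  rw [h3, dR_bilin_self _ (mdifferentiableAt_real hφ), dR_bilin_self _ (mdifferentiableAt_real h1),
    h2, h, hL]
  have h4 := sympl_spAct x.X (dR φ y v) (φ y)
  rw [sympl_eq_pairing, sympl_eq_pairing] at h4
  simp only [smul_apply, sub_apply, smul_eq_mul, ContinuousLinearMap.flip_apply, map_add, add_apply]
  linear_combination -(1 / 2 : ℂ) * h4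

variable [FiniteDimensional ℂ E]

theorem IsSpecialKahlerPair.smul (hU : IsOpen U) (h : IsSpecialKahlerPair S U φ F) (x : GSK n) :
    IsSpecialKahlerPair S U (fun y => (x • (φ y, F y)).1) (fun y => (x • (φ y, F y)).2) := by
  have h1 : IsKahlerianLagrangian E U (fun y => (x • (φ y, F y)).1) :=
    h.1.comp_real (isRealSympl_spActL x.X) (c := x.v) fun y _ => .of_forall fun _ => rfl
  refine ⟨h1, (S.isInducedBy_iff hU h1).2 fun y hy => ?_, fun y hy => ?_, fun y hy v => ?_⟩
  · exact ((S.isInducedBy_iff hU h.1).1 h.2 y hy).comp_real (isRealSympl_spActL x.X) (c := x.v)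
      (h.1.contMDiffAt hU hy) (.of_forall fun _ => rfl)
  · exact x.mdifferentiableAt_smul_snd (h.1.holomorphic y hy) (h.prepotential_holomorphic y hy)
  · have h2 : dR (fun y => spAct x.X (φ y) + x.v) y v = spAct x.X (dR φ y v) :=
      dR_comp_real (R := spActL x.X) (h.1.mdifferentiableAt hy) (.of_forall fun _ => rfl) v
    rw [x.dR_smul_snd (h.1.holomorphic y hy) (h.prepotential_holomorphic y hy)
      (h.dR_prepotential hy v), pairing_apply]
    change _ = ∑ i, _ * dR (fun y => spAct x.X (φ y) + x.v) y v (Sum.inl i)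
    rw [h2]
    exact Finset.sum_congr rfl fun i _ => mul_comm _ _

/-- Two affine coordinate systems differ by an affine map. -/
theorem exists_linear_of_affineCoordinates {D : Connection E M} {g : BilinField E M}
    {φ φ' : M → Phase n} (hU : IsOpen U) (h : ∀ y ∈ U, AffineCoordinatesAt g D φ y)
    (h' : ∀ y ∈ U, AffineCoordinatesAt g D φ' y) {p : M} (hp : p ∈ U) :
    ∃ A : RealPhase n →L[ℝ] RealPhase n, ∀ᶠ y in 𝓝 p, ∀ v : TangentSpace 𝓘(ℝ, E) y,
      dR (fun y => reP n (φ' y)) y v = A (dR (fun y => reP n (φ y)) y v) := by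
  classical
  set r := fun y => reP n (φ y) with hr
  set r' := fun y => reP n (φ' y) with hr'
  -- The coordinate fields of r on U; the value 0 outside U plays no role.
  have hs : ∀ y : M, ∃ Y : RealPhase n → TangentSpace 𝓘(ℝ, E) y, y ∈ U → ∀ e, dR r y (Y e) = e := by
    intro y
    by_cases hy : y ∈ U
    · choose Y hY using (h y hy).bijective.self_of_nhds.2
      exact ⟨Y, fun _ => hY⟩
    · exact ⟨fun _ => 0, fun hy' => absurd hy' hy⟩
  choose Y hY using hs
  have hYd (e) {y : M} (hy : y ∈ U) : VDiffAt (fun y => Y y e) y := by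
    refine vDiffAt_of_dR (h y hy).smooth_re (h y hy).bijective ?_
    refine (mdifferentiableAt_const (c := e)).congr_of_eventuallyEq ?_
    filter_upwards [hU.mem_nhds hy] with z hz using hY z hz e
  -- Coordinate fields of affine coordinates are parallel, so their components in the second affine
  -- system are locally constant; these components are the entries of A.
  have hY0 (e) {y : M} (hy : y ∈ U) (v : TangentSpace 𝓘(ℝ, E) y) : D (fun y => Y y e) y v = 0 := by
    apply (h y hy).eq_of_dR_eq
    rw [(h y hy).connection.self_of_nhds _ v (hYd e hy), map_zero]
    have h1 : (fun y => dR r y (Y y e)) =ᶠ[𝓝 y] fun _ => e := by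
      filter_upwards [hU.mem_nhds hy] with z hz using hY z hz e
    rw [dR_congr h1, dR_const, zero_apply]
  have hc (e) : ∀ᶠ y in 𝓝 p, dR r' y (Y y e) = dR r' p (Y p e) := by
    refine eventually_eq_of_dR_eq_zero (E := E) (f := fun y => dR r' y (Y y e)) ?_ ?_
    · filter_upwards [hU.mem_nhds hp] with y hy using (h' y hy).mdiff (hYd e hy)
    · filter_upwards [hU.mem_nhds hp] with y hy
      ext1 v
      rw [zero_apply, ← (h' y hy).connection.self_of_nhds _ v (hYd e hy), hY0 e hy, map_zero]
  have hdec (a : RealPhase n) : a = ∑ j, a j • (Pi.single j 1 : RealPhase n) := by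
    funext k
    simp [Finset.sum_apply, Pi.single_apply]
  refine ⟨∑ j, (ContinuousLinearMap.proj (R := ℝ) (φ := fun _ : Fin n ⊕ Fin n => ℝ) j).smulRight
    (dR r' p (Y p (Pi.single j 1))), ?_⟩
  filter_upwards [hU.mem_nhds hp, Filter.eventually_all.2 fun j => hc (Pi.single j 1)]
    with y hy hcy v
  have h1 : v = ∑ j, dR r y v j • Y y (Pi.single j 1) := by
    apply (h y hy).eq_of_dR_eq
    rw [map_sum]
    simp only [map_smul]
    conv_lhs => rw [hdec (dR (fun y => reP n (φ y)) y v)]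
    exact Finset.sum_congr rfl fun j _ => by rw [← hr, hY y hy]
  conv_lhs => rw [h1, map_sum]
  simp only [map_smul, hcy, sum_apply, ContinuousLinearMap.smulRight_apply,
    ContinuousLinearMap.proj_apply]

/-- Both real parts are affine coordinates in which ω is the standard form, so they differ by a
symplectic X and a translation. Complex linearity extends dφ' = X dφ to imaginary parts, integration
yields v, and two prepotentials of the same φ' differ by a constant, which yields s. -/
theorem IsSpecialKahlerPair.exists_eq_smul (hE : Module.finrank ℂ E = n) (hU : IsOpen U)
    (h : IsSpecialKahlerPair S U φ F) (h' : IsSpecialKahlerPair S U φ' F') {p : M} (hp : p ∈ U) :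
    ∃ x : GSK n, ∀ᶠ y in 𝓝 p, (φ' y, F' y) = x • (φ y, F y) := by
  have hc : ∀ y ∈ U, AffineCoordinatesAt S.g S.conn φ y := fun y hy =>
    affineCoordinatesAt hE hU h.1 ((S.isInducedBy_iff hU h.1).1 h.2) hy
  have hc' : ∀ y ∈ U, AffineCoordinatesAt S.g S.conn φ' y := fun y hy =>
    affineCoordinatesAt hE hU h'.1 ((S.isInducedBy_iff hU h'.1).1 h'.2) hy
  obtain ⟨A, hA⟩ := exists_linear_of_affineCoordinates hU hc hc' hp
  have hAs : ∀ a b, symplR n (A a) (A b) = symplR n a b := by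
    intro a b
    obtain ⟨v, rfl⟩ := (hc p hp).bijective.self_of_nhds.2 a
    obtain ⟨w, rfl⟩ := (hc p hp).bijective.self_of_nhds.2 b
    rw [← hA.self_of_nhds, ← hA.self_of_nhds, ← (hc p hp).form.self_of_nhds,
      ← (hc' p hp).form.self_of_nhds]
  obtain ⟨X, hX⟩ := exists_symplecticGroup A hAs
  have h1 : ∀ᶠ y in 𝓝 p, ∀ v : TangentSpace 𝓘(ℝ, E) y, dR φ' y v = spActL X (dR φ y v) := by
    filter_upwards [hA, hU.mem_nhds hp] with y hAy hy
    have h2 (v : TangentSpace 𝓘(ℝ, E) y) : reP n (dR φ' y v) = reP n (spActL X (dR φ y v)) := by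
      rw [← h'.1.dR_reP hy, hAy, spActL_apply, reP_spAct, hX, h.1.dR_reP hy]
    intro v
    refine ext_reP_imP (h2 v) ?_
    -- The imaginary part at v is minus the real part at Jv.
    rw [← neg_inj, ← reP_I_smul, ← reP_I_smul, ← dR_cplxJ (h'.1.holomorphic y hy), h2,
      dR_cplxJ (h.1.holomorphic y hy), map_smul]
  have h2 : ∀ᶠ y in 𝓝 p, φ' y - spActL X (φ y) = φ' p - spActL X (φ p) := by
    refine eventually_eq_of_dR_eq_zero (E := E) (f := fun y => φ' y - spActL X (φ y)) ?_ ?_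
    · filter_upwards [hU.mem_nhds hp] with y hy
      exact (h'.1.mdifferentiableAt hy).sub
        (mdifferentiableAt_clm_comp ((spActL X).restrictScalars ℝ) (h.1.mdifferentiableAt hy))
    · filter_upwards [hU.mem_nhds hp, h1] with y hy h1y
      ext1 v
      have hm := mdifferentiableAt_clm_comp ((spActL X).restrictScalars ℝ)
        (h.1.mdifferentiableAt hy)
      have h3 := DFunLike.congr_fun (dR_sub (h'.1.mdifferentiableAt hy) hm) v
      refine h3.trans ?_
      rw [sub_apply, dR_clm_comp ((spActL X).restrictScalars ℝ) (h.1.mdifferentiableAt hy), h1y]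
      exact sub_self _
  set x₀ : GSK n := ⟨X, 0, φ' p - spActL X (φ p)⟩ with hx₀
  have h3 : ∀ᶠ y in 𝓝 p, φ' y = (x₀ • (φ y, F y)).1 := by
    filter_upwards [h2] with y hy
    rw [GSK.smul_fst, hx₀, ← hy, ← spActL_apply, add_sub_cancel]
  have h4 := h.smul hU x₀
  have h5 : ∀ᶠ y in 𝓝 p, F' y - (x₀ • (φ y, F y)).2 = F' p - (x₀ • (φ p, F p)).2 := by
    refine eventually_eq_of_dR_eq_zero (E := E) (f := fun y => F' y - (x₀ • (φ y, F y)).2) ?_ ?_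
    · filter_upwards [hU.mem_nhds hp] with y hy
      exact mdifferentiableAt_real
        ((h'.prepotential_holomorphic y hy).sub (h4.prepotential_holomorphic y hy))
    · filter_upwards [hU.mem_nhds hp, Filter.EventuallyEq.eventuallyEq_nhds h3] with y hy h3y
      ext1 v
      rw [dR_sub (mdifferentiableAt_real (h'.prepotential_holomorphic y hy))
        (mdifferentiableAt_real (h4.prepotential_holomorphic y hy)), sub_apply,
        h'.dR_prepotential hy, h4.dR_prepotential hy, dR_congr h3y, h3y.self_of_nhds, sub_self]
      rfl
  -- The action subtracts s, hence the sign of the constant.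
  refine ⟨⟨X, -(F' p - (x₀ • (φ p, F p)).2), φ' p - spActL X (φ p)⟩, ?_⟩
  filter_upwards [h3, h5] with y h3y h5y
  refine Prod.ext h3y ?_
  have h6 := sub_eq_iff_eq_add.1 h5y
  rw [h6]
  simp only [GSK.smul_snd, hx₀]
  ring

end Pairs

/-! ### Topology, parallel transport and holonomy of the bundle of germs. -/

section GermBundle
variable {E : Type*} [NormedAddCommGroup E] [NormedSpace ℂ E]
  {M : Type*} [TopologicalSpace M] [ChartedSpace E M] [IsManifold 𝓘(ℂ, E) ω M]
  {S : AffineSpecialKahler E M} {U : Set M} {φ φ' : M → Phase n} {F F' : M → ℂ}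

theorem IsNondegeneratePair.mono (h : IsNondegeneratePair S U φ F) {V : Set M} (hV : V ⊆ U) :
    IsNondegeneratePair S V φ F where
  toIsSpecialKahlerPair := h.toIsSpecialKahlerPair.mono hV
  kahlerian q hq := h.kahlerian q (hV hq)
  norm_ne_zero q hq := h.norm_ne_zero q (hV hq)

namespace SKBundle

theorem exists_isGermOf (u : SKBundle n S) : ∃ U φ F, IsOpen U ∧ u.1 ∈ U ∧
    IsSpecialKahlerPair S U φ F ∧ u.IsGermOf φ F := u.2.2

theorem isGermOf_iff {u : SKBundle n S} (hu : u.IsGermOf φ F) :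
    u.IsGermOf φ' F' ↔ ∀ᶠ y in 𝓝 u.1, (φ' y, F' y) = (φ y, F y) := by
  rw [IsGermOf, show u.2.1 = _ from hu, germAt, germAt, Germ.coe_eq]
  exact eventuallyEq_comm

theorem eq_of_isGermOf {u u' : SKBundle n S} (h : u.1 = u'.1) (hu : u.IsGermOf φ F)
    (hu' : u'.IsGermOf φ F) : u = u' := by
  obtain ⟨p, g, hg⟩ := u
  obtain ⟨p', g', hg'⟩ := u'
  obtain rfl : p = p' := h
  congr 2
  exact hu.trans hu'.symm

variable (S) in
/-- The germs of a pair at the points of a set. -/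
def sheet (U : Set M) (φ : M → Phase n) (F : M → ℂ) : Set (SKBundle n S) :=
  {u | u.1 ∈ U ∧ u.IsGermOf φ F}

/-- The topology in which the horizontal sections are homeomorphisms onto open sets. -/
instance : TopologicalSpace (SKBundle n S) :=
  TopologicalSpace.generateFrom
    {s | ∃ U φ F, IsOpen U ∧ IsSpecialKahlerPair S U φ F ∧ s = sheet S U φ F}

theorem isOpen_sheet (hU : IsOpen U) (h : IsSpecialKahlerPair S U φ F) :
    IsOpen (sheet S U φ F) :=
  TopologicalSpace.isOpen_generateFrom_of_mem ⟨U, φ, F, hU, h, rfl⟩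

theorem continuous_base : Continuous (fun u : SKBundle n S => u.1) := by
  refine continuous_def.2 fun V hV => isOpen_iff_mem_nhds.2 fun u hu => ?_
  obtain ⟨U, φ, F, hU, huU, h, hg⟩ := u.exists_isGermOf
  exact mem_of_superset ((isOpen_sheet (hU.inter hV) (h.mono inter_subset_left)).mem_nhds
    ⟨⟨huU, hu⟩, hg⟩) fun u' hu' => hu'.1.2

/-- In the topology whose open sets are generated by the sheets, moving continuously forces a curve
to stay in one horizontal section locally. Concatenation, reversal and images of horizontal curves
then come from the theory of paths. -/
theorem isHorizontal_iff {c : unitInterval → SKBundle n S} : IsHorizontal c ↔ Continuous c := by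
  constructor
  · rintro ⟨hc, h⟩
    refine continuous_generateFrom_iff.2 ?_
    rintro _ ⟨U, φ, F, hU, hF, rfl⟩
    refine isOpen_iff_mem_nhds.2 fun t ht => ?_
    obtain ⟨U', φ', F', hU', ht', hF', hev⟩ := h t
    have h1 := (isGermOf_iff hev.self_of_nhds).1 ht.2
    filter_upwards [hev, hc.continuousAt.eventually (h1.eventually_nhds),
      hc.continuousAt.eventually (hU.mem_nhds ht.1)] with s hs hs1 hs2
    exact ⟨hs2, (isGermOf_iff hs).2 hs1⟩
  · intro hc
    refine ⟨continuous_base.comp hc, fun t => ?_⟩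
    obtain ⟨U, φ, F, hU, ht, h, hg⟩ := (c t).exists_isGermOf
    refine ⟨U, φ, F, hU, ht, h, ?_⟩
    filter_upwards [hc.continuousAt.preimage_mem_nhds ((isOpen_sheet hU h).mem_nhds ⟨ht, hg⟩)]
      with s hs using hs.2

/-- The germ of a pair at a point of its domain. -/
def ofPair (hU : IsOpen U) (h : IsSpecialKahlerPair S U φ F) (p : U) : SKBundle n S :=
  ⟨p, germAt φ F p, U, φ, F, hU, p.2, h, rfl⟩

theorem isGermOf_ofPair (hU : IsOpen U) (h : IsSpecialKahlerPair S U φ F) (p : U) :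
    (ofPair hU h p).IsGermOf φ F := rfl

theorem continuous_ofPair (hU : IsOpen U) (h : IsSpecialKahlerPair S U φ F) :
    Continuous (ofPair hU h) := by
  refine continuous_generateFrom_iff.2 ?_
  rintro _ ⟨U', φ', F', hU', h', rfl⟩
  refine isOpen_iff_mem_nhds.2 fun p hp => ?_
  have h1 := (isGermOf_iff (isGermOf_ofPair hU h p)).1 hp.2
  filter_upwards [continuous_subtype_val.continuousAt.eventually h1.eventually_nhds,
    continuous_subtype_val.continuousAt.eventually (hU'.mem_nhds hp.1)] with q hq hq'
  exact ⟨hq', (isGermOf_iff (isGermOf_ofPair hU h q)).2 hq⟩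

theorem mem_horizontalLeaf_iff {u u' : SKBundle n S} : u' ∈ horizontalLeaf u ↔ Joined u u' := by
  constructor
  · rintro ⟨c, hc, h0, h1⟩
    exact ⟨⟨⟨c, isHorizontal_iff.1 hc⟩, h0, h1⟩⟩
  · rintro ⟨γ⟩
    exact ⟨γ, isHorizontal_iff.2 γ.continuous, γ.source, γ.target⟩

theorem mem_dom_iff {u : SKBundle n S} {p : M} :
    p ∈ dom u ↔ ∃ u' : SKBundle n S, u'.1 = p ∧ JoinedIn {u | u.IsNondegenerate} u u' := by
  constructor
  · rintro ⟨c, hc, h0, h1, hn⟩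
    exact ⟨c 1, h1, ⟨⟨c, isHorizontal_iff.1 hc⟩, h0, rfl⟩, hn⟩
  · rintro ⟨u', rfl, γ, hγ⟩
    exact ⟨γ, isHorizontal_iff.2 γ.continuous, γ.source, congrArg Sigma.fst γ.target, hγ⟩

/-- Every point of the domain has a neighbourhood on which some continuation of `u` is a
non-degenerate pair. -/
theorem exists_nondegeneratePair {u : SKBundle n S} {p : M} (hp : p ∈ dom u) :
    ∃ V φ F, IsOpen V ∧ p ∈ V ∧ V ⊆ dom u ∧ IsNondegeneratePair S V φ F ∧
      ∀ q ∈ V, ∃ u' ∈ horizontalLeaf u, u'.1 = q ∧ u'.IsGermOf φ F := by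
  obtain ⟨u₁, rfl, hj⟩ := mem_dom_iff.1 hp
  obtain ⟨U, φ, F, hU, hu₁, h, hg⟩ := hj.target_mem
  have _ : LocallyPathConnectedSpace M := ChartedSpace.locallyPathConnectedSpace E M
  have hsub : pathComponentIn U u₁.1 ⊆ U := pathComponentIn_subset
  -- Paths inside U lift to the sheet of the pair and consist of non-degenerate germs. The path
  -- component is open as manifolds are locally path connected.
  have key : ∀ q ∈ pathComponentIn U u₁.1, ∃ u' : SKBundle n S, u'.1 = q ∧ u'.IsGermOf φ F ∧
      JoinedIn {u | u.IsNondegenerate} u u' := by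
    intro q hq
    have hq' : JoinedIn U u₁.1 q := hq
    have hs := h.toIsSpecialKahlerPair
    refine ⟨ofPair hU hs ⟨q, hq'.target_mem⟩, rfl, isGermOf_ofPair _ _ _, hj.trans ?_⟩
    have h1 : u₁ = ofPair hU hs ⟨u₁.1, hu₁⟩ := eq_of_isGermOf rfl hg (isGermOf_ofPair _ _ _)
    obtain ⟨γ⟩ := hq'.joined_subtype
    refine ⟨(γ.map (continuous_ofPair hU hs)).cast h1 rfl, fun t => ?_⟩
    exact ⟨U, φ, F, hU, (γ t).2, h, isGermOf_ofPair hU hs (γ t)⟩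
  refine ⟨pathComponentIn U u₁.1, φ, F, hU.pathComponentIn _, mem_pathComponentIn_self hu₁, ?_,
    h.mono hsub, ?_⟩
  · intro q hq
    obtain ⟨u', h1, -, h2⟩ := key q hq
    exact mem_dom_iff.2 ⟨u', h1, h2⟩
  · intro q hq
    obtain ⟨u', h1, h2, h3⟩ := key q hq
    exact ⟨u', mem_horizontalLeaf_iff.2 h3.joined, h1, h2⟩

theorem isOpen_dom (u : SKBundle n S) : IsOpen (dom u) := by
  refine isOpen_iff_mem_nhds.2 fun p hp => ?_
  obtain ⟨V, φ, F, hV, hpV, hsub, -⟩ := exists_nondegeneratePair hp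
  exact mem_of_superset (hV.mem_nhds hpV) hsub

variable [FiniteDimensional ℂ E]

/-- The action of `G_SK` on germs of special Kähler pairs. -/
instance : SMul (GSK n) (SKBundle n S) where
  smul x u := ⟨u.1, u.2.1.map (x • ·), by
    obtain ⟨U, φ, F, hU, hu, h, hg⟩ := u.2.2
    exact ⟨U, _, _, hU, hu, h.smul hU x, by rw [hg]; rfl⟩⟩

theorem IsGermOf.smul {u : SKBundle n S} (h : u.IsGermOf φ F) (x : GSK n) :
    (x • u).IsGermOf (fun y => (x • (φ y, F y)).1) (fun y => (x • (φ y, F y)).2) :=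
  congrArg (Germ.map (x • ·)) h

instance : MulAction (GSK n) (SKBundle n S) where
  one_smul u := by
    obtain ⟨U, φ, F, hU, hu, h, hg⟩ := u.exists_isGermOf
    have h1 := hg.smul 1
    simp only [one_smul] at h1
    exact eq_of_isGermOf rfl h1 hg
  mul_smul x y u := by
    obtain ⟨U, φ, F, hU, hu, h, hg⟩ := u.exists_isGermOf
    have h1 := hg.smul (x * y)
    simp only [mul_smul] at h1
    exact eq_of_isGermOf rfl h1 ((hg.smul y).smul x)

/-- The preimage of a sheet is the sheet of the pair moved by x⁻¹. Thus parallel transport commutes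
with the action of G_SK. -/
theorem continuous_const_smul (x : GSK n) : Continuous (fun u : SKBundle n S => x • u) := by
  refine continuous_generateFrom_iff.2 ?_
  rintro _ ⟨U, φ, F, hU, h, rfl⟩
  have h1 : (fun u : SKBundle n S => x • u) ⁻¹' sheet S U φ F =
      sheet S U (fun y => (x⁻¹ • (φ y, F y)).1) (fun y => (x⁻¹ • (φ y, F y)).2) := by
    ext u
    refine and_congr_right fun _ => ⟨fun hg => ?_, fun hg => ?_⟩
    · have := IsGermOf.smul hg x⁻¹
      rwa [inv_smul_smul] at this
    · have := IsGermOf.smul hg x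
      simp only [Prod.mk.eta, smul_inv_smul] at this
      exact this
  rw [h1]
  exact isOpen_sheet hU (h.smul hU _)

theorem isTranslate_smul (x : GSK n) (u : SKBundle n S) : IsTranslate x u (x • u) := by
  obtain ⟨U, φ, F, hU, hu, h, hg⟩ := u.exists_isGermOf
  exact ⟨φ, F, _, _, hg, hg.smul x, rfl, fun _ => rfl⟩

/-- Two germs of the leaf of `u` over the same point differ by a real element of `G_SK` if the
holonomy of `u` is real. -/
theorem exists_realSubgroup (hE : Module.finrank ℂ E = n) {u u₁ u₂ : SKBundle n S}
    (hol : holonomy u ⊆ (realSubgroup n : Set (GSK n))) (h₁ : u₁ ∈ horizontalLeaf u)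
    (h₂ : u₂ ∈ horizontalLeaf u) (h : u₁.1 = u₂.1) (hg₁ : u₁.IsGermOf φ F)
    (hg₂ : u₂.IsGermOf φ' F') :
    ∃ x ∈ realSubgroup n, ∀ᶠ y in 𝓝 u₁.1, (φ' y, F' y) = x • (φ y, F y) := by
  obtain ⟨x, hx⟩ : ∃ x : GSK n, u₂ = x • u₁ := by
    obtain ⟨U, φ, F, hU, hu, hp, hg⟩ := u₁.exists_isGermOf
    obtain ⟨U', φ', F', hU', hu', hp', hg'⟩ := u₂.exists_isGermOf
    rw [← h] at hu'
    obtain ⟨x, hx⟩ := (hp.mono (inter_subset_left (t := U'))).exists_eq_smul hE (hU.inter hU')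
      (hp'.mono inter_subset_right) ⟨hu, hu'⟩
    refine ⟨x, eq_of_isGermOf h.symm hg' ((isGermOf_iff (hg.smul x)).2 hx)⟩
  refine ⟨x, ?_, (isGermOf_iff (hg₁.smul x)).1 (hx ▸ hg₂)⟩
  -- Translating a path from u to u₂ = x · u₁ by x⁻¹ gives one from x⁻¹ · u to u₁. A path from u to
  -- u₁ followed by its reverse ends at x⁻¹ · u, over the base point of u.
  have h1 : Joined (x⁻¹ • u) (x⁻¹ • u₂) := by
    obtain ⟨γ⟩ := mem_horizontalLeaf_iff.1 h₂
    exact ⟨γ.map (continuous_const_smul x⁻¹)⟩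
  rw [hx, inv_smul_smul] at h1
  obtain ⟨γ⟩ := (mem_horizontalLeaf_iff.1 h₁).trans h1.symm
  have h2 : x⁻¹ ∈ holonomy u :=
    ⟨γ, isHorizontal_iff.2 γ.continuous, γ.source, by
      rw [γ.target]
      exact isTranslate_smul _ _⟩
  exact inv_mem_iff.1 (hol h2)

end SKBundle
end GermBundle

/-! ### The linear representation of G_SK on `ℂ²ⁿ⁺²`. -/

section Hat

variable (n) in
/-- The vector of `ℂ²ⁿ⁺²` with coordinates `(z⁰, w₀, a)`. -/
def hat : (ℂ × ℂ × Phase n) →L[ℂ] Phase (n + 1) :=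
  LinearMap.toContinuousLinearMap
    { toFun := fun b => Sum.elim (Fin.cons b.1 (fun i => b.2.2 (Sum.inl i)))
        (Fin.cons b.2.1 (fun i => b.2.2 (Sum.inr i)))
      map_add' := by
        intro b c
        funext j
        rcases j with j | j <;> refine Fin.cases ?_ (fun i => ?_) j <;> simp
      map_smul' := by
        intro t b
        funext j
        rcases j with j | j <;> refine Fin.cases ?_ (fun i => ?_) j <;> simp }

theorem hat_apply (b : ℂ × ℂ × Phase n) : hat n b =
    Sum.elim (Fin.cons b.1 (fun i => b.2.2 (Sum.inl i)))
      (Fin.cons b.2.1 (fun i => b.2.2 (Sum.inr i))) := rfl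

variable (n) in
/-- The coordinates `(z⁰, w₀, a)` of a vector of `ℂ²ⁿ⁺²`. -/
def unhat : Phase (n + 1) →L[ℂ] (ℂ × ℂ × Phase n) :=
  LinearMap.toContinuousLinearMap
    { toFun := fun A => (A (Sum.inl 0), A (Sum.inr 0),
        Sum.elim (fun i => A (Sum.inl i.succ)) (fun i => A (Sum.inr i.succ)))
      map_add' := by
        intro A B
        refine Prod.ext rfl (Prod.ext rfl ?_)
        funext j
        rcases j with j | j <;> rfl
      map_smul' := by
        intro t A
        refine Prod.ext rfl (Prod.ext rfl ?_)
        funext j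
        rcases j with j | j <;> rfl }

theorem unhat_hat (b : ℂ × ℂ × Phase n) : unhat n (hat n b) = b := by
  refine Prod.ext rfl (Prod.ext rfl ?_)
  funext j
  rcases j with j | j <;> rfl

theorem hat_unhat (A : Phase (n + 1)) : hat n (unhat n A) = A := by
  funext j
  rcases j with j | j <;> refine Fin.cases ?_ (fun i => ?_) j <;> rfl

theorem sympl_hat (b c : ℂ × ℂ × Phase n) :
    sympl (hat n b) (hat n c) = b.1 * c.2.1 - b.2.1 * c.1 + sympl b.2.2 c.2.2 := by
  simp [sympl, hat_apply, Fin.sum_univ_succ]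
  ring

theorem conj_hat (b : ℂ × ℂ × Phase n) : (fun j => conj (hat n b j)) =
    hat n (conj b.1, conj b.2.1, fun j => conj (b.2.2 j)) := by
  funext j
  rcases j with j | j <;> refine Fin.cases ?_ (fun i => ?_) j <;> simp [hat_apply]

/-- The linear map `(z⁰, w₀, a) ↦ (z⁰, w₀ + Ω(X a, v) - 2 s z⁰, X a + z⁰ v)`. -/
def GSK.linearAux (x : GSK n) : (ℂ × ℂ × Phase n) →L[ℂ] (ℂ × ℂ × Phase n) :=
  LinearMap.toContinuousLinearMap
    { toFun := fun b => (b.1, b.2.1 + sympl (spAct x.X b.2.2) x.v - 2 * x.s * b.1,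
        spAct x.X b.2.2 + b.1 • x.v)
      map_add' := by
        intro b c
        refine Prod.ext rfl (Prod.ext ?_ ?_)
        · simp [spAct_add, sympl_add_left]; ring
        · simp [spAct_add, add_smul]; abel
      map_smul' := by
        intro t b
        have h1 : spAct x.X (t • b.2.2) = t • spAct x.X b.2.2 := (spActL x.X).map_smul t _
        refine Prod.ext rfl (Prod.ext ?_ ?_)
        · simp [h1, sympl_eq_pairing]; ring
        · simp [h1, mul_smul] }

theorem GSK.linearAux_apply (x : GSK n) (b : ℂ × ℂ × Phase n) : x.linearAux b =
    (b.1, b.2.1 + sympl (spAct x.X b.2.2) x.v - 2 * x.s * b.1, spAct x.X b.2.2 + b.1 • x.v) := rfl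

/-- The linear representation of `G_SK` on `ℂ²ⁿ⁺²`, for which the conification is equivariant. -/
def GSK.linear (x : GSK n) : Phase (n + 1) →L[ℂ] Phase (n + 1) :=
  (hat n).comp (x.linearAux.comp (unhat n))

theorem GSK.linear_hat (x : GSK n) (b : ℂ × ℂ × Phase n) :
    x.linear (hat n b) = hat n (x.linearAux b) := by
  simp [GSK.linear, unhat_hat]

/-- The shift of w₀ by Ω(Xa, v) compensates the cross terms produced by z⁰v, and the shift by -2sz⁰
cancels by antisymmetry, so Ω̂ is preserved. Commuting with conjugation is where the reality of s
and v, and thus of the holonomy, enters. -/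
theorem isRealSympl_linear {x : GSK n} (hx : x ∈ realSubgroup n) : IsRealSympl x.linear where
  sympl_eq A B := by
    obtain ⟨b, rfl⟩ : ∃ b, hat n b = A := ⟨_, hat_unhat A⟩
    obtain ⟨c, rfl⟩ : ∃ c, hat n c = B := ⟨_, hat_unhat B⟩
    have h1 := sympl_spAct x.X b.2.2 c.2.2
    simp only [GSK.linear_hat, sympl_hat, GSK.linearAux_apply, sympl_add_left, sympl_add_right, h1]
    simp only [sympl_eq_pairing, map_smul, smul_apply, smul_eq_mul]
    ring
  map_conj A := by
    obtain ⟨b, rfl⟩ : ∃ b, hat n b = A := ⟨_, hat_unhat A⟩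
    obtain ⟨hs, hv⟩ := hx
    have hv' : (fun j => conj (x.v j)) = x.v := funext fun j => Complex.conj_eq_iff_im.2 (hv j)
    have h1 (a c : Phase n) :
        sympl (fun j => conj (a j)) (fun j => conj (c j)) = conj (sympl a c) := by
      simp [sympl]
    have h2 := (isRealSympl_spActL x.X).map_conj b.2.2
    simp only [spActL_apply] at h2
    rw [conj_hat, GSK.linear_hat, GSK.linear_hat, conj_hat, GSK.linearAux_apply,
      GSK.linearAux_apply]
    congr 1
    refine Prod.ext rfl (Prod.ext ?_ ?_)
    · simp only [h2, map_add, map_sub, map_mul, Complex.conj_eq_iff_im.2 hs, ← h1, hv',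
        Complex.conj_ofNat]
    · funext j
      have h3 : spAct x.X (fun j => conj (b.2.2 j)) j = conj (spAct x.X b.2.2 j) := congrFun h2 j
      have h4 : conj (x.v j) = x.v j := congrFun hv' j
      change spAct x.X (fun j => conj (b.2.2 j)) j + conj b.1 * x.v j =
        conj (spAct x.X b.2.2 j + b.1 * x.v j)
      rw [h3, map_add, map_mul, h4]

/-- The lift `Ψ = (1, 2 F - zᵗw, φ)` of `φ`. -/
def lift {N : Type*} (φ : N → Phase n) (F : N → ℂ) (p : N) : Phase (n + 1) :=
  hat n (1, 2 * F p - pairing n (φ p) (φ p), φ p)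

theorem conification_eq {N : Type*} (φ : N → Phase n) (F : N → ℂ) (q : ℂˣ × N) :
    conification φ F q = (q.1 : ℂ) • lift φ F q.2 := by
  rw [conification, lift, hat_apply, zw_eq_pairing]

/-- In 2F' - z'ᵗw' the quadratic corrections in the formula for F' cancel, leaving 2F - zᵗw + Ω(φ',
v) - 2s; and Ω(φ', v) = Ω(Xφ, v). -/
theorem lift_smul {N : Type*} {φ φ' : N → Phase n} {F F' : N → ℂ} {x : GSK n} {p : N}
    (h : (φ' p, F' p) = x • (φ p, F p)) : lift φ' F' p = x.linear (lift φ F p) := by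
  have h1 : φ' p = spAct x.X (φ p) + x.v := congrArg Prod.fst h
  have h2 : F' p = F p - 1 / 2 * zw (φ p) + 1 / 2 * zw (spAct x.X (φ p) + x.v)
      + 1 / 2 * sympl (spAct x.X (φ p) + x.v) x.v - x.s := congrArg Prod.snd h
  rw [lift, lift, GSK.linear_hat, GSK.linearAux_apply]
  congr 1
  refine Prod.ext rfl (Prod.ext ?_ ?_)
  · simp only [h1, h2, ← zw_eq_pairing, sympl_add_left, sympl_self]
    ring
  · simp [h1]

end Hat

/-! ### Atlases of Lagrangian immersions and Euler fields. -/

section Atlas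
variable {E : Type*} [NormedAddCommGroup E] [NormedSpace ℂ E] [FiniteDimensional ℂ E]
  {M : Type*} [TopologicalSpace M] [ChartedSpace E M] [IsManifold 𝓘(ℂ, E) ω M]

theorem apply_inverse_of_bijective {W : Type*} [NormedAddCommGroup W] [NormedSpace ℝ W]
    {L : E →L[ℝ] W} (hL : Function.Bijective L) (b : W) : L (L.inverse b) = b := by
  obtain ⟨e, rfl⟩ : L.IsInvertible :=
    ⟨(LinearEquiv.ofBijective _ hL).toContinuousLinearEquiv, by ext; rfl⟩
  rw [ContinuousLinearMap.inverse_equiv]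
  simp

variable (n E M) in
/-- An atlas of Kählerian Lagrangian immersions that differ locally by real symplectic maps. -/
structure LagrangianAtlas where
  U : M → Set M
  φ : M → M → Phase n
  isOpen : ∀ x, IsOpen (U x)
  mem : ∀ x, x ∈ U x
  isKahlerianLagrangian : ∀ x, IsKahlerianLagrangian E (U x) (φ x)
  compatible : ∀ x, ∀ y ∈ U x, ∃ R : Phase n →L[ℂ] Phase n, IsRealSympl R ∧
    ∀ᶠ z in 𝓝 y, φ x z = R (φ y z)

namespace LagrangianAtlas

variable (A : LagrangianAtlas n E M)

/-- The metric induced by an atlas of Lagrangian immersions. -/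
def metric : BilinField E M := fun x =>
  ((metricForm n).bilinearComp (dR (E := E) (A.φ x) x : E →L[ℝ] Phase n)
    (dR (E := E) (A.φ x) x : E →L[ℝ] Phase n) : E →L[ℝ] E →L[ℝ] ℝ)

/-- The connection induced by an atlas of Lagrangian immersions. -/
def connection (Y : VField E M) (x : M) :
    TangentSpace 𝓘(ℝ, E) x →L[ℝ] TangentSpace 𝓘(ℝ, E) x :=
  (dR (E := E) (fun y => reP n (A.φ x y)) x : E →L[ℝ] RealPhase n).inverse.comp
    (dR (fun y => reP n (dR (A.φ x) y (Y y))) x)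

variable {A}

theorem inducesAt (hE : Module.finrank ℂ E = n) (x : M) :
    InducesAt A.metric A.connection (A.φ x) x := by
  refine ⟨fun v w => rfl, fun Y v _ => ?_⟩
  have h := A.isKahlerianLagrangian x
  have hb := h.bijective_dR_reP hE (A.mem x)
  rw [← h.dR_reP (A.mem x)]
  exact apply_inverse_of_bijective (E := E) hb _

theorem inducesAt_of_eventuallyEq (hE : Module.finrank ℂ E = n) {x : M}
    {R : Phase n →L[ℂ] Phase n} (hR : IsRealSympl R) {φ : M → Phase n}
    (h : ∀ᶠ y in 𝓝 x, φ y = R (A.φ x y)) : InducesAt A.metric A.connection φ x :=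
  (inducesAt hE x).comp_real hR (c := 0)
    ((A.isKahlerianLagrangian x).contMDiffAt (A.isOpen x) (A.mem x))
    (h.mono fun _ hy => hy.trans (add_zero _).symm)

omit [FiniteDimensional ℂ E] [IsManifold 𝓘(ℂ, E) ω M] in
theorem isKahlerianLagrangian_of_eventuallyEq {x : M}
    {R : Phase n →L[ℂ] Phase n} (hR : IsRealSympl R) {φ : M → Phase n}
    (h : ∀ᶠ y in 𝓝 x, φ y = R (A.φ x y)) : IsKahlerianLagrangian E {x} φ := by
  refine ((A.isKahlerianLagrangian x).mono (singleton_subset_iff.2 (A.mem x))).comp_real hR (c := 0)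
    fun y hy => ?_
  obtain rfl : y = x := hy
  exact h.mono fun _ hy => hy.trans (add_zero _).symm

/-- The structure at y is defined by the immersion chosen for y; the immersion chosen for x differs
from it near y by a real symplectic map and induces the same structure. -/
theorem inducesAt_of_mem (hE : Module.finrank ℂ E = n) {x y : M} (hy : y ∈ A.U x) :
    InducesAt A.metric A.connection (A.φ x) y := by
  obtain ⟨R, hR, h⟩ := A.compatible x y hy
  exact inducesAt_of_eventuallyEq hE hR h

theorem locallyInduced (hE : Module.finrank ℂ E = n) :
    LocallyInduced n A.metric A.connection := fun x =>
  ⟨A.U x, A.φ x, A.isOpen x, A.mem x, A.isKahlerianLagrangian x, fun _ => inducesAt_of_mem hE⟩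

theorem affineCoordinatesAt (hE : Module.finrank ℂ E = n) (x : M) :
    AffineCoordinatesAt A.metric A.connection (A.φ x) x :=
  SpecialKahler.affineCoordinatesAt hE (A.isOpen x) (A.isKahlerianLagrangian x)
    (fun _ => inducesAt_of_mem hE) (A.mem x)

variable (A) in
/-- An Euler field of an atlas of Lagrangian immersions. -/
structure IsEuler (ξ : VField E M) : Prop where
  dR_eq : ∀ x, ∀ᶠ y in 𝓝 x, dR (A.φ x) y (ξ y) = A.φ x y
  norm_ne_zero : ∀ x, herm (A.φ x x) (A.φ x x) ≠ 0

namespace IsEuler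

variable {ξ : VField E M} (h : A.IsEuler ξ)
include h

theorem dR_reP (hE : Module.finrank ℂ E = n) (x : M) :
    (fun y => dR (fun y => reP n (A.φ x y)) y (ξ y)) =ᶠ[𝓝 x] fun y => reP n (A.φ x y) := by
  filter_upwards [(affineCoordinatesAt hE x).dR_re, h.dR_eq x] with y h1 h2
  rw [h1, h2]

theorem smooth (hE : Module.finrank ℂ E = n) : VSmooth ξ := fun x =>
  contMDiffAt_vField_of_dR (affineCoordinatesAt hE x).smooth_re (affineCoordinatesAt hE x).bijective
    ((affineCoordinatesAt hE x).smooth_re.congr_of_eventuallyEq (h.dR_reP hE x))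

/-- In affine coordinates r the Euler field is the position vector, dr(ξ) = r, and its derivative is
the identity. -/
theorem connection_eq (hE : Module.finrank ℂ E = n) (x : M) (v : TangentSpace 𝓘(ℝ, E) x) :
    A.connection ξ x v = v := by
  have hc := affineCoordinatesAt (A := A) hE x
  apply hc.eq_of_dR_eq
  rw [hc.connection.self_of_nhds ξ v ((h.smooth hE x).mdifferentiableAt (by simp)),
    dR_congr (h.dR_reP hE x)]

theorem connection_cplxJ (hE : Module.finrank ℂ E = n) (x : M) (v : TangentSpace 𝓘(ℝ, E) x) :
    A.connection (fun y => cplxJ y (ξ y)) x v = cplxJ x v := by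
  have hc := affineCoordinatesAt (A := A) hE x
  have h1 : (fun y => dR (fun y => reP n (A.φ x y)) y (cplxJ y (ξ y))) =ᶠ[𝓝 x]
      fun y => -imP n (A.φ x y) := by
    filter_upwards [hc.dR_re, hc.dR_J, h.dR_eq x] with y h1 h2 h3
    rw [h1, h2, h3, reP_I_smul]
  apply hc.eq_of_dR_eq
  rw [hc.connection.self_of_nhds _ v
    (VDiffAt.cplxJ ((h.smooth hE x).mdifferentiableAt (by simp))), dR_congr h1,
    hc.dR_re_J.self_of_nhds]

/-- The conical affine special Kähler structure of an atlas with an Euler field. -/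
def conical (hE : Module.finrank ℂ E = n) : ConicalAffineSpecialKahler E M where
  toAffineSpecialKahler := (A.locallyInduced hE).affineSpecialKahler hE
  ξ := ξ
  ξ_smooth := h.smooth hE
  norm_ξ_ne_zero x := by
    change A.metric x (ξ x) (ξ x) ≠ 0
    rw [(inducesAt hE x).metric, metricForm_apply, (h.dR_eq x).self_of_nhds]
    -- γ(A, A) is real, so it vanishes as soon as its real part does.
    intro h0
    exact h.norm_ne_zero x (Complex.ext (by simpa using h0) (herm_self_im _))
  conn_ξ := h.connection_eq hE
  leviCivita_ξ := ⟨_, AffineSpecialKahler.isLeviCivita _, fun x v =>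
    AffineSpecialKahler.leviCivita_eq_id _ (h.connection_eq hE x v) (h.connection_cplxJ hE x v)⟩

end IsEuler
end LagrangianAtlas
end Atlas

/-! ### Derivatives on ℂˣ × M and on open submanifolds. -/

section ProductManifold
variable {E : Type*} [NormedAddCommGroup E] [NormedSpace ℂ E]
  {M : Type*} [TopologicalSpace M] [ChartedSpace E M]
  {W : Type*} [NormedAddCommGroup W] [NormedSpace ℂ W]

theorem hasMFDerivAt_of_chart {E' : Type*} [NormedAddCommGroup E'] [NormedSpace ℂ E']
    {M' : Type*} [TopologicalSpace M'] [ChartedSpace E' M'] {f : M → M'} {x : M} {g : E → E'}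
    {L : E →L[ℂ] E'} (hf : ContinuousAt f x) (hg : HasFDerivAt g L (chartAt E x x))
    (h : ∀ z ∈ (chartAt E x).target, chartAt E' (f x) (f ((chartAt E x).symm z)) = g z) :
    HasMFDerivAt 𝓘(ℂ, E) 𝓘(ℂ, E') f x L := by
  refine ⟨hf, ?_⟩
  rw [ModelWithCorners.range_eq_univ]
  refine HasFDerivAt.hasFDerivWithinAt (hg.congr_of_eventuallyEq ?_)
  exact mem_of_superset ((chartAt E x).open_target.mem_nhds (mem_chart_target E x)) h

theorem hasMFDerivAt_units_val (a : ℂˣ) :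
    HasMFDerivAt 𝓘(ℂ, ℂ) 𝓘(ℂ, ℂ) (fun a : ℂˣ => (a : ℂ)) a (ContinuousLinearMap.id ℂ ℂ) :=
  hasMFDerivAt_of_chart (E := ℂ) (E' := ℂ) Units.continuous_val.continuousAt (hasFDerivAt_id _)
    fun _ hz => (chartAt ℂ a).right_inv hz

theorem hasMFDerivAt_units_mul (a b : ℂˣ) :
    HasMFDerivAt 𝓘(ℂ, ℂ) 𝓘(ℂ, ℂ) (fun a : ℂˣ => a * b) a
      ((b : ℂ) • ContinuousLinearMap.id ℂ ℂ) := by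
  refine hasMFDerivAt_of_chart (E := ℂ) (E' := ℂ) (continuous_mul_const b).continuousAt
    (g := fun z => (b : ℂ) • z) ((hasFDerivAt_id _).const_smul (b : ℂ)) fun z hz => ?_
  have h1 : (((chartAt ℂ a).symm z : ℂˣ) : ℂ) = z := (chartAt ℂ a).right_inv hz
  change (((chartAt ℂ a).symm z * b : ℂˣ) : ℂ) = b * z
  rw [Units.val_mul, h1, mul_comm]

theorem hasMFDerivAt_opens_val {D : TopologicalSpace.Opens M} (x : D) :
    HasMFDerivAt 𝓘(ℂ, E) 𝓘(ℂ, E) (fun y : D => (y : M)) x (ContinuousLinearMap.id ℂ E) :=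
  hasMFDerivAt_of_chart continuous_subtype_val.continuousAt (hasFDerivAt_id _)
    fun _ hz => (chartAt E x).right_inv hz

theorem hasMFDerivAt_fst_units (q : ℂˣ × M) :
    HasMFDerivAt 𝓘(ℂ, ℂ × E) 𝓘(ℂ, ℂ) (fun q : ℂˣ × M => q.1) q
      (ContinuousLinearMap.fst ℂ ℂ E) := by
  have h := hasMFDerivAt_fst (I := 𝓘(ℂ, ℂ)) (I' := 𝓘(ℂ, E)) q
  rw [modelWithCornersSelf_prod]
  exact h

theorem hasMFDerivAt_snd_units (q : ℂˣ × M) :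
    HasMFDerivAt 𝓘(ℂ, ℂ × E) 𝓘(ℂ, E) (fun q : ℂˣ × M => q.2) q
      (ContinuousLinearMap.snd ℂ ℂ E) := by
  have h := hasMFDerivAt_snd (I := 𝓘(ℂ, ℂ)) (I' := 𝓘(ℂ, E)) q
  rw [modelWithCornersSelf_prod]
  exact h

theorem hasMFDerivAt_prodMk_units {E' : Type*} [NormedAddCommGroup E'] [NormedSpace ℂ E']
    {N : Type*} [TopologicalSpace N] [ChartedSpace E' N] {f : N → ℂˣ} {g : N → M} {x : N}
    {f' : E' →L[ℂ] ℂ} {g' : E' →L[ℂ] E} (hf : HasMFDerivAt 𝓘(ℂ, E') 𝓘(ℂ, ℂ) f x f')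
    (hg : HasMFDerivAt 𝓘(ℂ, E') 𝓘(ℂ, E) g x g') :
    HasMFDerivAt 𝓘(ℂ, E') 𝓘(ℂ, ℂ × E) (fun y => (f y, g y)) x (f'.prod g') := by
  have h := hf.prodMk hg
  rw [modelWithCornersSelf_prod]
  exact h

theorem hasMFDerivAt_val_fst (q : ℂˣ × M) :
    HasMFDerivAt 𝓘(ℂ, ℂ × E) 𝓘(ℂ, ℂ) (fun q : ℂˣ × M => (q.1 : ℂ)) q
      (ContinuousLinearMap.fst ℂ ℂ E) :=
  (hasMFDerivAt_units_val q.1).comp q (hasMFDerivAt_fst_units q)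

theorem dR_val_fst (q : ℂˣ × M) (w : ℂ × E) :
    dR (E := ℂ × E) (fun q : ℂˣ × M => (q.1 : ℂ)) q w = w.1 :=
  DFunLike.congr_fun (hasMFDerivAt_real (hasMFDerivAt_val_fst q)).mfderiv w

theorem mdifferentiableAt_comp_snd {Ψ : M → W} {q : ℂˣ × M}
    (hΨ : MDifferentiableAt 𝓘(ℂ, E) 𝓘(ℂ, W) Ψ q.2) :
    MDifferentiableAt 𝓘(ℂ, ℂ × E) 𝓘(ℂ, W) (fun q : ℂˣ × M => Ψ q.2) q :=
  hΨ.comp q (hasMFDerivAt_snd_units q).mdifferentiableAt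

theorem dR_comp_snd {Ψ : M → W} {q : ℂˣ × M}
    (hΨ : MDifferentiableAt 𝓘(ℝ, E) 𝓘(ℝ, W) Ψ q.2) (w : ℂ × E) :
    dR (E := ℂ × E) (fun q : ℂˣ × M => Ψ q.2) q w = dR (E := E) Ψ q.2 w.2 := by
  have h := (hΨ.hasMFDerivAt.comp q (hasMFDerivAt_real (hasMFDerivAt_snd_units q))).mfderiv
  exact DFunLike.congr_fun h w

theorem mdifferentiableAt_smul_snd {Ψ : M → W} {q : ℂˣ × M}
    (hΨ : MDifferentiableAt 𝓘(ℂ, E) 𝓘(ℂ, W) Ψ q.2) :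
    MDifferentiableAt 𝓘(ℂ, ℂ × E) 𝓘(ℂ, W) (fun q : ℂˣ × M => (q.1 : ℂ) • Ψ q.2) q :=
  (hasMFDerivAt_val_fst q).mdifferentiableAt.smul (mdifferentiableAt_comp_snd hΨ)

theorem dR_smul_snd [IsManifold 𝓘(ℂ, E) ω M] {Ψ : M → W} {q : ℂˣ × M}
    (hΨ : MDifferentiableAt 𝓘(ℂ, E) 𝓘(ℂ, W) Ψ q.2) (w : ℂ × E) :
    dR (E := ℂ × E) (fun q : ℂˣ × M => (q.1 : ℂ) • Ψ q.2) q w =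
      w.1 • Ψ q.2 + (q.1 : ℂ) • dR (E := E) Ψ q.2 w.2 := by
  have h := dR_bilin (E := ℂ × E) (ContinuousLinearMap.lsmul ℝ ℂ : ℂ →L[ℝ] W →L[ℝ] W)
    (hasMFDerivAt_real (hasMFDerivAt_val_fst (E := E) q)).mdifferentiableAt
    (mdifferentiableAt_real (mdifferentiableAt_comp_snd hΨ)) w
  refine h.trans ?_
  rw [dR_val_fst, dR_comp_snd (mdifferentiableAt_real hΨ)]
  rfl

variable {D : TopologicalSpace.Opens M}

theorem mdifferentiableAt_comp_val {f : M → W} {x : D}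
    (hf : MDifferentiableAt 𝓘(ℂ, E) 𝓘(ℂ, W) f x) :
    MDifferentiableAt 𝓘(ℂ, E) 𝓘(ℂ, W) (fun y : D => f y) x :=
  hf.comp x (hasMFDerivAt_opens_val x).mdifferentiableAt

theorem dR_comp_val {f : M → W} {x : D} (hf : MDifferentiableAt 𝓘(ℝ, E) 𝓘(ℝ, W) f x) (v : E) :
    dR (E := E) (fun y : D => f y) x v = dR (E := E) f (x : M) v := by
  have h := (hf.hasMFDerivAt.comp x (hasMFDerivAt_real (hasMFDerivAt_opens_val x))).mfderiv
  exact DFunLike.congr_fun h v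

end ProductManifold

/-! ### Conifications are Lagrangian immersions. -/

section Conification
variable {E : Type*} [NormedAddCommGroup E] [NormedSpace ℂ E]
  {M : Type*} [TopologicalSpace M] [ChartedSpace E M] [IsManifold 𝓘(ℂ, E) ω M]
  {S : AffineSpecialKahler E M} {U : Set M} {φ : M → Phase n} {F : M → ℂ}
  {D : TopologicalSpace.Opens M}

theorem IsSpecialKahlerPair.mdifferentiableAt_lift (h : IsSpecialKahlerPair S U φ F) {p : M}
    (hp : p ∈ U) : MDifferentiableAt 𝓘(ℂ, E) 𝓘(ℂ, Phase (n + 1)) (lift φ F) p := by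
  have h1 := h.1.holomorphic p hp
  have h2 := h.prepotential_holomorphic p hp
  have h3 : MDifferentiableAt 𝓘(ℂ, E) 𝓘(ℂ, ℂ) (fun p => 2 * F p) p :=
    (((2 : ℂ) • ContinuousLinearMap.id ℂ ℂ).differentiableAt.comp_mdifferentiableAt h2)
  exact (hat n).differentiableAt.comp_mdifferentiableAt ((mdifferentiableAt_const (c := 1)).prodMk_space
    ((h3.sub (mdifferentiableAt_bilin_complex (pairing n) h1)).prodMk_space h1))

/-- Subtracting d(zᵗw) = dzᵗw + zᵗdw from 2dF = 2dzᵗw leaves Ω(dφ, φ) in the w₀-component. -/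
theorem IsSpecialKahlerPair.dR_lift (h : IsSpecialKahlerPair S U φ F) {p : M} (hp : p ∈ U)
    (v : TangentSpace 𝓘(ℝ, E) p) : dR (lift φ F) p v =
      hat n (0, sympl (dR φ p v) (φ p), dR φ p v) := by
  have h0 := mdifferentiableAt_real (h.mdifferentiableAt_lift hp)
  -- Composing with coordinate projections reduces the claim to the three components.
  have key {W : Type} [NormedAddCommGroup W] [NormedSpace ℂ W]
      (L : (ℂ × ℂ × Phase n) →L[ℂ] W) : L (unhat n (dR (lift φ F) p v)) =
        dR (fun y => L (1, 2 * F y - pairing n (φ y) (φ y), φ y)) p v := by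
    have h1 := dR_clm_comp ((L.comp (unhat n)).restrictScalars ℝ) h0 v
    refine h1.symm.trans (DFunLike.congr_fun (dR_congr (.of_forall fun y => ?_)) v)
    change L (unhat n (lift φ F y)) = _
    rw [lift, unhat_hat]
  rw [← hat_unhat (dR (lift φ F) p v)]
  congr 1
  refine Prod.ext ?_ (Prod.ext ?_ ?_)
  · have h1 := key (ContinuousLinearMap.fst ℂ ℂ (ℂ × Phase n))
    refine h1.trans ?_
    exact DFunLike.congr_fun (dR_const (E := E) (1 : ℂ) p) v
  · have h1 := key ((ContinuousLinearMap.fst ℂ ℂ (Phase n)).comp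
      (ContinuousLinearMap.snd ℂ ℂ (ℂ × Phase n)))
    refine h1.trans ?_
    have h2 := mdifferentiableAt_real (h.prepotential_holomorphic p hp)
    have h3 := h.1.mdifferentiableAt hp
    have h4 := dR_clm_comp ((2 : ℂ) • ContinuousLinearMap.id ℝ ℂ) h2 v
    have h5 := dR_bilin_self (pairing n) h3 v
    have h6 := DFunLike.congr_fun (dR_sub
      (mdifferentiableAt_clm_comp ((2 : ℂ) • ContinuousLinearMap.id ℝ ℂ) h2)
      (mdifferentiableAt_bilin (pairingR n) h3 h3)) v
    refine h6.trans ?_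
    rw [sub_apply, h4, h.dR_prepotential hp, sympl_eq_pairing]
    change 2 * pairing n (dR φ p v) (φ p) - dR (fun y => pairing n (φ y) (φ y)) p v = _
    rw [h5]
    ring
  · have h1 := key ((ContinuousLinearMap.snd ℂ ℂ (Phase n)).comp
      (ContinuousLinearMap.snd ℂ ℂ (ℂ × Phase n)))
    exact h1

/-- The w₀-component Ω(dφ, φ) of dΨ cancels Ω(φ, dφ): the coordinate 2F - zᵗw is designed for this.
It makes the cone over the lift isotropic in the radial direction. -/
theorem IsSpecialKahlerPair.sympl_lift_dR (h : IsSpecialKahlerPair S U φ F) {p : M} (hp : p ∈ U)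
    (v : TangentSpace 𝓘(ℝ, E) p) : sympl (lift φ F p) (dR (lift φ F) p v) = 0 := by
  rw [h.dR_lift hp, lift, sympl_hat, sympl_eq_pairing, sympl_eq_pairing]
  ring

theorem IsSpecialKahlerPair.sympl_dR_lift (h : IsSpecialKahlerPair S U φ F) {p : M} (hp : p ∈ U)
    (v w : TangentSpace 𝓘(ℝ, E) p) : sympl (dR (lift φ F) p v) (dR (lift φ F) p w) = 0 := by
  rw [h.dR_lift hp, h.dR_lift hp, sympl_hat, h.1.lagrangian p hp]
  ring

theorem IsSpecialKahlerPair.dR_conification (h : IsSpecialKahlerPair S U φ F) {q : ℂˣ × M}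
    (hq : q.2 ∈ U) (w : ℂ × E) : dR (E := ℂ × E) (conification φ F) q w =
      w.1 • lift φ F q.2 + (q.1 : ℂ) • dR (E := E) (lift φ F) q.2 w.2 := by
  have h1 : conification φ F = fun q : ℂˣ × M => (q.1 : ℂ) • lift φ F q.2 :=
    funext (conification_eq φ F)
  rw [h1]
  exact dR_smul_snd (h.mdifferentiableAt_lift hq) w

theorem conification_val (φ : M → Phase n) (F : M → ℂ) :
    conification (fun p : D => φ p) (fun p : D => F p) =
      fun q : ℂˣ × D => (q.1 : ℂ) • (fun p : D => lift φ F p) q.2 :=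
  funext (conification_eq _ _)

theorem IsSpecialKahlerPair.dR_conification_val (h : IsSpecialKahlerPair S U φ F) {q : ℂˣ × D}
    (hq : (q.2 : M) ∈ U) (w : ℂ × E) :
    dR (E := ℂ × E) (conification (fun p : D => φ p) (fun p : D => F p)) q w =
      w.1 • lift φ F q.2 + (q.1 : ℂ) • dR (E := E) (lift φ F) (q.2 : M) w.2 := by
  have h1 := h.mdifferentiableAt_lift hq
  rw [conification_val, dR_smul_snd (mdifferentiableAt_comp_val h1),
    dR_comp_val (mdifferentiableAt_real h1)]

theorem sympl_smul_add_smul_eq_zero {a b b' : Phase n} (c d t : ℂ) (h₁ : sympl a b' = 0)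
    (h₂ : sympl b a = 0) (h₃ : sympl b b' = 0) : sympl (c • a + t • b) (d • a + t • b') = 0 := by
  rw [sympl_eq_pairing] at h₁ h₂ h₃ ⊢
  simp only [map_add, map_smul, add_apply, smul_apply, smul_eq_mul]
  linear_combination c * t * h₁ + t * d * h₂ + t * t * h₃

/-- The conification of a non-degenerate special Kähler pair is a Kählerian Lagrangian immersion. -/
theorem IsNondegeneratePair.isKahlerianLagrangian_conification (h : IsNondegeneratePair S U φ F) :
    IsKahlerianLagrangian (ℂ × E) {q : ℂˣ × D | (q.2 : M) ∈ U}
      (conification (fun p : D => φ p) (fun p : D => F p)) := by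
  have hs := h.toIsSpecialKahlerPair
  -- dΦ is given by the same formula on ℂˣ × M and on ℂˣ × D, so non-degeneracy carries over.
  have hk : ∀ q ∈ {q : ℂˣ × D | (q.2 : M) ∈ U},
      IsKahlerianAt (E := ℂ × E) (conification (fun p : D => φ p) (fun p : D => F p)) q := by
    intro q hq v hv
    refine h.kahlerian (q.1, (q.2 : M)) hq v fun w => ?_
    have h1 := (congrArg₂ herm (hs.dR_conification_val hq v)
      (hs.dR_conification_val hq w)).symm.trans (hv w)
    exact (congrArg₂ herm (hs.dR_conification (q := (q.1, (q.2 : M))) hq v)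
      (hs.dR_conification (q := (q.1, (q.2 : M))) hq w)).trans h1
  refine ⟨fun q hq => ?_, fun q hq => ?_, fun q hq v w => ?_, hk⟩
  · rw [conification_val]
    exact mdifferentiableAt_smul_snd (mdifferentiableAt_comp_val (hs.mdifferentiableAt_lift hq))
  · rw [injective_iff_map_eq_zero]
    intro v hv
    -- A vector in the kernel of dΦ is orthogonal to everything, so Kählerian implies immersive.
    refine hk q hq v fun w => ?_
    rw [hv]
    simp [herm, sympl]
  · have h1 := hs.sympl_lift_dR hq
    have h2 := hs.sympl_dR_lift hq
    refine (congrArg₂ sympl (hs.dR_conification_val hq v) (hs.dR_conification_val hq w)).trans ?_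
    have h3 (v : E) : sympl (dR (E := E) (lift φ F) (q.2 : M) v) (lift φ F q.2) = 0 := by
      have h4 := h1 v
      rw [sympl_eq_pairing] at h4 ⊢
      linear_combination -h4
    exact sympl_smul_add_smul_eq_zero _ _ _ (h1 _) (h3 _) (h2 _ _)

theorem IsNondegeneratePair.herm_lift_ne_zero (h : IsNondegeneratePair S U φ F) {p : M}
    (hp : p ∈ U) : herm (lift φ F p) (lift φ F p) ≠ 0 := by
  have h1 := h.norm_ne_zero (1, p) hp
  rwa [conification_eq, Units.val_one, one_smul] at h1

end Conification

/-! ### The conical structure on ℂˣ × dom u. -/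

section ConicalStructure
variable {E : Type*} [NormedAddCommGroup E] [NormedSpace ℂ E]
  {M : Type*} [TopologicalSpace M] [ChartedSpace E M] [IsManifold 𝓘(ℂ, E) ω M]
  {S : AffineSpecialKahler E M} {U : Set M} {φ φ' : M → Phase n} {F F' : M → ℂ}

/-- A special Kähler pair all of whose germs belong to the leaf of `u`. -/
structure IsLeafPair (u : SKBundle n S) (U : Set M) (φ : M → Phase n) (F : M → ℂ) : Prop where
  isOpen : IsOpen U
  pair : IsSpecialKahlerPair S U φ F
  mem_leaf : ∀ p ∈ U, ∃ u' ∈ horizontalLeaf u, u'.1 = p ∧ u'.IsGermOf φ F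

/-- The domain of `u` as an open submanifold. -/
def domain (u : SKBundle n S) : TopologicalSpace.Opens M := ⟨dom u, SKBundle.isOpen_dom u⟩

theorem exists_leafPair (u : SKBundle n S) (p : domain u) : ∃ c : Set M × (M → Phase n) × (M → ℂ),
    (p : M) ∈ c.1 ∧ IsLeafPair u c.1 c.2.1 c.2.2 ∧ IsNondegeneratePair S c.1 c.2.1 c.2.2 := by
  obtain ⟨V, φ, F, hV, hp, -, h, hl⟩ := SKBundle.exists_nondegeneratePair p.2
  exact ⟨(V, φ, F), hp, ⟨hV, h.toIsSpecialKahlerPair, hl⟩, h⟩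

/-- The vector field generating the action of `ℂˣ`. -/
def eulerField (D : TopologicalSpace.Opens M) : VField (ℂ × E) (ℂˣ × D) :=
  fun q => ((q.1 : ℂ), (0 : E))

theorem dR_conification_eulerField {D : TopologicalSpace.Opens M} (h : IsSpecialKahlerPair S U φ F)
    {q : ℂˣ × D} (hq : (q.2 : M) ∈ U) :
    dR (E := ℂ × E) (conification (fun p : D => φ p) (fun p : D => F p)) q (eulerField D q) =
      conification (fun p : D => φ p) (fun p : D => F p) q := by
  refine (h.dR_conification_val hq ((q.1 : ℂ), (0 : E))).trans ?_
  rw [conification_val]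
  have h1 : dR (E := E) (lift φ F) (q.2 : M) (0 : E) = 0 := map_zero _
  simp only [h1, smul_zero, add_zero]

variable [FiniteDimensional ℂ E]

/-- Both pairs have germs over p in the leaf of u, so these differ by a real group element, and
equivariance of the lift converts it into a linear map. -/
theorem IsLeafPair.exists_linear (hE : Module.finrank ℂ E = n) {u : SKBundle n S}
    (hol : holonomy u ⊆ (realSubgroup n : Set (GSK n))) {V : Set M} (h : IsLeafPair u U φ F)
    (h' : IsLeafPair u V φ' F') {p : M} (hp : p ∈ U) (hp' : p ∈ V) :
    ∃ R : Phase (n + 1) →L[ℂ] Phase (n + 1), IsRealSympl R ∧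
      ∀ᶠ y in 𝓝 p, lift φ' F' y = R (lift φ F y) := by
  obtain ⟨u₁, h₁, rfl, hg₁⟩ := h.mem_leaf _ hp
  obtain ⟨u₂, h₂, hp₂, hg₂⟩ := h'.mem_leaf _ hp'
  obtain ⟨x, hx, hev⟩ := SKBundle.exists_realSubgroup hE hol h₁ h₂ hp₂.symm hg₁ hg₂
  exact ⟨x.linear, isRealSympl_linear hx, hev.mono fun r hr => lift_smul hr⟩

theorem IsLeafPair.exists_linear_conification (hE : Module.finrank ℂ E = n) {u : SKBundle n S}
    (hol : holonomy u ⊆ (realSubgroup n : Set (GSK n))) {V : Set M} (h : IsLeafPair u U φ F)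
    (h' : IsLeafPair u V φ' F') {D : TopologicalSpace.Opens M} {q : ℂˣ × D}
    (hq : (q.2 : M) ∈ U) (hq' : (q.2 : M) ∈ V) :
    ∃ R : Phase (n + 1) →L[ℂ] Phase (n + 1), IsRealSympl R ∧
      ∀ᶠ r in 𝓝 q, conification (fun p : D => φ' p) (fun p : D => F' p) r =
        R (conification (fun p : D => φ p) (fun p : D => F p) r) := by
  obtain ⟨R, hR, hev⟩ := h.exists_linear hE hol h' hq hq'
  refine ⟨R, hR, ?_⟩
  have hc : Continuous fun r : ℂˣ × D => (r.2 : M) := continuous_subtype_val.comp continuous_snd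
  filter_upwards [hc.continuousAt.eventually hev] with r hr
  rw [conification_val, conification_val, map_smul]
  exact congrArg _ hr

/-- The conifications of the continuations of `u`. -/
def conicalAtlas (hE : Module.finrank ℂ E = n) (u : SKBundle n S)
    (hol : holonomy u ⊆ (realSubgroup n : Set (GSK n))) :
    LagrangianAtlas (n + 1) (ℂ × E) (ℂˣ × domain u) where
  U q := {r | (r.2 : M) ∈ (exists_leafPair u q.2).choose.1}
  φ q := conification (fun p : domain u => (exists_leafPair u q.2).choose.2.1 p)
    (fun p : domain u => (exists_leafPair u q.2).choose.2.2 p)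
  isOpen q := (exists_leafPair u q.2).choose_spec.2.1.isOpen.preimage
    (continuous_subtype_val.comp continuous_snd)
  mem q := (exists_leafPair u q.2).choose_spec.1
  isKahlerianLagrangian q :=
    (exists_leafPair u q.2).choose_spec.2.2.isKahlerianLagrangian_conification
  compatible q _ hr := (exists_leafPair u _).choose_spec.2.1.exists_linear_conification hE hol
    (exists_leafPair u q.2).choose_spec.2.1 (exists_leafPair u _).choose_spec.1 hr

theorem isEuler_eulerField (hE : Module.finrank ℂ E = n) (u : SKBundle n S)
    (hol : holonomy u ⊆ (realSubgroup n : Set (GSK n))) :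
    (conicalAtlas hE u hol).IsEuler (eulerField (domain u)) where
  dR_eq q := by
    filter_upwards [((conicalAtlas hE u hol).isOpen q).mem_nhds ((conicalAtlas hE u hol).mem q)]
      with r hr
    exact dR_conification_eulerField
      (exists_leafPair u q.2).choose_spec.2.2.toIsSpecialKahlerPair hr
  norm_ne_zero q := by
    have h := (exists_leafPair u q.2).choose_spec
    exact h.2.2.norm_ne_zero (q.1, (q.2 : M)) h.1

theorem finrank_prod_complex (hE : Module.finrank ℂ E = n) :
    Module.finrank ℂ (ℂ × E) = n + 1 := by
  rw [Module.finrank_prod, hE, Module.finrank_self, add_comm]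

/-- The conical affine special Kähler structure on `ℂˣ × dom u`. -/
def conicalStructure (hE : Module.finrank ℂ E = n) (u : SKBundle n S)
    (hol : holonomy u ⊆ (realSubgroup n : Set (GSK n))) :
    ConicalAffineSpecialKahler (ℂ × E) (ℂˣ × domain u) :=
  (isEuler_eulerField hE u hol).conical (finrank_prod_complex hE)

/-- Non-degeneracy of the pair itself need not be assumed: near every point its conification is a
real symplectic image of an immersion of the atlas, and being Kählerian Lagrangian and inducing the
structure both pass to such images. -/
theorem IsLeafPair.isKahlerianLagrangian (hE : Module.finrank ℂ E = n) {u : SKBundle n S}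
    (hol : holonomy u ⊆ (realSubgroup n : Set (GSK n))) (h : IsLeafPair u U φ F) :
    IsKahlerianLagrangian (ℂ × E) {q : ℂˣ × domain u | (q.2 : M) ∈ U}
        (conification (fun p : domain u => φ p) (fun p : domain u => F p)) ∧
      (conicalStructure hE u hol).toAffineSpecialKahler.IsInducedBy
        {q : ℂˣ × domain u | (q.2 : M) ∈ U}
        (conification (fun p : domain u => φ p) (fun p : domain u => F p)) := by
  have key : ∀ q ∈ {q : ℂˣ × domain u | (q.2 : M) ∈ U},
      ∃ R : Phase (n + 1) →L[ℂ] Phase (n + 1), IsRealSympl R ∧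
        ∀ᶠ r in 𝓝 q, conification (fun p : domain u => φ p) (fun p : domain u => F p) r =
          R ((conicalAtlas hE u hol).φ q r) := fun q hq =>
    (exists_leafPair u q.2).choose_spec.2.1.exists_linear_conification hE hol h
      (exists_leafPair u q.2).choose_spec.1 hq
  have h1 : IsKahlerianLagrangian (ℂ × E) {q : ℂˣ × domain u | (q.2 : M) ∈ U}
      (conification (fun p : domain u => φ p) (fun p : domain u => F p)) := by
    have h2 : ∀ q ∈ {q : ℂˣ × domain u | (q.2 : M) ∈ U}, IsKahlerianLagrangian (ℂ × E) {q}
        (conification (fun p : domain u => φ p) (fun p : domain u => F p)) := by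
      intro q hq
      obtain ⟨R, hR, hev⟩ := key q hq
      exact LagrangianAtlas.isKahlerianLagrangian_of_eventuallyEq hR hev
    exact ⟨fun q hq => (h2 q hq).holomorphic q rfl, fun q hq => (h2 q hq).immersion q rfl,
      fun q hq => (h2 q hq).lagrangian q rfl, fun q hq => (h2 q hq).kahlerian q rfl⟩
  refine ⟨h1, ((conicalStructure hE u hol).isInducedBy_iff (h.isOpen.preimage
    (continuous_subtype_val.comp continuous_snd)) h1).2 fun q hq => ?_⟩
  obtain ⟨R, hR, hev⟩ := key q hq
  exact LagrangianAtlas.inducesAt_of_eventuallyEq (finrank_prod_complex hE) hR hev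

end ConicalStructure

/-! ### The Hermitian form of the projective metric. -/

section ProjectiveForm

/-- The Hermitian form on `ℂ²ⁿ`, for `γ(A, A) ≠ 0`, that descends to the projective space. -/
def projHerm (A b c : Phase n) : ℂ :=
  -herm b c / herm A A + herm b A * herm A c / herm A A ^ 2

variable (n) in
/-- The bilinear form `½ Re γ(·, √-1 ·)`. -/
def metricFormI : Phase n →L[ℝ] Phase n →L[ℝ] ℝ :=
  (metricForm n).bilinearComp (ContinuousLinearMap.id ℝ (Phase n))
    (Complex.I • ContinuousLinearMap.id ℝ (Phase n))

theorem metricFormI_apply (a b : Phase n) : metricFormI n a b = metricForm n a (Complex.I • b) :=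
  rfl

theorem metricFormI_eq (a b : Phase n) : metricFormI n a b = 1 / 2 * (herm a b).im := by
  rw [metricFormI_apply, metricForm_apply, herm_smul_right]
  simp

/-- The real part of `projHerm`. -/
def projForm (A : Phase n) : Phase n →L[ℝ] Phase n →L[ℝ] ℝ :=
  -(metricForm n A A)⁻¹ • metricForm n + ((metricForm n A A) ^ 2)⁻¹ •
    ((metricForm n A).smulRight (metricForm n A) + (metricFormI n A).smulRight (metricFormI n A))

theorem projForm_apply' (A b c : Phase n) : projForm A b c =
    - metricForm n b c / metricForm n A A +
      (metricForm n A b * metricForm n A c + metricFormI n A b * metricFormI n A c)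
        / metricForm n A A ^ 2 := by
  simp only [projForm, add_apply, smul_apply, ContinuousLinearMap.smulRight_apply, smul_eq_mul]
  ring

theorem herm_self_eq (A : Phase n) : herm A A = ((2 * metricForm n A A : ℝ) : ℂ) := by
  rw [metricForm_apply]
  apply Complex.ext
  · simp
  · simpa using herm_self_im A

theorem projForm_apply (A b c : Phase n) : projForm A b c = (projHerm A b c).re := by
  have h1 : (herm A A ^ 2) = (((2 * metricForm n A A) ^ 2 : ℝ) : ℂ) := by
    rw [herm_self_eq]; push_cast; ring
  rw [projHerm, h1, herm_self_eq, Complex.add_re, Complex.div_ofReal_re, Complex.div_ofReal_re,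
    herm_swap b A, Complex.mul_re, Complex.conj_re, Complex.conj_im, projForm_apply',
    metricFormI_eq, metricFormI_eq, metricForm_apply b c, metricForm_apply A b,
    metricForm_apply A c, Complex.neg_re]
  generalize metricForm n A A = k
  rcases eq_or_ne k 0 with rfl | hk
  · simp
  · field_simp
    ring

theorem contDiffAt_real_smul {W V : Type*} [NormedAddCommGroup W] [NormedSpace ℝ W]
    [NormedAddCommGroup V] [NormedSpace ℝ V] {f : W → ℝ} {g : W → V} {A : W}
    (hf : ContDiffAt ℝ ∞ f A) (hg : ContDiffAt ℝ ∞ g A) :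
    ContDiffAt ℝ ∞ (fun x => f x • g x) A := hf.smul hg

theorem contDiffAt_rankTwo_form {W : Type*} [NormedAddCommGroup W] [NormedSpace ℝ W]
    (N N' : W →L[ℝ] W →L[ℝ] ℝ) {A : W} (hA : N A A ≠ 0) :
    ContDiffAt ℝ ∞ (fun A => -(N A A)⁻¹ • N + ((N A A) ^ 2)⁻¹ •
      ((N A).smulRight (N A) + (N' A).smulRight (N' A))) A := by
  have h1 : ContDiffAt ℝ ∞ (fun A => N A) A := N.contDiff.contDiffAt
  have h2 : ContDiffAt ℝ ∞ (fun A => N' A) A := N'.contDiff.contDiffAt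
  have h3 : ContDiffAt ℝ ∞ (fun A => N A A) A := h1.clm_apply contDiffAt_id
  exact (contDiffAt_real_smul (h3.inv hA).neg contDiffAt_const).add
    (contDiffAt_real_smul ((h3.pow 2).inv (pow_ne_zero 2 hA)) ((h1.smulRight h1).add (h2.smulRight h2)))

theorem contDiffAt_projForm {A : Phase n} (hA : metricForm n A A ≠ 0) :
    ContDiffAt ℝ ∞ (projForm (n := n)) A :=
  contDiffAt_rankTwo_form (metricForm n) (metricFormI n) hA

theorem projForm_symm (A b c : Phase n) : projForm A b c = projForm A c b := by
  rw [projForm_apply', projForm_apply', metricForm_apply b c, herm_swap b c, Complex.conj_re,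
    ← metricForm_apply]
  ring

theorem projHerm_I_left (A b c : Phase n) :
    projHerm A (Complex.I • b) c = Complex.I * projHerm A b c := by
  simp only [projHerm, herm_smul_left]
  ring

theorem projHerm_I_right (A b c : Phase n) :
    projHerm A b (Complex.I • c) = -Complex.I * projHerm A b c := by
  simp only [projHerm, herm_smul_right, Complex.conj_I]
  ring

theorem projForm_I (A b c : Phase n) :
    projForm A (Complex.I • b) (Complex.I • c) = projForm A b c := by
  rw [projForm_apply, projForm_apply, projHerm_I_left, projHerm_I_right]
  simp

theorem projForm_I_right (A b c : Phase n) :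
    projForm A b (Complex.I • c) = (projHerm A b c).im := by
  rw [projForm_apply, projHerm_I_right]
  simp

/-- The form vanishes when one argument is a multiple of A, and the factors |t|² of numerators and
denominators cancel; so it descends to the projective space. -/
theorem projHerm_invariant {A : Phase n} (hA : herm A A ≠ 0) {t : ℂ} (ht : t ≠ 0) (ζ η : ℂ)
    (b c : Phase n) :
    projHerm (t • A) (ζ • A + t • b) (η • A + t • c) = projHerm A b c := by
  have ht' : conj t ≠ 0 := by simpa using ht
  simp only [projHerm, herm_add_left, herm_add_right, herm_smul_left, herm_smul_right]
  field_simp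
  ring

theorem projForm_invariant {A : Phase n} (hA : herm A A ≠ 0) {t : ℂ} (ht : t ≠ 0) (ζ η : ℂ)
    (b c : Phase n) :
    projForm (t • A) (ζ • A + t • b) (η • A + t • c) = projForm A b c := by
  rw [projForm_apply, projForm_apply, projHerm_invariant hA ht]

theorem IsRealSympl.projForm_eq {R : Phase n →L[ℂ] Phase n} (hR : IsRealSympl R) (A b c : Phase n) :
    projForm (R A) (R b) (R c) = projForm A b c := by
  simp only [projForm_apply, projHerm, hR.herm_eq]

/-- The coefficient removes from b its component along A. What is left is orthogonal to A, and its
product with c is -γ(A, A) times `projHerm`. -/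
theorem herm_add_eq_zero {A b c : Phase n} (hA : herm A A ≠ 0) (h : projHerm A b c = 0) (η : ℂ) :
    herm ((-herm b A / herm A A) • A + b) (η • A + c) = 0 := by
  have h1 : -herm b c * herm A A + herm b A * herm A c = 0 := by
    rw [projHerm] at h
    field_simp at h
    linear_combination h
  simp only [herm_add_left, herm_add_right, herm_smul_left, herm_smul_right]
  field_simp
  linear_combination -h1

end ProjectiveForm

/-! ### The quotient tensor as a pulled back projective form. -/

section QuotientTensor
variable {E : Type*} [NormedAddCommGroup E] [NormedSpace ℂ E] [FiniteDimensional ℂ E]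
  {M : Type*} [TopologicalSpace M] [ChartedSpace E M] [IsManifold 𝓘(ℂ, E) ω M]
  {A : LagrangianAtlas n E M} {ξ : VField E M}

theorem metricForm_symm (a b : Phase n) : metricForm n a b = metricForm n b a := by
  rw [metricForm_apply, metricForm_apply, herm_swap, Complex.conj_re]

theorem LagrangianAtlas.IsEuler.potential_eq (h : A.IsEuler ξ) (hE : Module.finrank ℂ E = n)
    (x : M) : (h.conical hE).potential =ᶠ[𝓝 x] fun y => metricForm n (A.φ x y) (A.φ x y) := by
  filter_upwards [(affineCoordinatesAt hE x).metric, h.dR_eq x] with y h1 h2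
  have h3 := h1 (ξ y) (ξ y)
  rw [h2] at h3
  exact h3

/-- By dΦ(ξ) = Φ, the potential is the quadratic form `metricForm` evaluated on Φ. Differentiating
it produces a factor 2 in each of dK̂ and dK̂ ∘ J, so the products absorb the 4 in the denominator.
-/
theorem LagrangianAtlas.IsEuler.quotientTensor_eq (h : A.IsEuler ξ) (hE : Module.finrank ℂ E = n)
    (x : M) (v w : TangentSpace 𝓘(ℝ, E) x) : (h.conical hE).quotientTensor x v w =
      projForm (A.φ x x) (dR (A.φ x) x v) (dR (A.φ x) x w) := by
  have hc := affineCoordinatesAt (A := A) hE x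
  have hp := h.potential_eq hE x
  have hd := hc.smooth.mdifferentiableAt (by simp)
  have h1 (v : TangentSpace 𝓘(ℝ, E) x) : dR (h.conical hE).potential x v =
      2 * metricForm n (A.φ x x) (dR (A.φ x) x v) := by
    rw [dR_congr hp, dR_bilin (metricForm n) hd hd, metricForm_symm (dR (A.φ x) x v)]
    ring
  have h2 : (h.conical hE).g x v w = metricForm n (dR (A.φ x) x v) (dR (A.φ x) x w) :=
    hc.metric.self_of_nhds v w
  rw [ConicalAffineSpecialKahler.quotientTensor, h1, h1, h1, h1, h2, hp.self_of_nhds,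
    hc.dR_J.self_of_nhds, hc.dR_J.self_of_nhds, projForm_apply', metricFormI_apply,
    metricFormI_apply]
  congr 1
  field_simp
  ring

end QuotientTensor

/-! ### Pseudo-Kähler metrics from lifts to the projective space. -/

section ProjectiveAtlas
variable {E : Type*} [NormedAddCommGroup E] [NormedSpace ℂ E] [FiniteDimensional ℂ E]
  {M : Type*} [TopologicalSpace M] [ChartedSpace E M] [IsManifold 𝓘(ℂ, E) ω M]

theorem metricFormI_swap (a b : Phase n) : metricFormI n a b = - metricFormI n b a := by
  rw [metricFormI_eq, metricFormI_eq, herm_swap, Complex.conj_im]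
  ring

/-- If γ(A, b) and γ(A, c) are purely imaginary, their contribution γ(b, A)γ(A, c) is real. The
imaginary part is then a constant form up to the factor γ(A, A). -/
theorem im_projHerm_of_normalized {A b c : Phase n} (hb : metricForm n A b = 0)
    (hc : metricForm n A c = 0) :
    (projHerm A b c).im = (-(metricForm n A A)⁻¹ • metricFormI n) b c := by
  have h1 : (herm A A ^ 2) = (((2 * metricForm n A A) ^ 2 : ℝ) : ℂ) := by
    rw [herm_self_eq]; push_cast; ring
  have hb' : (herm A b).re = 0 := by rw [metricForm_apply] at hb; linarith
  have hc' : (herm A c).re = 0 := by rw [metricForm_apply] at hc; linarith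
  rw [projHerm, h1, herm_self_eq, Complex.add_im, Complex.div_ofReal_im, Complex.div_ofReal_im,
    herm_swap b A, Complex.mul_im, Complex.conj_re, Complex.conj_im, hb', hc', Complex.neg_im]
  simp only [smul_apply, smul_eq_mul, metricFormI_eq]
  generalize metricForm n A A = k
  rcases eq_or_ne k 0 with rfl | hk
  · simp
  · field_simp
    ring

omit [FiniteDimensional ℂ E] [IsManifold 𝓘(ℂ, E) ω M] in
/-- A holomorphic lift can be rescaled near a point so that its norm becomes constant. -/
theorem exists_normalized_lift {A : M → Phase n} {x : M}
    (hA : ContMDiffAt 𝓘(ℝ, E) 𝓘(ℝ, Phase n) ∞ A x) (hx : metricForm n (A x) (A x) ≠ 0) :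
    ∃ ρ : M → ℝ, ContMDiffAt 𝓘(ℝ, E) 𝓘(ℝ, ℝ) ∞ ρ x ∧ ∀ᶠ y in 𝓝 x, ρ y ≠ 0 ∧
      metricForm n (ρ y • A y) (ρ y • A y) = metricForm n (A x) (A x) := by
  set k : M → ℝ := fun y => metricForm n (A y) (A y) with hk
  have hks : ContMDiffAt 𝓘(ℝ, E) 𝓘(ℝ, ℝ) ∞ k x :=
    (contMDiffAt_clm_comp (metricForm n) hA).clm_apply hA
  have h1 : k x / k x = 1 := div_self hx
  -- Dividing by the value at x makes the radicand positive near x whichever sign the norm has.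
  have h2 : ContDiffAt ℝ ∞ (fun t : ℝ => (√(t / k x))⁻¹) (k x) := by
    refine ContDiffAt.inv (ContDiffAt.sqrt (contDiffAt_id.div_const _) ?_) ?_
    · simp [h1]
    · simp [h1]
  have h3 : ContinuousAt (fun y => k y / k x) x := hks.continuousAt.div_const _
  refine ⟨fun y => (√(k y / k x))⁻¹, h2.comp_contMDiffAt hks, ?_⟩
  filter_upwards [h3.eventually (lt_mem_nhds (by rw [h1]; exact one_pos : (0 : ℝ) < k x / k x))]
    with y hy
  have h4 : √(k y / k x) ≠ 0 := (Real.sqrt_pos.2 hy).ne'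
  refine ⟨inv_ne_zero h4, ?_⟩
  have h5 : √(k y / k x) ^ 2 = k y / k x := Real.sq_sqrt hy.le
  have h6 : k y ≠ 0 := fun h0 => by simp [h0] at hy
  change _ = k x
  rw [map_smul, map_smul, smul_apply, smul_eq_mul, smul_eq_mul, ← mul_assoc, ← pow_two, inv_pow, h5]
  change (k y / k x)⁻¹ * k y = k x
  field_simp

variable (n E M) in
/-- An atlas of holomorphic lifts, with values in `{A | γ(A, A) ≠ 0} ⊆ ℂ²ⁿ`, of maps to the
projective space, that differ locally by real symplectic maps. -/
structure ProjectiveAtlas where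
  U : M → Set M
  ψ : M → M → Phase n
  isOpen : ∀ x, IsOpen (U x)
  mem : ∀ x, x ∈ U x
  holomorphic : ∀ x, ∀ y ∈ U x, MDifferentiableAt 𝓘(ℂ, E) 𝓘(ℂ, Phase n) (ψ x) y
  norm_ne_zero : ∀ x, ∀ y ∈ U x, herm (ψ x y) (ψ x y) ≠ 0
  compatible : ∀ x, ∀ y ∈ U x, ∃ R : Phase n →L[ℂ] Phase n, IsRealSympl R ∧
    ∀ᶠ z in 𝓝 y, ψ x z = R (ψ y z)
  nondeg : ∀ x, ∀ v : TangentSpace 𝓘(ℝ, E) x, (∀ w : TangentSpace 𝓘(ℝ, E) x,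
    projForm (ψ x x) (dR (ψ x) x v) (dR (ψ x) x w) = 0) → v = 0

namespace ProjectiveAtlas

variable (A : ProjectiveAtlas n E M)

/-- The metric induced by the projective metric. -/
def metric : BilinField E M := fun x =>
  ((projForm (A.ψ x x)).bilinearComp (dR (E := E) (A.ψ x) x : E →L[ℝ] Phase n)
    (dR (E := E) (A.ψ x) x : E →L[ℝ] Phase n) : E →L[ℝ] E →L[ℝ] ℝ)

omit [FiniteDimensional ℂ E] [IsManifold 𝓘(ℂ, E) ω M] in
theorem metric_apply (x : M) (v w : TangentSpace 𝓘(ℝ, E) x) :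
    A.metric x v w = projForm (A.ψ x x) (dR (A.ψ x) x v) (dR (A.ψ x) x w) := rfl

omit [FiniteDimensional ℂ E] [IsManifold 𝓘(ℂ, E) ω M] in
theorem metric_of_mem {x y : M} (hy : y ∈ A.U x) (v w : TangentSpace 𝓘(ℝ, E) y) :
    A.metric y v w = projForm (A.ψ x y) (dR (A.ψ x) y v) (dR (A.ψ x) y w) := by
  obtain ⟨R, hR, h⟩ := A.compatible x y hy
  have h1 (v : TangentSpace 𝓘(ℝ, E) y) : dR (A.ψ x) y v = R (dR (A.ψ y) y v) :=
    dR_comp_real (c := 0) (mdifferentiableAt_real (A.holomorphic y y (A.mem y)))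
      (h.mono fun _ hz => hz.trans (add_zero _).symm) v
  rw [h1, h1, h.self_of_nhds, hR.projForm_eq, metric_apply]

theorem contMDiffAt_lift (x : M) : ContMDiffAt 𝓘(ℝ, E) 𝓘(ℝ, Phase n) ∞ (A.ψ x) x :=
  contMDiffAt_real_of_holomorphic
    (mem_of_superset ((A.isOpen x).mem_nhds (A.mem x)) (A.holomorphic x))

omit [FiniteDimensional ℂ E] [IsManifold 𝓘(ℂ, E) ω M] in
theorem metricForm_ne_zero (x : M) : metricForm n (A.ψ x x) (A.ψ x x) ≠ 0 := by
  have h := A.norm_ne_zero x x (A.mem x)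
  rw [herm_self_eq] at h
  intro h0
  exact h (by simp [h0])

/-- The fundamental form of the metric is the pull-back of a constant form. -/
theorem exists_form_eq (x : M) : ∃ (B : Phase n →L[ℝ] Phase n →L[ℝ] ℝ) (f : M → Phase n),
    (∀ a b, B a b = - B b a) ∧ ContMDiffAt 𝓘(ℝ, E) 𝓘(ℝ, Phase n) ∞ f x ∧
      ∀ᶠ y in 𝓝 x, ∀ v w, A.metric y v (cplxJ y w) = B (dR f y v) (dR f y w) := by
  obtain ⟨ρ, hρ, hev⟩ := exists_normalized_lift (A.contMDiffAt_lift x) (A.metricForm_ne_zero x)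
  have hf : ContMDiffAt 𝓘(ℝ, E) 𝓘(ℝ, Phase n) ∞ (fun y => ρ y • A.ψ x y) x :=
    hρ.smul (A.contMDiffAt_lift x)
  refine ⟨-(metricForm n (A.ψ x x) (A.ψ x x))⁻¹ • metricFormI n, fun y => ρ y • A.ψ x y,
    fun a b => ?_, hf, ?_⟩
  · simp only [smul_apply]
    rw [metricFormI_swap, smul_neg]
  have hρd := (contMDiffAt_iff_contMDiffAt_nhds (by simp)).1 (hρ.of_le (m := 1) (by simp))
  have hfd := (contMDiffAt_iff_contMDiffAt_nhds (by simp)).1 (hf.of_le (m := 1) (by simp))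
  filter_upwards [hev.eventually_nhds, hρd, hfd, (A.isOpen x).mem_nhds (A.mem x)]
    with y hy hρy hfy hyU v w
  have hψ := A.holomorphic x y hyU
  have hdf (v : TangentSpace 𝓘(ℝ, E) y) : dR (fun y => ρ y • A.ψ x y) y v =
      ((dR ρ y v : ℝ) : ℂ) • A.ψ x y + ((ρ y : ℝ) : ℂ) • dR (A.ψ x) y v := by
    rw [dR_smul (hρy.mdifferentiableAt one_ne_zero) (mdifferentiableAt_real hψ), Complex.coe_smul,
      Complex.coe_smul, add_comm]
  -- The rescaled lift f has constant norm, so df is orthogonal to f for the real metric.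
  have hn (v : TangentSpace 𝓘(ℝ, E) y) :
      metricForm n (ρ y • A.ψ x y) (dR (fun y => ρ y • A.ψ x y) y v) = 0 := by
    have hd := hfy.mdifferentiableAt one_ne_zero
    have h1 := dR_bilin (metricForm n) hd hd v
    rw [dR_congr (hy.mono fun _ h => h.2), dR_const, zero_apply, metricForm_symm (dR _ y v)] at h1
    linarith
  have h1 := im_projHerm_of_normalized (hn v) (hn w)
  rw [hy.self_of_nhds.2] at h1
  -- The rescaling changes the lift by ρ and its derivative by radial terms, neither of which
  -- affects `projHerm`.
  rw [← h1, hdf, hdf, ← Complex.coe_smul, projHerm_invariant (A.norm_ne_zero x y hyU)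
    (Complex.ofReal_ne_zero.2 hy.self_of_nhds.1), A.metric_of_mem hyU, dR_cplxJ hψ,
    projForm_I_right]

/-- The pseudo-Kähler metric of an atlas of holomorphic lifts. -/
def pseudoKahler : PseudoKahler E M where
  g := A.metric
  smooth x := by
    refine contMDiffAt_bilin_dR (A.contMDiffAt_lift x) (C := fun y => projForm (A.ψ x y))
      ((contDiffAt_projForm (A.metricForm_ne_zero x)).comp_contMDiffAt (A.contMDiffAt_lift x)) ?_
    filter_upwards [(A.isOpen x).mem_nhds (A.mem x)] with y hy using A.metric_of_mem hy
  symm x v w := projForm_symm _ _ _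
  nondeg x v hv := A.nondeg x v hv
  invariant x v w := by
    have h := A.holomorphic x x (A.mem x)
    rw [metric_apply, dR_cplxJ h, dR_cplxJ h, projForm_I, metric_apply]
  closed X Y Z x hX hY hZ := by
    obtain ⟨B, f, hB, hf, hev⟩ := A.exists_form_eq x
    have h1 (Y Z : VField E M) : (fun y => A.metric y (Y y) (cplxJ y (Z y))) =ᶠ[𝓝 x] fun y =>
        B (dR f y (Y y)) (dR f y (Z y)) := by
      filter_upwards [hev] with y hy
      rw [hy]
    rw [dR_congr (h1 Y Z), dR_congr (h1 Z X), dR_congr (h1 X Y), hev.self_of_nhds,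
      hev.self_of_nhds, hev.self_of_nhds]
    exact closed_pullback_const B hB (hf.of_le two_le_infty) hX hY hZ

end ProjectiveAtlas
end ProjectiveAtlas

/-! ### The projective special Kähler quotient. -/

section Quotient
variable {E : Type*} [NormedAddCommGroup E] [NormedSpace ℂ E]
  {M : Type*} [TopologicalSpace M] [ChartedSpace E M] [IsManifold 𝓘(ℂ, E) ω M]
  {S : AffineSpecialKahler E M} {U : Set M} {φ : M → Phase n} {F : M → ℂ}

/-- For such v, subtracting the component of dΨ(v) along Ψ gives a vector in the image of dΦ at (1,
p) that is γ̂-orthogonal to this image. Non-degeneracy of Φ^*γ̂ forces v = 0. -/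
theorem IsNondegeneratePair.eq_zero_of_projForm (h : IsNondegeneratePair S U φ F) {p : M}
    (hp : p ∈ U) {v : TangentSpace 𝓘(ℝ, E) p} (hv : ∀ w : TangentSpace 𝓘(ℝ, E) p,
      projForm (lift φ F p) (dR (lift φ F) p v) (dR (lift φ F) p w) = 0) : v = 0 := by
  have hs := h.toIsSpecialKahlerPair
  -- Applying the hypothesis to Jw supplies the imaginary part.
  have h1 (w : TangentSpace 𝓘(ℝ, E) p) :
      projHerm (lift φ F p) (dR (lift φ F) p v) (dR (lift φ F) p w) = 0 := by
    refine Complex.ext ?_ ?_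
    · rw [← projForm_apply, hv, Complex.zero_re]
    · rw [← projForm_I_right, ← dR_cplxJ (hs.mdifferentiableAt_lift hp), hv, Complex.zero_im]
  set ζ : ℂ := -herm (dR (lift φ F) p v) (lift φ F p) / herm (lift φ F p) (lift φ F p) with hζ
  have h2 (w : ℂ × E) : dR (E := ℂ × E) (conification φ F) ((1 : ℂˣ), p) w =
      w.1 • lift φ F p + dR (E := E) (lift φ F) p w.2 := by
    have h3 := hs.dR_conification (q := ((1 : ℂˣ), p)) hp w
    rwa [Units.val_one, one_smul] at h3
  have h3 : ((ζ, v) : ℂ × E) = 0 := by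
    refine h.kahlerian ((1 : ℂˣ), p) hp (ζ, v) fun w => ?_
    exact (congrArg₂ herm (h2 (ζ, v)) (h2 w)).trans
      (herm_add_eq_zero (h.herm_lift_ne_zero hp) (h1 _) _)
  exact congrArg Prod.snd h3

variable {D : TopologicalSpace.Opens M}

omit [IsManifold 𝓘(ℂ, E) ω M] in
theorem mdifferentiable_act :
    MDifferentiable 𝓘(ℂ, ℂ × (ℂ × E)) 𝓘(ℂ, ℂ × E)
      (fun q : ℂˣ × (ℂˣ × D) => (q.1 * q.2.1, q.2.2)) := by
  intro q
  have h1 := (hasMFDerivAt_snd_units (E := ℂ × E) q)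
  have h2 := (hasMFDerivAt_fst_units (E := E) q.2).comp q h1
  have h3 := (hasMFDerivAt_snd_units (E := E) q.2).comp q h1
  have h4 : MDifferentiableAt 𝓘(ℂ, ℂ × (ℂ × E)) 𝓘(ℂ, ℂ)
      (fun q : ℂˣ × (ℂˣ × D) => q.1 * q.2.1) q := by
    have h5 := ((contMDiff_mul 𝓘(ℂ, ℂ) 1 (G := ℂˣ)).mdifferentiable one_ne_zero) (q.1, q.2.1)
    exact h5.comp q ((hasMFDerivAt_fst_units (E := ℂ × E) q).mdifferentiableAt.prodMk
      h2.mdifferentiableAt)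
  exact (hasMFDerivAt_prodMk_units h4.hasMFDerivAt h3).mdifferentiableAt

omit [IsManifold 𝓘(ℂ, E) ω M] in
theorem mfderiv_orbit (q : ℂˣ × D) (c : ℂ) :
    mfderiv 𝓘(ℝ, ℂ) 𝓘(ℝ, ℂ × E) (fun a : ℂˣ => (a * q.1, q.2)) 1 c =
      c.re • eulerField D (1 * q.1, q.2) +
        c.im • cplxJ (1 * q.1, q.2) (eulerField D (1 * q.1, q.2)) := by
  have h1 := hasMFDerivAt_real (hasMFDerivAt_prodMk_units (hasMFDerivAt_units_mul 1 q.1)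
    (hasMFDerivAt_const (I := 𝓘(ℂ, ℂ)) (I' := 𝓘(ℂ, E)) q.2 (1 : ℂˣ)))
  refine (DFunLike.congr_fun h1.mfderiv c).trans ?_
  have h2 : (((q.1 : ℂ) * c, (0 : E)) : ℂ × E) =
      c.re • (((1 * q.1 : ℂˣ) : ℂ), (0 : E)) + c.im • Complex.I • (((1 * q.1 : ℂˣ) : ℂ), (0 : E)) := by
    refine Prod.ext ?_ (by simp)
    simp only [one_mul, Prod.fst_add, Prod.smul_fst, smul_eq_mul, Complex.real_smul]
    conv_lhs => rw [← Complex.re_add_im c]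
    ring
  exact h2

omit [IsManifold 𝓘(ℂ, E) ω M] in
theorem mfderiv_snd_units (q : ℂˣ × D) (w : ℂ × E) :
    mfderiv 𝓘(ℝ, ℂ × E) 𝓘(ℝ, E) (fun q : ℂˣ × D => q.2) q w = w.2 :=
  DFunLike.congr_fun (hasMFDerivAt_real (hasMFDerivAt_snd_units q)).mfderiv w

variable [FiniteDimensional ℂ E]

/-- The lifts of the continuations of `u`. -/
def projectiveAtlas (hE : Module.finrank ℂ E = n) (u : SKBundle n S)
    (hol : holonomy u ⊆ (realSubgroup n : Set (GSK n))) :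
    ProjectiveAtlas (n + 1) E (domain u) where
  U p := {r | (r : M) ∈ (exists_leafPair u p).choose.1}
  ψ p r := lift (exists_leafPair u p).choose.2.1 (exists_leafPair u p).choose.2.2 r
  isOpen p := (exists_leafPair u p).choose_spec.2.1.isOpen.preimage continuous_subtype_val
  mem p := (exists_leafPair u p).choose_spec.1
  holomorphic p _ hr := mdifferentiableAt_comp_val
    ((exists_leafPair u p).choose_spec.2.1.pair.mdifferentiableAt_lift hr)
  norm_ne_zero p _ hr := (exists_leafPair u p).choose_spec.2.2.herm_lift_ne_zero hr
  compatible p r hr := by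
    obtain ⟨R, hR, hev⟩ := (exists_leafPair u r).choose_spec.2.1.exists_linear hE hol
      (exists_leafPair u p).choose_spec.2.1 (exists_leafPair u r).choose_spec.1 hr
    exact ⟨R, hR, continuous_subtype_val.continuousAt.eventually hev⟩
  nondeg p v hv := by
    have h := (exists_leafPair u p).choose_spec
    have hd (w : E) := dR_comp_val (mdifferentiableAt_real (h.2.1.pair.mdifferentiableAt_lift h.1)) w
    refine h.2.2.eq_zero_of_projForm h.1 fun w => ?_
    exact (congrArg₂ (fun b c => projForm _ b c) (hd v) (hd w)).symm.trans (hv w)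

/-- At (z⁰, p) one has Φ = z⁰Ψ and dΦ = dz⁰ Ψ + z⁰ dΨ; the invariance of the projective form removes
both z⁰ and the radial term. -/
theorem quotientTensor_eq_pullback (hE : Module.finrank ℂ E = n) (u : SKBundle n S)
    (hol : holonomy u ⊆ (realSubgroup n : Set (GSK n))) (q : ℂˣ × domain u) (v w : ℂ × E) :
    (projectiveAtlas hE u hol).metric q.2 v.2 w.2 =
      (conicalStructure hE u hol).quotientTensor q v w := by
  have h := (exists_leafPair u q.2).choose_spec
  have hd (w : E) := dR_comp_val (mdifferentiableAt_real (h.2.1.pair.mdifferentiableAt_lift h.1)) w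
  have h1 := (isEuler_eulerField hE u hol).quotientTensor_eq (finrank_prod_complex hE) q v w
  refine Eq.trans ?_ h1.symm
  have hc (w : ℂ × E) := h.2.1.pair.dR_conification_val (D := domain u) (q := q) h.1 w
  refine Eq.trans ?_ (congrArg₂ (fun b c => projForm _ b c) (hc v) (hc w)).symm
  refine (congrArg₂ (fun b c => projForm _ b c) (hd v.2) (hd w.2)).trans ?_
  have he : (conicalAtlas hE u hol).φ q q = (q.1 : ℂ) • lift (exists_leafPair u q.2).choose.2.1
      (exists_leafPair u q.2).choose.2.2 (q.2 : M) :=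
    congrFun (conification_val (exists_leafPair u q.2).choose.2.1
      (exists_leafPair u q.2).choose.2.2) q
  rw [he]
  exact (projForm_invariant (h.2.2.herm_lift_ne_zero h.1) q.1.ne_zero _ _ _ _).symm

theorem isProjectiveQuotient (hE : Module.finrank ℂ E = n) (u : SKBundle n S)
    (hol : holonomy u ⊆ (realSubgroup n : Set (GSK n))) :
    (conicalStructure hE u hol).IsProjectiveQuotient (fun a q => (a * q.1, q.2)) (fun q => q.2)
      (projectiveAtlas hE u hol).pseudoKahler where
  act_one q := by rw [one_mul]
  act_mul a b q := by rw [mul_assoc]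
  act_holomorphic := mdifferentiable_act
  act_free a q h := by simpa using congrArg Prod.fst h
  generator := mfderiv_orbit
  pr_surjective p := ⟨(1, p), rfl⟩
  pr_holomorphic q := (hasMFDerivAt_snd_units q).mdifferentiableAt
  pr_submersion q v := ⟨((0, v) : ℂ × E), mfderiv_snd_units (E := E) q ((0, v) : ℂ × E)⟩
  pr_fibres q r := by
    refine ⟨fun h => ⟨r.1 * q.1⁻¹, Prod.ext (by simp) h.symm⟩, ?_⟩
    rintro ⟨a, rfl⟩
    rfl
  pullback q v w :=
    (congrArg₂ (fun b c => (projectiveAtlas hE u hol).metric q.2 b c) (mfderiv_snd_units q v)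
      (mfderiv_snd_units q w)).trans (quotientTensor_eq_pullback hE u hol q v w)

end Quotient

end SpecialKahler

end

open SpecialKahler in
theorem mainTheorem1 {n : ℕ}
    {E : Type*} [NormedAddCommGroup E] [NormedSpace ℂ E] [FiniteDimensional ℂ E]
    (hn : Module.finrank ℂ E = n)
    {M : Type*} [TopologicalSpace M] [T2Space M] [SecondCountableTopology M] [ConnectedSpace M]
    [ChartedSpace E M] [IsManifold 𝓘(ℂ, E) ω M]
    (S : AffineSpecialKahler E M) (u : SKBundle n S) (hu : u.IsNondegenerate)
    (hol : holonomy u ⊆ (realSubgroup n : Set (GSK n))) :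
    ∃ hopen : IsOpen (dom u),
      let D : TopologicalSpace.Opens M := ⟨dom u, hopen⟩
      ∃ T : ConicalAffineSpecialKahler (ℂ × E) (ℂˣ × D),
        (∀ (U : Set M) (φ : M → Phase n) (F : M → ℂ), IsOpen U → U ⊆ dom u →
          IsSpecialKahlerPair S U φ F →
          (∀ p ∈ U, ∃ u' ∈ horizontalLeaf u, u'.1 = p ∧ u'.IsGermOf φ F) →
          IsKahlerianLagrangian (ℂ × E) {q : ℂˣ × D | (q.2 : M) ∈ U}
              (conification (fun p : D => φ p) (fun p : D => F p)) ∧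
            T.toAffineSpecialKahler.IsInducedBy {q : ℂˣ × D | (q.2 : M) ∈ U}
              (conification (fun p : D => φ p) (fun p : D => F p))) ∧
        ∃ h : PseudoKahler E D,
          T.IsProjectiveQuotient (fun a q => (a * q.1, q.2)) (fun q => q.2) h := by
  refine ⟨SKBundle.isOpen_dom u, conicalStructure hn u hol, fun U φ F hU _ hF hleaf => ?_,
    (projectiveAtlas hn u hol).pseudoKahler, isProjectiveQuotient hn u hol⟩
  exact IsLeafPair.isKahlerianLagrangian hn hol ⟨hU, hF, hleaf⟩
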